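/- **Setting.** Fix $d\in\mathbb N$, $\eta>0$, a symmetric real $d\times d$ matrix $B$ and a smooth $H:\mathbb R^d\times\mathbb R^d\to\mathbb R$, $(U,W)\mapsto H(U,W)$. For a function $v$ on $\mathbb Z$ or $\mathbb R$ and a step $h$ let $T_hv=v(\cdot+h)$, $\widetilde D_h=\eta(T_h-\mathrm{Id})$, $\widetilde D_h^*=\eta(T_{-h}-\mathrm{Id})$, $D_h=\tfrac\eta2(T_h-T_{-h})$, $J_h=D_hB$ and $$\delta_hH[v]=\nabla_UH(v,\widetilde D_hv)+\widetilde D_h^*\,\nabla_WH(v,\widetilde D_hv).$$ Consider the Hamiltonian lattice system $\frac{d}{dt}U(t)=J_1\,\delta_1H[U(t)]$ for $U(t)=(U_j(t))_{j\in\mathbb Z}\in(\mathbb R^d)^{\mathbb Z}$. **Family of waves.** Let $N\ge1$ and $p_0=(\underline k,\underline M,\underline E)\in\mathbb R\times\mathbb R^d\times\mathbb R$ with $\underline k=1/N$. Let $u^{p}$ (one-periodic profiles $\mathbb R\to\mathbb R^d$) and $\omega(p)\in\mathbb R$ be defined for $p=(k,M,E)$ in an open neighborhood of $p_0$, smooth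 (in $(p,\zeta)$, resp. $p$), such that $U_j(t)=u^{p}(kj+\omega(p)t)$ solves the lattice system, $\int_0^1u^p=M$ and $\int_0^1H(u^p,\widetilde D_ku^p)=E$. Assume $\omega:=\omega(p_0)\ne0$. **Bloch evolution.** Let $A(t)$ be the linearization of $J_1\delta_1H$ about the wave of parameter $p_0$. For $\xi\in\mathbb R$ let $A_\xi(t)$ be its Bloch symbol, acting on $N$-periodic $\mathbb C^d$-valued sequences by $(A_\xi(t)f)_j=e^{-ij\xi}\big(A(t)(e^{i\,\cdot\,\xi}f)\big)_j$, and let $S_\xi(t,s)$ be the evolution system it generates: $S_\xi(s,s)=\mathrm{Id}$, $\partial_tS_\xi(t,s)=A_\xi(t)S_\xi(t,s)$. **Assumption A (non-degeneracy).** The generalized kernel of $S_0(1/\omega,0)-\mathrm{Id}$ is spanned by the sequences $(v(j/N))_j$ with $v\in\{\partial_\zeta u,\partial_{M_1}u,\dots,\partial_{M_d}u,\partial_Eu\}$ taken at $p_0$. **Whitham system.** Let $$F=\eta\int_0^1\delta_kH[u^p],\qquad S=\eta\int_0^1\Big(\tfrac12\,T_{-k}(\delta_kH[u^p])\cdot B\,\delta_kH[u^p]+T_{-k}\big(\nabla_WH(u^p,\widetilde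 D_ku^p)\big)\cdot J_k\,\delta_kH[u^p]\Big),$$ and consider the averaged system $\partial_Tk=\partial_X\omega$, $\partial_TM=B\,\partial_XF$, $\partial_TE=\partial_XS$ in the variables $(k,M,E)$. Let $\mathcal W$ be the Jacobian matrix of $(\omega,BF,S)$ with respect to $(k,M,E)$ at $p_0$, and let $a_1,\dots,a_{d+2}\in\mathbb C$ be its eigenvalues, listed with algebraic multiplicity (the characteristic speeds: the linearized system has solutions proportional to $e^{i\xi(X+a_\alpha T)}$). **Theorem 4.3.** There exist $\epsilon_0>0$, $\xi_0\in(0,\pi/N)$ and continuous curves $\lambda_\alpha:[-\xi_0,\xi_0]\to\mathbb C$, $\alpha=1,\dots,d+2$, such that $$\forall\xi\in[-\xi_0,\xi_0],\qquad\sigma\big(S_\xi(1/\omega,0)\big)\cap B(1,\epsilon_0)=\{\lambda_1(\xi),\dots,\lambda_{d+2}(\xi)\},$$ and, for every $\alpha$, as $\xi\to0$, $$\lambda_\alpha(\xi)=e^{\frac1\omega\,i\,\xi\,a_\alpha}+\mathcal O(|\xi|^{2})$$ whenever $a_\alpha$ is a semisimple eigenvalue of $\mathcal W$ (in particular a simple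 one) or an eigenvalue of algebraic multiplicity at most two; in general, the same holds with remainder $\mathcal O(|\xi|^{1+1/m})$, for $m$ the size of the largest Jordan block of $\mathcal W$ at $a_\alpha$. -/

import Mathlib

open Set Filter Topology MeasureTheory
open scoped Matrix ContDiff TensorProduct

noncomputable section

namespace HamLattice

/-! ### Discrete difference operators

They are written on functions on an additive group `G` with a step `h : G`, so that the same
definitions serve for sequences (`G = ℤ`, `h = 1`) and for profiles (`G = ℝ`, `h = k`). -/

section Differences

variable {G E : Type*} [AddCommGroup G] [AddCommGroup E] [Module ℝ E]

/-- The forward difference `η (T_h - Id)`. -/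
def fwd (η : ℝ) (h : G) (v : G → E) : G → E := fun x => η • (v (x + h) - v x)

/-- The adjoint `η (T_h⁻¹ - Id)` of the forward difference. -/
def fwdAdj (η : ℝ) (h : G) (v : G → E) : G → E := fun x => η • (v (x - h) - v x)

/-- The centered difference `(η / 2) (T_h - T_h⁻¹)`. -/
def ctr (η : ℝ) (h : G) (v : G → E) : G → E := fun x => (η / 2) • (v (x + h) - v (x - h))

end Differences

/-- The data of the Hamiltonian lattice system `dU/dt = J δH[U]`, `J = D B`: a smooth Hamiltonian
`H(U, D̃U)`, a symmetric matrix `B` and a mesh parameter `η > 0`, with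
`D = (η / 2) (T - T⁻¹)` and `D̃ = η (T - Id)`. -/
structure System (d : ℕ) where
  H : (Fin d → ℝ) × (Fin d → ℝ) → ℝ
  B : Matrix (Fin d) (Fin d) ℝ
  η : ℝ
  smooth : ContDiff ℝ ∞ H
  symm : B.IsSymm
  η_pos : 0 < η

namespace System

variable {d : ℕ} (L : System d)

/-- Gradient of `H` in its first argument. -/
def gradU (p : (Fin d → ℝ) × (Fin d → ℝ)) : Fin d → ℝ :=
  fun i => fderiv ℝ L.H p (Pi.single i 1, 0)

/-- Gradient of `H` in its second argument. -/
def gradW (p : (Fin d → ℝ) × (Fin d → ℝ)) : Fin d → ℝ :=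
  fun i => fderiv ℝ L.H p (0, Pi.single i 1)

section

variable {G : Type*} [AddCommGroup G]

/-- The pair `(v, D̃_h v)`, at which `H` and its derivatives are evaluated. -/
def jet (h : G) (v : G → Fin d → ℝ) : G → (Fin d → ℝ) × (Fin d → ℝ) :=
  fun x => (v x, fwd L.η h v x)

/-- Discrete Euler operator `δ_h H[v] = ∇_U H(v, D̃_h v) + D̃_h^* ∇_{D̃U} H(v, D̃_h v)`. -/
def euler (h : G) (v : G → Fin d → ℝ) : G → Fin d → ℝ :=
  fun x => L.gradU (L.jet h v x) + fwdAdj L.η h (fun y => L.gradW (L.jet h v y)) x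

/-- `J_h = D_h B`. -/
def J (h : G) (v : G → Fin d → ℝ) : G → Fin d → ℝ :=
  ctr L.η h (fun x => L.B *ᵥ v x)

end

/-- `U` solves the lattice system `dU/dt = J δH[U]`. -/
def IsSolution (U : ℝ → ℤ → Fin d → ℝ) : Prop :=
  ∀ (t : ℝ) (j : ℤ), HasDerivAt (fun s => U s j) (L.J 1 (L.euler 1 (U t)) j) t

end System

/-- The wave `U_j(t) = u(k j + w t)` of wavenumber `k` and time frequency `w` generated by a profile `u`. -/
def wave {d : ℕ} (k w : ℝ) (u : ℝ → Fin d → ℝ) : ℝ → ℤ → Fin d → ℝ :=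
  fun t j => u (k * j + w * t)

/-- Parameters `(k, M, E)`. -/
abbrev Param (d : ℕ) : Type := ℝ × (Fin d → ℝ) × ℝ

/-- A smooth family of periodic traveling waves, defined near `p₀` and parametrized by wavenumber,
averages of the components and averaged Hamiltonian. -/
structure WaveFamily {d : ℕ} (L : System d) (p₀ : Param d) where
  dom : Set (Param d)
  isOpen_dom : IsOpen dom
  mem_dom : p₀ ∈ dom
  /-- profile `u^{(k,M,E)}(ζ)` -/
  u : Param d → ℝ → Fin d → ℝ
  /-- time frequency `ω(k,M,E)` -/
  freq : Param d → ℝ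
  smooth_u : ContDiffOn ℝ ∞ (fun q : Param d × ℝ => u q.1 q.2) (dom ×ˢ univ)
  smooth_freq : ContDiffOn ℝ ∞ freq dom
  periodic : ∀ p ∈ dom, Function.Periodic (u p) 1
  isSolution : ∀ p ∈ dom, L.IsSolution (wave p.1 (freq p) (u p))
  mean_eq : ∀ p ∈ dom, ∫ ζ in (0 : ℝ)..1, u p ζ = p.2.1
  energy_eq : ∀ p ∈ dom, ∫ ζ in (0 : ℝ)..1, L.H (L.jet p.1 (u p) ζ) = p.2.2

namespace WaveFamily

variable {d : ℕ} {L : System d} {p₀ : Param d} (𝓕 : WaveFamily L p₀)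

/-! ### The averaged (Whitham) system

`∂_T k = ∂_X ω`, `∂_T M = B ∂_X F`, `∂_T E = ∂_X S`. -/

/-- `F = η ∫₀¹ δ_k H[u]`. -/
def F (p : Param d) : Fin d → ℝ :=
  L.η • ∫ ζ in (0 : ℝ)..1, L.euler p.1 (𝓕.u p) ζ

/-- `S = η ∫₀¹ ( ½ T_{-k}(δ_k H[u]) · B δ_k H[u] + T_{-k}(∇_{D̃U} H(u, D̃_k u)) · J_k δ_k H[u] )`. -/
def S (p : Param d) : ℝ :=
  L.η * ∫ ζ in (0 : ℝ)..1,
    ((1 / 2) * (L.euler p.1 (𝓕.u p) (ζ - p.1) ⬝ᵥ (L.B *ᵥ L.euler p.1 (𝓕.u p) ζ))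
      + L.gradW (L.jet p.1 (𝓕.u p) (ζ - p.1)) ⬝ᵥ L.J p.1 (L.euler p.1 (𝓕.u p)) ζ)

/-- The Whitham system is `∂_T p = ∂_X (whithamFlux p)` for `p = (k, M, E)`. -/
def whithamFlux (p : Param d) : Param d := (𝓕.freq p, L.B *ᵥ 𝓕.F p, 𝓕.S p)

/-- The linearized Whitham system about `p₀` is `∂_T q = whithamLin ∂_X q`; this is its
coefficient, seen as a complex endomorphism. -/
def whithamLin : Module.End ℂ (ℂ ⊗[ℝ] Param d) :=
  (fderiv ℝ 𝓕.whithamFlux p₀ : Param d →ₗ[ℝ] Param d).baseChange ℂ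

/-- `a₁, …, a_{d+2}` are the characteristic speeds of the linearized Whitham system, listed with
algebraic multiplicity: the modes `e^{iξ(X + a T)}` are solutions. -/
def IsCharacteristicSpeeds (a : Fin (d + 2) → ℂ) : Prop :=
  𝓕.whithamLin.charpoly = ∏ α, (Polynomial.X - Polynomial.C (a α))

end WaveFamily

/-! ### Linearization about a wave -/

namespace System

variable {d : ℕ} (L : System d)

/-- The Jacobian at `p` of `f : ℝ^d × ℝ^d → ℝ^d` in the first argument, as a complex matrix. -/
def jacU (f : (Fin d → ℝ) × (Fin d → ℝ) → Fin d → ℝ) (p : (Fin d → ℝ) × (Fin d → ℝ)) :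
    Matrix (Fin d) (Fin d) ℂ :=
  Matrix.of fun i l => ((fderiv ℝ f p (Pi.single l 1, 0) i : ℝ) : ℂ)

/-- The Jacobian at `p` of `f : ℝ^d × ℝ^d → ℝ^d` in the second argument, as a complex matrix. -/
def jacW (f : (Fin d → ℝ) × (Fin d → ℝ) → Fin d → ℝ) (p : (Fin d → ℝ) × (Fin d → ℝ)) :
    Matrix (Fin d) (Fin d) ℂ :=
  Matrix.of fun i l => ((fderiv ℝ f p (0, Pi.single l 1) i : ℝ) : ℂ)

/-- The differential at `U` of `f(U, D̃U)`, in the (complexified) direction `V`. -/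
def linJet (f : (Fin d → ℝ) × (Fin d → ℝ) → Fin d → ℝ) (U : ℤ → Fin d → ℝ)
    (V : ℤ → Fin d → ℂ) : ℤ → Fin d → ℂ :=
  fun j => jacU f (L.jet 1 U j) *ᵥ V j + jacW f (L.jet 1 U j) *ᵥ fwd L.η 1 V j

/-- The differential at `U` of the Euler operator `δH`, in the direction `V`. -/
def linEuler (U : ℤ → Fin d → ℝ) (V : ℤ → Fin d → ℂ) : ℤ → Fin d → ℂ :=
  fun j => L.linJet L.gradU U V j + fwdAdj L.η 1 (L.linJet L.gradW U V) j

/-- The linearization about `U` of the vector field `J δH`, acting on complex sequences. -/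
def linField (U : ℤ → Fin d → ℝ) : (ℤ → Fin d → ℂ) →ₗ[ℂ] (ℤ → Fin d → ℂ) where
  toFun V := ctr L.η 1 (fun j => L.B.map ((↑) : ℝ → ℂ) *ᵥ L.linEuler U V j)
  map_add' V W := by
    funext j
    simp only [ctr, linEuler, linJet, fwd, fwdAdj, Pi.add_apply, smul_sub, smul_add,
      Matrix.mulVec_add, Matrix.mulVec_sub, Matrix.mulVec_smul]
    abel
  map_smul' c V := by
    funext j
    simp only [ctr, linEuler, linJet, fwd, fwdAdj, Pi.smul_apply, smul_sub, smul_add,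
      Matrix.mulVec_add, Matrix.mulVec_sub, Matrix.mulVec_smul, RingHom.id_apply,
      smul_comm c]

end System

/-! ### Bloch symbols and the evolution they generate -/

/-- `N`-periodic `ℂ^d`-valued sequences. -/
abbrev PerSeq (d N : ℕ) : Type := ZMod N → Fin d → ℂ

/-- The Bloch symbol at `ξ` of an `N`-periodic operator `A` on sequences:
`(A_ξ f)_j = e^{-ijξ} (A (e^{i·ξ} f))_j`, for `j = 0, …, N - 1`, where `f` is extended
`N`-periodically. -/
def blochSymbol {d : ℕ} (N : ℕ) [NeZero N] (A : (ℤ → Fin d → ℂ) →ₗ[ℂ] (ℤ → Fin d → ℂ)) (ξ : ℝ) :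
    PerSeq d N →L[ℂ] PerSeq d N :=
  LinearMap.toContinuousLinearMap
    { toFun := fun f j => Complex.exp (-(Complex.I * (j.val : ℂ) * ξ)) •
        A (fun l : ℤ => Complex.exp (Complex.I * (l : ℂ) * ξ) • f (l : ZMod N)) (j.val : ℤ)
      map_add' := fun f g => by
        funext j
        have : (fun l : ℤ => Complex.exp (Complex.I * (l : ℂ) * ξ) • (f + g) (l : ZMod N))
            = (fun l : ℤ => Complex.exp (Complex.I * (l : ℂ) * ξ) • f (l : ZMod N))
              + fun l : ℤ => Complex.exp (Complex.I * (l : ℂ) * ξ) • g (l : ZMod N) := by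
          funext l; simp [smul_add]
        rw [this, map_add]
        simp only [Pi.add_apply, smul_add]
      map_smul' := fun c f => by
        funext j
        have : (fun l : ℤ => Complex.exp (Complex.I * (l : ℂ) * ξ) • (c • f) (l : ZMod N))
            = c • fun l : ℤ => Complex.exp (Complex.I * (l : ℂ) * ξ) • f (l : ZMod N) := by
          funext l; simp only [Pi.smul_apply]; rw [smul_comm]
        rw [this, map_smul]
        simp only [Pi.smul_apply, RingHom.id_apply]
        rw [smul_comm] }

/-- `S(t, s)` is the evolution system generated by `A(t)`:
`S(s, s) = Id` and `∂_t S(t, s) = A(t) S(t, s)`. -/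
def IsEvolutionSystem {R : Type*} [NormedRing R] [NormedSpace ℝ R] (A : ℝ → R)
    (S : ℝ → ℝ → R) : Prop :=
  ∀ s : ℝ, S s s = 1 ∧ ∀ t : ℝ, HasDerivAt (fun r => S r s) (A t * S t s) t

section Evolution

variable {R : Type*} [NormedRing R] [NormedSpace ℝ R]

/-- Successive terms of the Peano–Baker series of `A`, started at time `s`. -/
def peanoBaker (A : ℝ → R) (s : ℝ) : ℕ → ℝ → R
  | 0 => fun _ => 1
  | n + 1 => fun t => ∫ r in s..t, A r * peanoBaker A s n r

/-- The evolution system generated by `A`, as the sum of its Peano–Baker series. For continuous `A`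
it is the unique evolution system generated by `A`: see `isEvolutionSystem_evolution` and
`IsEvolutionSystem.unique`. -/
def evolution (A : ℝ → R) (t s : ℝ) : R := ∑' n, peanoBaker A s n t

theorem continuous_peanoBaker [CompleteSpace R] {A : ℝ → R} (hA : Continuous A) (s : ℝ) (n : ℕ) :
    Continuous (peanoBaker A s n) := by
  induction n with
  | zero => exact continuous_const
  | succ n ih =>
    exact intervalIntegral.continuous_primitive
      (fun a b => (hA.mul ih).intervalIntegrable a b) s

theorem hasDerivAt_peanoBaker [CompleteSpace R] {A : ℝ → R} (hA : Continuous A) (s : ℝ) (n : ℕ)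
    (t : ℝ) : HasDerivAt (peanoBaker A s (n + 1)) (A t * peanoBaker A s n t) t :=
  ((hA.mul (continuous_peanoBaker hA s n)).integral_hasStrictDerivAt s t).hasDerivAt

theorem norm_peanoBaker_le {A : ℝ → R} {s ρ K : ℝ} (hK0 : 0 ≤ K)
    (hK : ∀ t, |t - s| ≤ ρ → ‖A t‖ ≤ K) (n : ℕ) (t : ℝ) (ht : |t - s| ≤ ρ) :
    ‖peanoBaker A s n t‖ ≤ ‖(1 : R)‖ * ((K * |t - s|) ^ n / n.factorial) := by
  induction n generalizing t with
  | zero => simp [peanoBaker]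
  | succ n ih =>
    have hb : ∀ r ∈ Set.uIoc s t, |r - s| ≤ |t - s| := by
      intro r hr
      exact Set.abs_sub_left_of_mem_uIcc (Set.uIoc_subset_uIcc hr)
    have hint : IntegrableOn
        (fun r : ℝ => ‖(1 : R)‖ * K ^ (n + 1) / n.factorial * |r - s| ^ n) (Set.uIoc s t) := by
      have : Continuous fun r : ℝ => ‖(1 : R)‖ * K ^ (n + 1) / n.factorial * |r - s| ^ n := by
        fun_prop
      exact (this.intervalIntegrable s t).def'
    calc ‖peanoBaker A s (n + 1) t‖
        ≤ ∫ r in Set.uIoc s t, ‖A r * peanoBaker A s n r‖ :=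
          intervalIntegral.norm_integral_le_integral_norm_uIoc
      _ ≤ ∫ r in Set.uIoc s t, ‖(1 : R)‖ * K ^ (n + 1) / n.factorial * |r - s| ^ n := by
          refine integral_mono_of_nonneg (Eventually.of_forall fun _ => norm_nonneg _) hint ?_
          refine (ae_restrict_iff' measurableSet_uIoc).2 (Eventually.of_forall fun r hr => ?_)
          have h1 := (hb r hr).trans ht
          calc ‖A r * peanoBaker A s n r‖ ≤ ‖A r‖ * ‖peanoBaker A s n r‖ := norm_mul_le _ _
            _ ≤ K * (‖(1 : R)‖ * ((K * |r - s|) ^ n / n.factorial)) :=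
              mul_le_mul (hK r h1) (ih r h1) (norm_nonneg _) hK0
            _ = _ := by rw [mul_pow]; ring
      _ = ‖(1 : R)‖ * ((K * |t - s|) ^ (n + 1) / (n + 1).factorial) := by
          rw [integral_const_mul, integral_pow_abs_sub_uIoc, mul_pow, Nat.factorial_succ]
          push_cast
          field_simp

theorem isEvolutionSystem_evolution [CompleteSpace R] {A : ℝ → R} (hA : Continuous A) :
    IsEvolutionSystem A (evolution A) := by
  intro s
  have hs : ∀ n, peanoBaker A s (n + 1) s = 0 := fun n => by simp [peanoBaker]
  refine ⟨?_, fun t => ?_⟩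
  · rw [evolution, tsum_eq_single 0]
    · rfl
    · rintro (_ | n) hn
      · exact absurd rfl hn
      · exact hs n
  · set ρ : ℝ := |t - s| + 1 with hρ
    obtain ⟨K, hK⟩ := (isCompact_closedBall s ρ).exists_bound_of_continuousOn hA.continuousOn
    have hK' : ∀ r, |r - s| ≤ ρ → ‖A r‖ ≤ K := fun r hr => hK r (by
      rwa [Metric.mem_closedBall, Real.dist_eq])
    have hρ0 : 0 < ρ := by positivity
    have hK0 : 0 ≤ K := (norm_nonneg _).trans (hK' s (by simpa using hρ0.le))
    have hbound : ∀ n, ∀ r ∈ Metric.ball s ρ, ‖peanoBaker A s n r‖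
        ≤ ‖(1 : R)‖ * ((K * ρ) ^ n / n.factorial) := by
      intro n r hr
      rw [Metric.mem_ball, Real.dist_eq] at hr
      refine (norm_peanoBaker_le hK0 hK' n r hr.le).trans ?_
      gcongr
    have hsum : Summable fun n : ℕ => ‖(1 : R)‖ * ((K * ρ) ^ n / n.factorial) :=
      (Real.summable_pow_div_factorial _).mul_left _
    have ht : t ∈ Metric.ball s ρ := by
      rw [Metric.mem_ball, Real.dist_eq, hρ]; linarith
    have hsm : ∀ r ∈ Metric.ball s ρ, Summable fun n => peanoBaker A s n r :=
      fun r hr => Summable.of_norm_bounded hsum fun n => hbound n r hr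
    have key : HasDerivAt (fun r => ∑' n, peanoBaker A s (n + 1) r)
        (∑' n, A t * peanoBaker A s n t) t := by
      refine hasDerivAt_tsum_of_isPreconnected (hsum.mul_left K) Metric.isOpen_ball
        (convex_ball s ρ).isPreconnected (fun n r _ => hasDerivAt_peanoBaker hA s n r)
        (fun n r hr => ?_) (Metric.mem_ball_self hρ0) ?_ ht
      · refine (norm_mul_le _ _).trans (mul_le_mul (hK' r ?_) (hbound n r hr) (norm_nonneg _) hK0)
        rw [Metric.mem_ball, Real.dist_eq] at hr
        exact hr.le
      · simp only [hs]; exact summable_zero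
    rw [(hsm t ht).tsum_mul_left] at key
    have heq : (fun r => evolution A r s) =ᶠ[𝓝 t]
        fun r => 1 + ∑' n, peanoBaker A s (n + 1) r := by
      filter_upwards [Metric.isOpen_ball.mem_nhds ht] with r hr
      rw [evolution, (hsm r hr).tsum_eq_zero_add]
      rfl
    exact (key.const_add 1).congr_of_eventuallyEq heq

theorem IsEvolutionSystem.unique {A : ℝ → R} (hA : Continuous A) {S S' : ℝ → ℝ → R}
    (h : IsEvolutionSystem A S) (h' : IsEvolutionSystem A S') : S = S' := by
  funext t s
  set ρ : ℝ := |t - s| + 1 with hρ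
  obtain ⟨K, hK⟩ := (isCompact_closedBall s ρ).exists_bound_of_continuousOn hA.continuousOn
  have hmem : ∀ r, r ∈ Set.Ioo (s - ρ) (s + ρ) → r ∈ Metric.closedBall s ρ := by
    intro r hr
    rw [Metric.mem_closedBall, Real.dist_eq, abs_le]
    constructor <;> linarith [hr.1, hr.2]
  refine ODE_solution_unique_of_mem_Ioo (v := fun r x => A r * x) (s := fun _ => Set.univ)
    (K := K.toNNReal) (a := s - ρ) (b := s + ρ) (t₀ := s) (f := fun r => S r s)
    (g := fun r => S' r s) (fun r hr => ?_) ?_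
    (fun r _ => ⟨(h s).2 r, Set.mem_univ _⟩) (fun r _ => ⟨(h' s).2 r, Set.mem_univ _⟩) ?_ ?_
  · refine LipschitzWith.lipschitzOnWith (LipschitzWith.of_dist_le_mul fun x y => ?_)
    rw [dist_eq_norm, dist_eq_norm, ← mul_sub]
    refine (norm_mul_le _ _).trans (mul_le_mul_of_nonneg_right ?_ (norm_nonneg _))
    exact (hK r (hmem r hr)).trans (Real.le_coe_toNNReal K)
  · have : 0 < ρ := by positivity
    constructor <;> linarith
  · simp only [(h s).1, (h' s).1]
  · have := abs_le.1 (le_of_lt (show |t - s| < ρ by rw [hρ]; linarith))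
    have h2 := abs_lt.1 (show |t - s| < ρ by rw [hρ]; linarith)
    constructor <;> linarith [h2.1, h2.2]

end Evolution

namespace WaveFamily

variable {d : ℕ} {L : System d} {p₀ : Param d} (𝓕 : WaveFamily L p₀)

/-- The base wave `U_j(t) = u(k j + ω t)`, with `u`, `k`, `ω` taken at the parameters `p₀`. -/
def baseWave : ℝ → ℤ → Fin d → ℝ := wave p₀.1 (𝓕.freq p₀) (𝓕.u p₀)

/-- The Bloch evolution `S_ξ(t, s)`: the evolution system generated by the Bloch symbols `A_ξ(t)` of
the linearization `A(t)` about the base wave. -/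
def blochEvolution (N : ℕ) [NeZero N] (ξ t s : ℝ) : PerSeq d N →L[ℂ] PerSeq d N :=
  evolution (fun r => blochSymbol N (L.linField (𝓕.baseWave r)) ξ) t s

/-- The `N`-periodic sequence `(v(j/N))_j` sampled from a one-periodic function `v`. -/
def sample (N : ℕ) (v : ℝ → Fin d → ℝ) : PerSeq d N :=
  fun j i => ((v ((j.val : ℝ) / N) i : ℝ) : ℂ)

/-- Tangent vectors to the set of periodic waves of fixed wavenumber at the base wave: the samples
of `∂_ζ u` and of the derivatives of `u` with respect to `(M, E)`. -/
def tangentVectors (N : ℕ) : Set (PerSeq d N) :=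
  insert (sample N (deriv (𝓕.u p₀)))
    (Set.range fun q : (Fin d → ℝ) × ℝ =>
      sample N fun ζ => fderiv ℝ (fun p => 𝓕.u p ζ) p₀ (0, q))

/-- Non-degeneracy: the generalized kernel of `S_0(1/ω, 0) - Id` is spanned by the tangent vectors
to the family of waves. (That these vectors belong to this generalized kernel and that, up to the
obvious linear dependence in `(M, E)`, they are independent, so that `∂_ζ u`, `∂_{M_i} u`, `∂_E u`
give a basis of it, is automatic.) -/
def NonDegenerate (N : ℕ) [NeZero N] : Prop :=
  Module.End.maxGenEigenspace
      (𝓕.blochEvolution N 0 (1 / 𝓕.freq p₀) 0 : Module.End ℂ (PerSeq d N)) 1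
    ≤ Submodule.span ℂ (𝓕.tangentVectors N)

end WaveFamily

end HamLattice

end

/-! Run in the time of the profile (time multiplied by `ω`), the Bloch evolution over one period is
a matrix family `M(ξ)`, entire in `ξ`. Its behaviour near the eigenvalue 1 is read off the family of
waves. With `φ = ∂_ζ u` and `χ` the derivatives in `(M, E)`, differentiating the profile equation
gives `M(0) φ = φ` and `M(0) (χ c) = χ c + (dω(c)/ω) φ`. A Bloch factor `e^{ijξ}` acts on `φ` to
first order as a change `iξ` of wavenumber does, so with `ψ = ∂_k u` the vector `M(ξ)(φ + iξψ)` is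
also known up to `O(ξ²)` (`hasDerivAt_paramSolution`, `hasDerivAt_evolution_param`). Assumption A
says that nothing else is critical.

The components and the Hamiltonian satisfy local conservation laws. With `ℓ_ξ` the mean linearized
densities and `n_ξ` the integrated mean fluxes, `ℓ_ξ (M(ξ) - 1) = (e^{iξ} - 1) n_ξ` holds exactly
(`conservation_monodromy`). No adjoint problem has to be solved: the `ℓ_ξ` supply all but one of the
coordinates on the critical subspace, which the implicit function theorem continues in `ξ`
(`exists_critical_block`). In these coordinates the conserved rows of `M(ξ) - 1` are divisible by
`ξ`, and their entries on the continuation of `φ` by `ξ²`, because `n_0 φ = 0`. After the phase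
coordinate is multiplied by `iξ` the block reads `1 + iξ W(ξ)` with `W` holomorphic, and `W(0)` is
similar to `ω⁻¹ 𝒲` (`exists_scaled_block`, `averaged_complexParam`). The similarity removes the
discrepancy between averages over the `N` cells and over a full period. So the eigenvalues near 1
are the `1 + iξν`, with `ν` an eigenvalue of `W(ξ)` near some `b = a/ω`.

The `ν` are arranged in continuous curves by `exists_continuous_roots`. If `q = (X - b)^m g`
annihilates `W(0)` and `g(b) ≠ 0`, then `q(W(ξ)) = O(ξ)`, hence `q(ν) = O(ξ)` and `ν - b =
O(|ξ|^{1/m})`, which is the general bound. For double eigenvalues with a Jordan block the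
Hamiltonian structure improves it. The generator is a product of two factors whose transposes at `ξ`
are, respectively, minus the first factor at `-ξ` and the second factor at `-ξ`, so the eigenvalues
of `M(-ξ)` are the inverses of those of `M(ξ)` (`exists_left_inverse_monodromy`). The Cayley
variable `κ = ν / (1 + iξν/2)` then has a characteristic polynomial even in `ξ`, which departs from
its value at 0 by `O(ξ²)` only; a root of multiplicity at most two moves by `O(ξ)`. -/

noncomputable section

namespace HamLattice

/-! ### Continuous selection of the roots of a curve of polynomials -/

section RootSelection

open Polynomial

/-- A chain of small steps that stays near a finite set cannot go far. -/
theorem norm_sub_le_of_chain {r : ℕ} {ε : ℝ} (hε : 0 < ε) (S : Fin r → ℂ) (z : ℕ → ℂ) (k : ℕ)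
    (hstep : ∀ l < k, ‖z (l + 1) - z l‖ ≤ ε) (hS : ∀ l ≤ k, ∃ β, ‖z l - S β‖ ≤ ε) :
    ‖z k - z 0‖ ≤ 4 * r * ε := by
  by_contra! h
  -- A chain that leaves the disc of radius `4rε` meets each radius `4cε`, `c ≤ r`, overshooting by
  -- at most one step, and has a point of `S` nearby at that moment. The resulting annuli have width
  -- `3ε` and spacing `4ε`, so they are disjoint and would need `r + 1` points.
  have key : ∀ c : Fin (r + 1), ∃ β, 4 * (c : ℝ) * ε - ε ≤ ‖S β - z 0‖ ∧
      ‖S β - z 0‖ ≤ 4 * (c : ℝ) * ε + 2 * ε := by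
    intro c
    have hc : (c : ℝ) ≤ r := by exact_mod_cast Nat.lt_succ_iff.1 c.2
    have hex : ∃ l, l ≤ k ∧ 4 * (c : ℝ) * ε ≤ ‖z l - z 0‖ :=
      ⟨k, le_rfl, le_trans (by gcongr) h.le⟩
    classical
    obtain ⟨hlk, hl⟩ := Nat.find_spec hex
    have hup : ‖z (Nat.find hex) - z 0‖ ≤ 4 * (c : ℝ) * ε + ε := by
      rcases Nat.eq_zero_or_pos (Nat.find hex) with h0 | h0
      · rw [h0, sub_self, norm_zero]; positivity
      · obtain ⟨l, hl'⟩ := Nat.exists_eq_add_of_lt h0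
        simp only [zero_add] at hl'
        have h1 := Nat.find_min hex (m := l) (by omega)
        have h2 : ‖z l - z 0‖ < 4 * (c : ℝ) * ε := by
          by_contra! h3
          exact h1 ⟨by omega, h3⟩
        have h4 := hstep l (by omega)
        rw [hl']
        calc ‖z (l + 1) - z 0‖ = ‖(z (l + 1) - z l) + (z l - z 0)‖ := by congr 1; ring
          _ ≤ _ := norm_add_le _ _
          _ ≤ _ := by linarith
    obtain ⟨β, hβ⟩ := hS _ hlk
    have h5 : |‖z (Nat.find hex) - z 0‖ - ‖S β - z 0‖| ≤ ε := by
      refine (abs_norm_sub_norm_le _ _).trans ?_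
      simpa using hβ
    rw [abs_le] at h5
    exact ⟨β, by linarith, by linarith⟩
  choose β h1 h2 using key
  have hinj : Function.Injective β := by
    intro c c' hcc
    by_contra hne
    wlog hlt : c < c' generalizing c c'
    · exact this hcc.symm (Ne.symm hne) (lt_of_le_of_ne (not_lt.1 hlt) (Ne.symm hne))
    have h3 : ((c : ℕ) : ℝ) + 1 ≤ ((c' : ℕ) : ℝ) := by exact_mod_cast hlt
    have h4 := h2 c
    have h5 := h1 c'
    rw [hcc] at h4
    nlinarith
  simpa using Fintype.card_le_of_injective β hinj

/-- Equal root multisets mean fibres of equal cardinality; the permutation is glued from bijections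
between the fibres. -/
theorem exists_perm_of_prod_X_sub_C_eq {r : ℕ} {x y : Fin r → ℂ}
    (h : ∏ α, (X - C (x α)) = ∏ α, (X - C (y α))) : ∃ σ : Equiv.Perm (Fin r), x = y ∘ σ := by
  classical
  have hx : ∀ x : Fin r → ℂ, (∏ α, (X - C (x α))).roots = Finset.univ.val.map x := fun x => by
    have := roots_multiset_prod_X_sub_C (Finset.univ.val.map x)
    rwa [Multiset.map_map] at this
  have h1 := congrArg roots h
  rw [hx, hx] at h1
  have h2 : ∀ v, Fintype.card {α // x α = v} = Fintype.card {α // y α = v} := fun v => by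
    have := congrArg (Multiset.count v) h1
    rw [Multiset.count_map, Multiset.count_map] at this
    rw [Fintype.card_subtype, Fintype.card_subtype]
    simpa [Finset.card_def, eq_comm] using this
  let σ : Equiv.Perm (Fin r) := (Equiv.sigmaFiberEquiv x).symm.trans
    ((Equiv.sigmaCongrRight fun v => Fintype.equivOfCardEq (h2 v)).trans (Equiv.sigmaFiberEquiv y))
  exact ⟨σ, funext fun α => (((Fintype.equivOfCardEq (h2 (x α))) ⟨α, rfl⟩).2).symm⟩

/-- Nearby polynomials of a continuous curve have nearby roots, after a permutation. -/
theorem exists_perm_roots_close {r : ℕ} {Q : ℝ → ℂ[X]} (hQ : ∀ w, Continuous fun t => (Q t).eval w)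
    {a b R : ℝ} {ε : ℝ} (hε : 0 < ε) :
    ∃ δ > 0, ∀ s ∈ Icc a b, ∀ t ∈ Icc a b, |s - t| < δ → ∀ x y : Fin r → ℂ,
      (∀ α, ‖x α‖ ≤ R) → (∀ α, ‖y α‖ ≤ R) → Q s = ∏ α, (X - C (x α)) →
      Q t = ∏ α, (X - C (y α)) → ∃ σ : Equiv.Perm (Fin r), ∀ α, ‖x α - y (σ α)‖ < ε := by
  let K : Set ((ℝ × ℝ) × (Fin r → ℂ) × (Fin r → ℂ)) :=
    (Icc a b ×ˢ Icc a b) ×ˢ (univ.pi fun _ => Metric.closedBall 0 R) ×ˢ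
      (univ.pi fun _ => Metric.closedBall 0 R)
  have hK : IsCompact K := (isCompact_Icc.prod isCompact_Icc).prod
    ((isCompact_univ_pi fun _ => isCompact_closedBall _ _).prod
      (isCompact_univ_pi fun _ => isCompact_closedBall _ _))
  -- Configurations whose root vectors no permutation brings within `ε` in the sup norm. Inside `K`
  -- they form a compact set on which `|s - t|` cannot vanish, since at equal times the root vectors
  -- are permutations of each other. The minimum of `|s - t|` is the required `δ`.
  let F : Set ((ℝ × ℝ) × (Fin r → ℂ) × (Fin r → ℂ)) :=
    (⋂ w, {q | (Q q.1.1).eval w = ∏ α, (w - q.2.1 α)}) ∩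
      ((⋂ w, {q | (Q q.1.2).eval w = ∏ α, (w - q.2.2 α)}) ∩
        ⋂ σ : Equiv.Perm (Fin r), {q | ε ≤ ‖q.2.1 - q.2.2 ∘ σ‖})
  have hF : IsClosed F := by
    refine IsClosed.inter ?_ (IsClosed.inter ?_ ?_)
    · exact isClosed_iInter fun w => isClosed_eq ((hQ w).comp (by fun_prop)) (by fun_prop)
    · exact isClosed_iInter fun w => isClosed_eq ((hQ w).comp (by fun_prop)) (by fun_prop)
    · refine isClosed_iInter fun σ => isClosed_le continuous_const (Continuous.norm ?_)
      refine Continuous.sub (by fun_prop) ?_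
      exact continuous_pi fun i => by simp only [Function.comp]; fun_prop
  have hKF := hK.inter_right hF
  have hpos : ∀ q ∈ K ∩ F, 0 < |q.1.1 - q.1.2| := by
    rintro ⟨⟨s, t⟩, x, y⟩ ⟨-, h1, h2, h3⟩
    rw [mem_iInter] at h1 h2 h3
    rw [abs_pos, sub_ne_zero]
    intro hst
    obtain rfl : s = t := hst
    have : ∏ α, (X - C (x α)) = ∏ α, (X - C (y α)) := by
      refine Polynomial.funext fun w => ?_
      simp only [eval_prod, eval_sub, eval_X, eval_C]
      exact (h1 w).symm.trans (h2 w)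
    obtain ⟨σ, hσ⟩ := exists_perm_of_prod_X_sub_C_eq this
    have : ε ≤ ‖x - y ∘ σ‖ := h3 σ
    simp only [hσ, sub_self, norm_zero] at this
    linarith
  obtain ⟨δ, hδ, hδ'⟩ : ∃ δ > 0, ∀ q ∈ K ∩ F, δ ≤ |q.1.1 - q.1.2| := by
    rcases (K ∩ F).eq_empty_or_nonempty with h | h
    · exact ⟨1, one_pos, by simp [h]⟩
    · obtain ⟨q, hq, hmin⟩ := hKF.exists_isMinOn h
        (f := fun q : (ℝ × ℝ) × (Fin r → ℂ) × (Fin r → ℂ) => |q.1.1 - q.1.2|) (by fun_prop)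
      exact ⟨_, hpos q hq, fun q' hq' => hmin hq'⟩
  refine ⟨δ, hδ, fun s hs t ht hst x y hx hy hQx hQy => ?_⟩
  by_contra! hcon
  refine absurd (hδ' ((s, t), x, y) ⟨⟨⟨hs, ht⟩, ?_, ?_⟩, ?_, ?_, ?_⟩) (not_le.2 hst)
  · simpa using hx
  · simpa using hy
  · exact mem_iInter.2 fun w => by simp [hQx, eval_prod]
  · exact mem_iInter.2 fun w => by simp [hQy, eval_prod]
  · refine mem_iInter.2 fun σ => ?_
    obtain ⟨α, hα⟩ := hcon σ
    exact hα.trans (norm_le_pi_norm (x - y ∘ σ) α)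

/-- A curve of split monic polynomials, continuous and constant outside a compact interval, has
continuous roots on a half line. -/
theorem exists_continuous_roots_Ici {r : ℕ} {Q : ℝ → ℂ[X]}
    (hQ : ∀ w, Continuous fun t => (Q t).eval w) {R : ℝ}
    (hroots : ∀ t, ∃ x : Fin r → ℂ, (∀ α, ‖x α‖ ≤ R) ∧ Q t = ∏ α, (X - C (x α)))
    (hmatch : ∀ ε > 0, ∃ δ > 0, ∀ s t, |s - t| < δ → ∀ x y : Fin r → ℂ,
      (∀ α, ‖x α‖ ≤ R) → (∀ α, ‖y α‖ ≤ R) → Q s = ∏ α, (X - C (x α)) →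
      Q t = ∏ α, (X - C (y α)) → ∃ σ : Equiv.Perm (Fin r), ∀ α, ‖x α - y (σ α)‖ < ε) :
    ∃ z : Fin r → ℝ → ℂ, (∀ α, ContinuousOn (z α) (Ici 0)) ∧
      ∀ t ∈ Ici (0 : ℝ), Q t = ∏ α, (X - C (z α t)) := by
  -- grids of mesh `1 / m n` on which roots can be matched up to `1 / (n + 1)`
  have hmesh : ∀ n : ℕ, ∃ m : ℕ, (n : ℝ) + 1 ≤ m ∧ ∀ l : ℕ, ∀ x y : Fin r → ℂ,
      (∀ α, ‖x α‖ ≤ R) → (∀ α, ‖y α‖ ≤ R) → Q (l / m) = ∏ α, (X - C (x α)) →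
      Q ((l + 1 : ℕ) / m) = ∏ α, (X - C (y α)) →
      ∃ σ : Equiv.Perm (Fin r), ∀ α, ‖x α - y (σ α)‖ < 1 / (n + 1) := by
    intro n
    obtain ⟨δ, hδ, h⟩ := hmatch (1 / (n + 1)) (by positivity)
    obtain ⟨m, hm⟩ := exists_nat_gt (max (1 / δ) (n + 1))
    have hm0 : (0 : ℝ) < m := lt_of_lt_of_le (by positivity) ((le_max_right _ _).trans hm.le)
    refine ⟨m, (le_max_right _ _).trans hm.le, fun l x y hx hy hQx hQy =>
      h _ _ ?_ x y hx hy hQx hQy⟩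
    have : (l : ℝ) / m - ((l + 1 : ℕ) : ℝ) / m = -(1 / m) := by push_cast; field_simp; ring
    rw [this, abs_neg, abs_of_pos (by positivity), one_div_lt hm0 hδ]
    exact (le_max_left _ _).trans_lt hm
  choose m hm hmstep using hmesh
  have hm0 : ∀ n, (0 : ℝ) < m n := fun n => lt_of_lt_of_le (by positivity) (hm n)
  have hchain : ∀ n, ∃ x : ℕ → Fin r → ℂ, (∀ l, (∀ α, ‖x l α‖ ≤ R) ∧
      Q ((l : ℝ) / m n) = ∏ α, (X - C (x l α))) ∧
      ∀ l α, ‖x (l + 1) α - x l α‖ ≤ 1 / (n + 1) := by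
    intro n
    let T : ℕ → Type := fun l => {x : Fin r → ℂ // (∀ α, ‖x α‖ ≤ R) ∧
      Q ((l : ℝ) / m n) = ∏ α, (X - C (x α))}
    have hnext : ∀ l (x : T l), ∃ y : T (l + 1), ∀ α, ‖y.1 α - x.1 α‖ ≤ 1 / (n + 1) := by
      rintro l ⟨x, hx, hQx⟩
      obtain ⟨y, hy, hQy⟩ := hroots ((l + 1 : ℕ) / m n)
      obtain ⟨σ, hσ⟩ := hmstep n l x y hx hy hQx hQy
      refine ⟨⟨y ∘ σ, fun α => hy _, ?_⟩, fun α => ?_⟩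
      · rw [hQy]
        exact (Equiv.prod_comp σ fun α => X - C (y α)).symm
      · rw [norm_sub_rev]; exact (hσ α).le
    choose nxt hnxt using hnext
    obtain ⟨x0, hx0⟩ := hroots ((0 : ℕ) / m n)
    let xs : ∀ l, T l := fun l => Nat.rec (motive := T) ⟨x0, hx0⟩ (fun l x => nxt l x) l
    exact ⟨fun l => (xs l).1, fun l => (xs l).2, fun l α => hnxt l (xs l) α⟩
  choose x hx hxstep using hchain
  -- The `n`-th approximate selection is the step function of the matched chain on the `n`-th grid.
  let zn : ℕ → ℝ → Fin r → ℂ := fun n t => x n ⌊t * m n⌋₊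
  -- asymptotic equicontinuity
  have hequi : ∀ ε > 0, ∃ δ > 0, ∀ s t, 0 ≤ s → s ≤ t → t - s < δ →
      ∀ᶠ n : ℕ in atTop, ∀ α, ‖zn n t α - zn n s α‖ ≤ 4 * r * ε := by
    intro ε hε
    obtain ⟨δ, hδ, h⟩ := hmatch ε hε
    refine ⟨δ / 2, by positivity, fun s t hs hst hts => ?_⟩
    have hlim : Tendsto (fun n : ℕ => 1 / ((n : ℝ) + 1)) atTop (𝓝 0) :=
      tendsto_one_div_add_atTop_nhds_zero_nat
    filter_upwards [hlim.eventually_lt_const hε, hlim.eventually_lt_const (half_pos hδ)]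
      with n h1 h2 α
    set i := ⌊s * m n⌋₊ with hi
    set k := ⌊t * m n⌋₊ - i with hk
    have hik : i ≤ ⌊t * m n⌋₊ := Nat.floor_mono (by have := hm0 n; gcongr)
    have hmn : 1 / (m n : ℝ) < δ / 2 :=
      lt_of_le_of_lt (one_div_le_one_div_of_le (by positivity) (hm n)) h2
    -- Between the times `s` and `t` every grid polynomial is within `δ` in time of the one at index
    -- `i`, so the chain stays `ε`-close to the finitely many roots `x n i`. That bounds its total
    -- displacement, however many steps it takes.
    have := norm_sub_le_of_chain hε (x n i) (fun l => x n (i + l) α) k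
      (fun l _ => (hxstep n (i + l) α).trans h1.le) (fun l hl => by
        have hd : |((i + l : ℕ) : ℝ) / m n - (i : ℝ) / m n| < δ := by
          have e : ((i + l : ℕ) : ℝ) / m n - (i : ℝ) / m n = l / m n := by
            push_cast; field_simp; ring
          have h3 : ((i + l : ℕ) : ℝ) ≤ t * m n :=
            le_trans (by exact_mod_cast (by omega : i + l ≤ ⌊t * m n⌋₊))
              (Nat.floor_le (by have := hm0 n; have := hs.trans hst; positivity))
          have h4 : s * m n < i + 1 := Nat.lt_floor_add_one _
          rw [e, abs_of_nonneg (by have := hm0 n; positivity), div_lt_iff₀ (hm0 n)]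
          rw [div_lt_iff₀ (hm0 n)] at hmn
          push_cast at h3
          have h5 : (t - s) * m n < δ / 2 * m n := mul_lt_mul_of_pos_right hts (hm0 n)
          nlinarith
        obtain ⟨σ, hσ⟩ := h _ _ hd _ _ (hx n (i + l)).1 (hx n i).1 (hx n (i + l)).2 (hx n i).2
        exact ⟨σ α, (hσ α).le⟩)
    simpa [zn, ← hi, hk, Nat.add_sub_cancel' hik] using this
  -- limit along an ultrafilter
  have hlim : ∀ t α, ∃ y : ℂ, Tendsto (fun n => zn n t α) (hyperfilter ℕ) (𝓝 y) := by
    intro t α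
    obtain ⟨y, -, hy⟩ := (isCompact_closedBall (0 : ℂ) R).ultrafilter_le_nhds
      ((hyperfilter ℕ).map fun n => zn n t α) (by
        rw [le_principal_iff]
        refine Filter.mem_map.2 (Filter.univ_mem' fun n : ℕ => ?_)
        simpa [zn] using (hx n ⌊t * m n⌋₊).1 α)
    exact ⟨y, hy⟩
  choose z hz using hlim
  have hfreq : (hyperfilter ℕ : Filter ℕ) ≤ atTop := by
    rw [← Nat.cofinite_eq_atTop]; exact hyperfilter_le_cofinite
  have hzequi : ∀ ε > 0, ∃ δ > 0, ∀ s t, 0 ≤ s → s ≤ t → t - s < δ → ∀ α,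
      ‖z t α - z s α‖ ≤ 4 * r * ε := by
    intro ε hε
    obtain ⟨δ, hδ, h⟩ := hequi ε hε
    refine ⟨δ, hδ, fun s t hs hst hts α => ?_⟩
    exact le_of_tendsto ((hz t α).sub (hz s α)).norm
      (((h s t hs hst hts).filter_mono hfreq).mono fun n hn => hn α)
  refine ⟨fun α t => z t α, fun α => ?_, fun t ht => ?_⟩
  · rw [Metric.continuousOn_iff]
    intro s hs ε hε
    obtain ⟨δ, hδ, h⟩ := hzequi (ε / (4 * r + 1)) (by positivity)
    refine ⟨δ, hδ, fun t ht hts => ?_⟩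
    have hlt : 4 * r * (ε / (4 * r + 1)) < ε := by
      rw [mul_div_assoc', div_lt_iff₀ (by positivity)]; nlinarith
    rw [Real.dist_eq] at hts
    rw [dist_eq_norm]
    rcases le_total s t with hst | hst
    · exact (h s t hs hst ((le_abs_self _).trans_lt hts) α).trans_lt hlt
    · rw [norm_sub_rev]
      exact (h t s ht hst ((le_abs_self _).trans_lt (by rwa [abs_sub_comm])) α).trans_lt hlt
  · refine Polynomial.funext fun w => ?_
    have h1 : Tendsto (fun n : ℕ => (⌊t * m n⌋₊ : ℝ) / m n) atTop (𝓝 t) := by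
      rw [tendsto_iff_norm_sub_tendsto_zero]
      refine squeeze_zero (fun _ => norm_nonneg _) (fun n => ?_)
        (tendsto_one_div_add_atTop_nhds_zero_nat (𝕜 := ℝ))
      have h3 : (⌊t * m n⌋₊ : ℝ) ≤ t * m n :=
        Nat.floor_le (by have := hm0 n; have : 0 ≤ t := ht; positivity)
      have h4 : t * m n < ⌊t * m n⌋₊ + 1 := Nat.lt_floor_add_one _
      have h5 : (⌊t * m n⌋₊ : ℝ) / m n - t = (⌊t * m n⌋₊ - t * m n) / m n := by
        have := hm0 n; field_simp
      rw [Real.norm_eq_abs, h5, abs_div, abs_of_pos (hm0 n)]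
      refine div_le_div₀ zero_le_one ?_ (by positivity) (hm n)
      rw [abs_le]; constructor <;> linarith
    have h2 : Tendsto (fun n => (Q ((⌊t * m n⌋₊ : ℝ) / m n)).eval w) (hyperfilter ℕ)
        (𝓝 ((Q t).eval w)) := (((hQ w).tendsto t).comp h1).mono_left hfreq
    have h3 : Tendsto (fun n => (Q ((⌊t * m n⌋₊ : ℝ) / m n)).eval w) (hyperfilter ℕ)
        (𝓝 (∏ α, (w - z t α))) := by
      have : ∀ n, (Q ((⌊t * m n⌋₊ : ℝ) / m n)).eval w = ∏ α, (w - zn n t α) := fun n => by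
        rw [(hx n ⌊t * m n⌋₊).2]
        simp [eval_prod, zn]
      simp only [this]
      exact tendsto_finsetProd _ fun α _ => tendsto_const_nhds.sub (hz t α)
    rw [tendsto_nhds_unique h2 h3]
    simp [eval_prod]

/-- A continuous curve of split monic polynomials on an interval has continuous roots. -/
theorem exists_continuous_roots {r : ℕ} {P : ℝ → ℂ[X]} {a b R : ℝ} (hab : a ≤ b)
    (hP : ∀ w, ContinuousOn (fun t => (P t).eval w) (Icc a b))
    (hroots : ∀ t ∈ Icc a b, ∃ x : Fin r → ℂ, (∀ α, ‖x α‖ ≤ R) ∧ P t = ∏ α, (X - C (x α))) :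
    ∃ z : Fin r → ℝ → ℂ, (∀ α, ContinuousOn (z α) (Icc a b)) ∧
      ∀ t ∈ Icc a b, P t = ∏ α, (X - C (z α t)) := by
  -- Translating `a` to 0 and freezing the polynomial outside `[a, b]` reduces to a half line. As
  -- `g` is 1-Lipschitz, uniform matching of roots on the compact interval becomes uniform matching
  -- everywhere.
  let g : ℝ → ℝ := fun t => projIcc a b hab (a + t)
  have hg : ∀ t, g t ∈ Icc a b := fun t => (projIcc a b hab (a + t)).2
  have hgc : Continuous g :=
    continuous_subtype_val.comp (continuous_projIcc.comp (continuous_const.add continuous_id))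
  have hlip : ∀ s t, |g s - g t| ≤ |s - t| := by
    intro s t
    have := (LipschitzWith.projIcc hab).dist_le_mul (a + s) (a + t)
    simpa [Subtype.dist_eq, Real.dist_eq, g] using this
  have hQ : ∀ w, Continuous fun t => (P (g t)).eval w := fun w =>
    (hP w).comp_continuous hgc hg
  have hPe : ∀ w, Continuous fun t => (P (projIcc a b hab t)).eval w := fun w =>
    (hP w).comp_continuous (continuous_subtype_val.comp continuous_projIcc) fun t => Subtype.coe_prop _
  obtain ⟨z, hz, hzP⟩ := exists_continuous_roots_Ici (r := r) (R := R) hQ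
    (fun t => hroots _ (hg t)) (fun ε hε => by
      obtain ⟨δ, hδ, h⟩ := exists_perm_roots_close (r := r) hPe (a := a) (b := b) (R := R) hε
      refine ⟨δ, hδ, fun s t hst x y hx hy hQx hQy =>
        h (g s) (hg s) (g t) (hg t) ((hlip s t).trans_lt hst) x y hx hy ?_ ?_⟩
      · rw [projIcc_of_mem hab (hg s)]; exact hQx
      · rw [projIcc_of_mem hab (hg t)]; exact hQy)
  refine ⟨fun α t => z α (t - a), fun α => ?_, fun t ht => ?_⟩
  · exact (hz α).comp (by fun_prop) fun t ht => by simpa using ht.1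
  · have := hzP (t - a) (by simpa using ht.1)
    have h2 : g (t - a) = t := by simp [g, projIcc_of_mem hab ht]
    rwa [h2] at this

end RootSelection

/-! ### Evolution systems depending holomorphically on a parameter -/

section HolomorphicEvolution

open Function

/-- The integral of a continuous family of entire functions is entire. -/
theorem differentiable_intervalIntegral {F : Type*} [NormedAddCommGroup F] [NormedSpace ℂ F]
    [NormedSpace ℝ F] [CompleteSpace F] {f : ℂ → ℝ → F}
    (hf : Continuous (uncurry f)) (hd : ∀ t, Differentiable ℂ fun ξ => f ξ t) (a b : ℝ) :
    Differentiable ℂ fun ξ => ∫ t in a..b, f ξ t := by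
  intro ξ₀
  obtain ⟨K, hK⟩ := ((isCompact_closedBall ξ₀ 2).prod (isCompact_uIcc (a := a) (b := b))).exists_bound_of_continuousOn
    hf.continuousOn
  have hf' : Continuous (uncurry fun (t : ℝ) (ξ : ℂ) => f ξ t) := hf.comp continuous_swap
  refine (intervalIntegral.hasDerivAt_integral_of_dominated_loc_of_deriv_le (𝕜 := ℂ)
    (F' := fun ξ t => deriv (fun ξ => f ξ t) ξ) (bound := fun _ => K / 1)
    (Metric.ball_mem_nhds ξ₀ one_pos) (Eventually.of_forall fun ξ => ?_) ?_ ?_ ?_ ?_ ?_).2.differentiableAt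
  · exact (hf.uncurry_left ξ).aestronglyMeasurable
  · exact (hf.uncurry_left ξ₀).intervalIntegrable _ _
  · have h2 := (stronglyMeasurable_deriv_with_param hf').comp_measurable
      (measurable_id.prodMk (measurable_const (a := ξ₀)))
    exact h2.aestronglyMeasurable
  -- Cauchy's estimate on the circle of radius 1 about `ξ`, which lies in the ball of radius 2 about
  -- `ξ₀` where `K` bounds `f`.
  · refine Eventually.of_forall fun t ht ξ hξ => ?_
    refine Complex.norm_deriv_le_of_forall_mem_sphere_norm_le one_pos
      (hd t).diffContOnCl fun z hz => hK (z, t) ⟨?_, uIoc_subset_uIcc ht⟩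
    rw [Metric.mem_closedBall]
    rw [Metric.mem_ball] at hξ
    rw [mem_sphere_iff_norm, ← dist_eq_norm] at hz
    linarith [dist_triangle z ξ ξ₀]
  · exact intervalIntegrable_const
  · exact Eventually.of_forall fun t _ ξ _ => ((hd t) ξ).hasDerivAt

theorem continuous_uncurry_peanoBaker {R : Type*} [NormedRing R] [NormedSpace ℝ R] {A : ℂ → ℝ → R} (hA : Continuous (uncurry A)) (s : ℝ)
    (n : ℕ) : Continuous (uncurry fun ξ => peanoBaker (A ξ) s n) := by
  induction n with
  | zero => exact continuous_const
  | succ n ih =>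
    have h : Continuous (uncurry fun (q : ℂ × ℝ) (r : ℝ) => A q.1 r * peanoBaker (A q.1) s n r) := by
      have h1 : Continuous fun x : (ℂ × ℝ) × ℝ => (x.1.1, x.2) := by fun_prop
      exact (hA.comp h1).mul (ih.comp h1)
    exact intervalIntegral.continuous_parametric_intervalIntegral_of_continuous h continuous_snd

variable {R : Type*} [NormedRing R] [NormedAlgebra ℂ R] [NormedSpace ℝ R] [CompleteSpace R]

theorem differentiable_peanoBaker {A : ℂ → ℝ → R} (hA : Continuous (uncurry A))
    (hd : ∀ t, Differentiable ℂ fun ξ => A ξ t) (s : ℝ) (n : ℕ) (t : ℝ) :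
    Differentiable ℂ fun ξ => peanoBaker (A ξ) s n t := by
  induction n generalizing t with
  | zero => exact differentiable_const _
  | succ n ih =>
    exact differentiable_intervalIntegral (f := fun ξ t => A ξ t * peanoBaker (A ξ) s n t)
      (hA.mul (continuous_uncurry_peanoBaker hA s n))
      (fun t => (hd t).mul (ih t)) s t

/-- The evolution system generated by an entire family of generators is entire. -/
theorem differentiable_evolution {A : ℂ → ℝ → R} (hA : Continuous (uncurry A))
    (hd : ∀ t, Differentiable ℂ fun ξ => A ξ t) (s t : ℝ) :
    Differentiable ℂ fun ξ => evolution (A ξ) t s := by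
  intro ξ₀
  obtain ⟨K, hK⟩ := ((isCompact_closedBall ξ₀ 1).prod
    (isCompact_closedBall s |t - s|)).exists_bound_of_continuousOn hA.continuousOn
  have hK' : ∀ ξ ∈ Metric.ball ξ₀ 1, ∀ r, |r - s| ≤ |t - s| → ‖A ξ r‖ ≤ K := fun ξ hξ r hr =>
    hK (ξ, r) ⟨Metric.ball_subset_closedBall hξ, by rwa [Metric.mem_closedBall, Real.dist_eq]⟩
  have hK0 : 0 ≤ K := (norm_nonneg _).trans (hK' ξ₀ (Metric.mem_ball_self one_pos) t le_rfl)
  have := Complex.differentiableOn_tsum_of_summable_norm (U := Metric.ball ξ₀ 1)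
    (F := fun n ξ => peanoBaker (A ξ) s n t)
    (u := fun n : ℕ => ‖(1 : R)‖ * ((K * |t - s|) ^ n / n.factorial))
    ((Real.summable_pow_div_factorial _).mul_left _)
    (fun n => (differentiable_peanoBaker hA hd s n t).differentiableOn) Metric.isOpen_ball
    (fun n ξ hξ => norm_peanoBaker_le hK0 (hK' ξ hξ) n t le_rfl)
  exact this.differentiableAt (Metric.ball_mem_nhds ξ₀ one_pos)

/-- Second order Taylor bound for a function holomorphic and bounded on the unit disc. -/
theorem norm_sub_deriv_le_of_bounded {F : Type*} [NormedAddCommGroup F] [NormedSpace ℂ F]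
    [CompleteSpace F] {f : ℂ → F} {K : ℝ} (hf : Differentiable ℂ f) (hK : ∀ ξ ∈ Metric.ball (0 : ℂ) 1, ‖f ξ‖ ≤ K)
    {ξ : ℂ} (hξ : ξ ∈ Metric.ball (0 : ℂ) 1) :
    ‖f ξ - f 0‖ ≤ 2 * K * ‖ξ‖ ∧ ‖f ξ - f 0 - ξ • deriv f 0‖ ≤ 4 * K * ‖ξ‖ ^ 2 := by
  have h0 : (0 : ℂ) ∈ Metric.ball (0 : ℂ) 1 := Metric.mem_ball_self one_pos
  -- The Schwarz lemma is used twice: `f` stays within `2K` of `f 0`, so its slope at 0 is bounded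
  -- by `2K`; the same argument for that slope bounds the second slope by `4K`.
  have hmap : ∀ {g : ℂ → F} {K : ℝ}, (∀ ξ ∈ Metric.ball (0 : ℂ) 1, ‖g ξ‖ ≤ K) →
      MapsTo g (Metric.ball 0 1) (Metric.closedBall (g 0) (2 * K)) := fun {g K} hg z hz => by
    rw [Metric.mem_closedBall, dist_eq_norm]
    linarith [norm_sub_le (g z) (g 0), hg z hz, hg 0 h0]
  have h1 : ∀ z ∈ Metric.ball (0 : ℂ) 1, ‖dslope f 0 z‖ ≤ 2 * K := fun z hz => by
    simpa using Complex.norm_dslope_le_div_of_mapsTo_ball hf.differentiableOn (hmap hK) hz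
  have hd : DifferentiableOn ℂ (dslope f 0) (Metric.ball 0 1) := by
    intro z hz
    rcases eq_or_ne z 0 with rfl | hne
    · obtain ⟨p, hp⟩ := (hf.analyticAt 0)
      exact hp.has_fpower_series_dslope_fslope.analyticAt.differentiableAt.differentiableWithinAt
    · exact ((differentiableAt_dslope_of_ne hne).2 (hf z)).differentiableWithinAt
  have h2 : ‖dslope (dslope f 0) 0 ξ‖ ≤ 2 * (2 * K) := by
    simpa using Complex.norm_dslope_le_div_of_mapsTo_ball hd (hmap h1) hξ
  have e1 : f ξ - f 0 = ξ • dslope f 0 ξ := by simpa using (sub_smul_dslope f 0 ξ).symm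
  have e2 : dslope f 0 ξ - deriv f 0 = ξ • dslope (dslope f 0) 0 ξ := by
    simpa using (sub_smul_dslope (dslope f 0) 0 ξ).symm
  constructor
  · rw [e1, norm_smul, mul_comm]
    exact mul_le_mul_of_nonneg_right (h1 ξ hξ) (norm_nonneg _)
  · rw [e1, ← smul_sub, e2, norm_smul, norm_smul]
    nlinarith [norm_nonneg ξ, mul_nonneg (norm_nonneg ξ) (norm_nonneg ξ)]

end HolomorphicEvolution

/-! ### First variation of a linear evolution with respect to a parameter -/

section VectorEvolution

open Function

/-- Gronwall estimate on the unit time interval for a forced linear equation. -/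
theorem norm_le_of_linear_ode {E : Type*} [NormedAddCommGroup E] [NormedSpace ℂ E]
    [NormedSpace ℝ E] {A : ℝ → E →L[ℂ] E} {K ε : ℝ} (hK : 1 ≤ K) (hε : 0 ≤ ε)
    (hA : ∀ t ∈ Icc (0 : ℝ) 1, ‖A t‖ ≤ K) {e ρ : ℝ → E}
    (he : ∀ t, HasDerivAt e (A t (e t) + ρ t) t) (hρ : ∀ t ∈ Icc (0 : ℝ) 1, ‖ρ t‖ ≤ ε)
    (h0 : e 0 = 0) {t : ℝ} (ht : t ∈ Icc (0 : ℝ) 1) : ‖e t‖ ≤ Real.exp K * ε := by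
  have h := norm_le_gronwallBound_of_norm_deriv_right_le (f := e) (δ := 0) (K := K) (ε := ε)
    (a := 0) (b := 1) (fun x _ => (he x).continuousAt.continuousWithinAt)
    (fun x _ => (he x).hasDerivWithinAt) (by simp [h0]) (fun x hx => by
      have hx' := Ico_subset_Icc_self hx
      refine (norm_add_le _ _).trans (add_le_add ?_ (hρ x hx'))
      exact ((A x).le_opNorm _).trans (mul_le_mul_of_nonneg_right (hA x hx') (norm_nonneg _))) t ht
  refine h.trans ?_
  have hK0 : 0 < K := by linarith
  rw [gronwallBound_of_K_ne_0 hK0.ne']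
  simp only [zero_mul, zero_add, sub_zero]
  have h1 : Real.exp (K * t) ≤ Real.exp K := Real.exp_le_exp.2 (by nlinarith [ht.2])
  -- The Grönwall bound is `(ε/K)(e^{Kt} - 1)`; the assumption `1 ≤ K` absorbs the denominator.
  have h2 : ε / K ≤ ε := div_le_self hε hK
  have h3 : 1 ≤ Real.exp (K * t) := Real.one_le_exp (by have := ht.1; positivity)
  have h4 : 0 ≤ ε / K := by positivity
  nlinarith

variable {E : Type*} [NormedAddCommGroup E] [NormedSpace ℂ E] [NormedSpace ℝ E]
  [IsScalarTower ℝ ℂ E] [CompleteSpace E]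

theorem hasDerivAt_evolution_apply {A : ℝ → E →L[ℂ] E} (hA : Continuous A) (s t : ℝ) (v : E) :
    HasDerivAt (fun r => evolution A r s v) (A t (evolution A t s v)) t :=
  (((ContinuousLinearMap.apply ℂ E v).restrictScalars ℝ).hasFDerivAt.comp_hasDerivAt t
    ((isEvolutionSystem_evolution hA s).2 t) :)

theorem evolution_self {A : ℝ → E →L[ℂ] E} (hA : Continuous A) (s : ℝ) : evolution A s s = 1 :=
  (isEvolutionSystem_evolution hA s).1

/-- Solutions of a linear differential equation are given by its evolution system. -/
theorem eq_evolution_apply {A : ℝ → E →L[ℂ] E} (hA : Continuous A) {x : ℝ → E}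
    (hx : ∀ t, HasDerivAt x (A t (x t)) t) {t : ℝ} (ht : t ∈ Icc (0 : ℝ) 1) :
    x t = evolution A t 0 (x 0) := by
  obtain ⟨K, hK⟩ := isCompact_Icc.exists_bound_of_continuousOn (s := Icc (0 : ℝ) 1) hA.continuousOn
  have := norm_le_of_linear_ode (le_max_right K 1) le_rfl
    (fun t ht => (hK t ht).trans (le_max_left _ _)) (ρ := 0)
    (e := fun t => x t - evolution A t 0 (x 0))
    (fun t => by simpa [map_sub] using (hx t).fun_sub (hasDerivAt_evolution_apply hA 0 t (x 0)))
    (by simp) (by simp [evolution_self hA]) ht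
  simpa [sub_eq_zero] using this

/-- First variation formula for a family of linear equations with holomorphic generators. -/
theorem hasDerivAt_evolution_param {A : ℂ → ℝ → E →L[ℂ] E} (hA : Continuous (uncurry A))
    (hd : ∀ t, Differentiable ℂ fun ξ => A ξ t) {x y : ℝ → E}
    (hx : ∀ t, HasDerivAt x (A 0 t (x t)) t)
    (hy : ∀ t, HasDerivAt y (A 0 t (y t) + deriv (fun ξ => A ξ t) 0 (x t)) t) :
    HasDerivAt (fun ξ : ℂ => evolution (A ξ) 1 0 (x 0 + ξ • y 0)) (y 1) 0 := by
  have hxc : Continuous x := continuous_iff_continuousAt.2 fun t => (hx t).continuousAt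
  have hyc : Continuous y := continuous_iff_continuousAt.2 fun t => (hy t).continuousAt
  have hA' : ∀ ξ, Continuous (A ξ) := fun ξ => hA.uncurry_left ξ
  obtain ⟨K₀, hK₀⟩ := ((isCompact_closedBall (0 : ℂ) 1).prod
    (isCompact_Icc (a := (0 : ℝ)) (b := 1))).exists_bound_of_continuousOn hA.continuousOn
  obtain ⟨X, hX⟩ := (isCompact_Icc (a := (0 : ℝ)) (b := 1)).exists_bound_of_continuousOn
    hxc.continuousOn
  obtain ⟨Y, hY⟩ := (isCompact_Icc (a := (0 : ℝ)) (b := 1)).exists_bound_of_continuousOn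
    hyc.continuousOn
  set K := max K₀ 1 with hKdef
  have hK1 : 1 ≤ K := le_max_right _ _
  have hK : ∀ ξ ∈ Metric.ball (0 : ℂ) 1, ∀ t ∈ Icc (0 : ℝ) 1, ‖A ξ t‖ ≤ K := fun ξ hξ t ht =>
    (hK₀ (ξ, t) ⟨Metric.ball_subset_closedBall hξ, ht⟩).trans (le_max_left _ _)
  have h01 : (0 : ℝ) ∈ Icc (0 : ℝ) 1 := ⟨le_rfl, zero_le_one⟩
  have hX0 : 0 ≤ X := (norm_nonneg _).trans (hX 0 h01)
  have hY0 : 0 ≤ Y := (norm_nonneg _).trans (hY 0 h01)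
  -- The equations for `x` and `y` cancel the terms of order 0 and 1, so `x + ξy` solves the
  -- equation at `ξ` up to a residual `ρ` of size `ξ²`. Grönwall transfers this bound to the
  -- difference with the exact solution.
  have hest : ∀ ξ ∈ Metric.ball (0 : ℂ) 1,
      ‖evolution (A ξ) 1 0 (x 0 + ξ • y 0) - (x 1 + ξ • y 1)‖
        ≤ Real.exp K * ((4 * K * X + 2 * K * Y) * ‖ξ‖ ^ 2) := by
    intro ξ hξ
    refine norm_le_of_linear_ode (A := A ξ) (K := K) hK1 (by positivity) (hK ξ hξ)
      (e := fun t => evolution (A ξ) t 0 (x 0 + ξ • y 0) - (x t + ξ • y t))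
      (ρ := fun t => (A ξ t - A 0 t - ξ • deriv (fun ξ => A ξ t) 0) (x t)
        + ξ • (A ξ t - A 0 t) (y t)) (fun t => ?_) (fun t ht => ?_) ?_ ⟨zero_le_one, le_rfl⟩
    · have h1 : HasDerivAt (fun t => ξ • y t)
          (ξ • (A 0 t (y t) + deriv (fun ξ => A ξ t) 0 (x t))) t :=
        (((ContinuousLinearMap.lsmul ℂ ℂ ξ : E →L[ℂ] E).restrictScalars ℝ).hasFDerivAt.comp_hasDerivAt t
          (hy t) :)
      refine ((hasDerivAt_evolution_apply (hA' ξ) 0 t (x 0 + ξ • y 0)).fun_sub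
        ((hx t).fun_add h1)).congr_deriv ?_
      simp only [map_sub, map_add, map_smul, sub_apply, smul_apply, smul_add, smul_sub]
      abel
    · have hb := norm_sub_deriv_le_of_bounded (hd t) (fun ξ hξ => hK ξ hξ t ht) hξ
      have h1 : ‖(A ξ t - A 0 t - ξ • deriv (fun ξ => A ξ t) 0) (x t)‖
          ≤ 4 * K * ‖ξ‖ ^ 2 * X :=
        (ContinuousLinearMap.le_opNorm _ _).trans
          (mul_le_mul hb.2 (hX t ht) (norm_nonneg _) (by positivity))
      have h2 : ‖(A ξ t - A 0 t) (y t)‖ ≤ 2 * K * ‖ξ‖ * Y :=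
        (ContinuousLinearMap.le_opNorm _ _).trans
          (mul_le_mul hb.1 (hY t ht) (norm_nonneg _) (by positivity))
      refine (norm_add_le _ _).trans ?_
      rw [norm_smul]
      nlinarith [mul_le_mul_of_nonneg_left h2 (norm_nonneg ξ)]
    · simp [evolution_self (hA' ξ)]
  have h10 : evolution (A 0) 1 0 (x 0) = x 1 :=
    (eq_evolution_apply (hA' 0) hx ⟨zero_le_one, le_rfl⟩).symm
  rw [hasDerivAt_iff_isLittleO_nhds_zero]
  have hO : (fun ξ : ℂ => evolution (A ξ) 1 0 (x 0 + ξ • y 0) - (x 1 + ξ • y 1))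
      =O[𝓝 0] fun ξ => ‖ξ‖ ^ 2 := by
    refine Asymptotics.IsBigO.of_bound (Real.exp K * (4 * K * X + 2 * K * Y)) ?_
    filter_upwards [Metric.ball_mem_nhds (0 : ℂ) one_pos] with ξ hξ
    rw [norm_pow, norm_norm, mul_assoc]
    exact hest ξ hξ
  have hlo : (fun ξ : ℂ => ‖ξ‖ ^ 2) =o[𝓝 0] fun ξ : ℂ => ξ := by
    have := Asymptotics.isLittleO_norm_pow_id (E' := ℂ) one_lt_two
    exact this
  refine (hO.trans_isLittleO hlo).congr_left fun ξ => ?_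
  simp only [zero_add, zero_smul, add_zero, h10]
  abel

end VectorEvolution

/-! ### Reduction of a holomorphic family of operators to its critical block -/

section InvariantGraph

variable {E Y : Type*} [NormedAddCommGroup E] [NormedSpace ℂ E] [FiniteDimensional ℂ E]
  [NormedAddCommGroup Y] [NormedSpace ℂ Y] [FiniteDimensional ℂ Y]

/-- Holomorphic continuation of an invariant subspace, parametrized by `Q`, with the normalization
`Λ ∘ Q = 1`. -/
theorem exists_analytic_invariant {M : ℂ → E →L[ℂ] E} {Λ : ℂ → E →L[ℂ] Y}
    (hM : AnalyticAt ℂ M 0) (hΛ : AnalyticAt ℂ Λ 0) {Q₀ : Y →L[ℂ] E} {m₀ : Y →L[ℂ] Y}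
    (h₀ : M 0 ∘L Q₀ = Q₀ ∘L m₀) (hΛQ : Λ 0 ∘L Q₀ = 1)
    (hinj : ∀ (X : Y →L[ℂ] E) (ν : Y →L[ℂ] Y), M 0 ∘L X - X ∘L m₀ = Q₀ ∘L ν → Λ 0 ∘L X = 0 →
      X = 0 ∧ ν = 0) :
    ∃ (Q : ℂ → Y →L[ℂ] E) (m : ℂ → Y →L[ℂ] Y), AnalyticAt ℂ Q 0 ∧ AnalyticAt ℂ m 0 ∧ Q 0 = Q₀ ∧
      m 0 = m₀ ∧ ∀ᶠ ξ in 𝓝 0, M ξ ∘L Q ξ = Q ξ ∘L m ξ ∧ Λ ξ ∘L Q ξ = 1 := by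
  have : CompleteSpace E := FiniteDimensional.complete ℂ E
  have : CompleteSpace Y := FiniteDimensional.complete ℂ Y
  -- Invariance and normalization together are the equation `F = (0, 1)` for `(Q, m)`. Unknowns and
  -- values lie in the same finite-dimensional space, so the injectivity `hinj` of the partial
  -- derivative is all that the implicit function theorem needs.
  let F : ℂ × ((Y →L[ℂ] E) × (Y →L[ℂ] Y)) → ((Y →L[ℂ] E) × (Y →L[ℂ] Y)) := fun q => (M q.1 ∘L q.2.1 - q.2.1 ∘L q.2.2, Λ q.1 ∘L q.2.1)
  have hF : ContDiffAt ℂ ω F (0, (Q₀, m₀)) := by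
    have h1 : ContDiffAt ℂ ω (fun q : ℂ × ((Y →L[ℂ] E) × (Y →L[ℂ] Y)) => M q.1) (0, (Q₀, m₀)) :=
      ContDiffAt.comp (f := Prod.fst) (g := M) _ hM.contDiffAt contDiffAt_fst
    have h2 : ContDiffAt ℂ ω (fun q : ℂ × ((Y →L[ℂ] E) × (Y →L[ℂ] Y)) => Λ q.1) (0, (Q₀, m₀)) :=
      ContDiffAt.comp (f := Prod.fst) (g := Λ) _ hΛ.contDiffAt contDiffAt_fst
    have h3 : ContDiffAt ℂ ω (fun q : ℂ × ((Y →L[ℂ] E) × (Y →L[ℂ] Y)) => q.2.1) (0, (Q₀, m₀)) := by fun_prop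
    have h4 : ContDiffAt ℂ ω (fun q : ℂ × ((Y →L[ℂ] E) × (Y →L[ℂ] Y)) => q.2.2) (0, (Q₀, m₀)) := by fun_prop
    exact ((h1.clm_comp h3).sub (h3.clm_comp h4)).prodMk (h2.clm_comp h3)
  have hinv : (fderiv ℂ F (0, (Q₀, m₀)) ∘L .inr ℂ ℂ ((Y →L[ℂ] E) × (Y →L[ℂ] Y))).IsInvertible := by
    set L := fderiv ℂ F (0, (Q₀, m₀)) ∘L .inr ℂ ℂ ((Y →L[ℂ] E) × (Y →L[ℂ] Y)) with hLdef
    have hL : HasFDerivAt (fun z : ((Y →L[ℂ] E) × (Y →L[ℂ] Y)) => F (0, z)) L (Q₀, m₀) := by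
      have h1 : HasFDerivAt F (fderiv ℂ F (0, (Q₀, m₀))) (0, (Q₀, m₀)) :=
        (hF.differentiableAt (by simp)).hasFDerivAt
      exact HasFDerivAt.comp (f := fun z : ((Y →L[ℂ] E) × (Y →L[ℂ] Y)) => ((0 : ℂ), z)) (Q₀, m₀) h1
        (hasFDerivAt_prodMk_right _ _)
    have hX : HasFDerivAt (fun z : ((Y →L[ℂ] E) × (Y →L[ℂ] Y)) => z.1) (ContinuousLinearMap.fst ℂ _ _) (Q₀, m₀) :=
      hasFDerivAt_fst
    have hν : HasFDerivAt (fun z : ((Y →L[ℂ] E) × (Y →L[ℂ] Y)) => z.2) (ContinuousLinearMap.snd ℂ _ _) (Q₀, m₀) :=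
      hasFDerivAt_snd
    have hL2 := hL.unique ((((hasFDerivAt_const (M 0) (Q₀, m₀)).clm_comp hX).sub
      (hX.clm_comp hν)).prodMk ((hasFDerivAt_const (Λ 0) (Q₀, m₀)).clm_comp hX))
    have hLz : ∀ z : ((Y →L[ℂ] E) × (Y →L[ℂ] Y)), L z = (M 0 ∘L z.1 - (Q₀ ∘L z.2 + z.1 ∘L m₀), Λ 0 ∘L z.1) := by
      intro z
      rw [hL2]
      refine Prod.ext ?_ ?_ <;> refine ContinuousLinearMap.ext fun y => ?_ <;> simp
    have hLinj : Function.Injective L := by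
      rw [injective_iff_map_eq_zero]
      intro z hz
      rw [hLz, Prod.mk_eq_zero] at hz
      obtain ⟨h1, h2⟩ := hinj z.1 z.2 (by rw [← sub_eq_zero, ← hz.1]; abel) hz.2
      exact Prod.ext h1 h2
    let e := LinearEquiv.ofInjectiveEndo (L : ((Y →L[ℂ] E) × (Y →L[ℂ] Y)) →ₗ[ℂ] ((Y →L[ℂ] E) × (Y →L[ℂ] Y))) hLinj
    exact ⟨e.toContinuousLinearEquiv, ContinuousLinearMap.ext fun z => rfl⟩
  have hn : (ω : WithTop ℕ∞) ≠ 0 := by simp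
  have hev := hF.eventually_apply_implicitFunction hn hinv
  have hself := hF.implicitFunction_apply_self hn hinv
  have hC := hF.contDiffAt_implicitFunction hn hinv
  set g := hF.implicitFunction hn hinv
  refine ⟨fun ξ => (g ξ).1, fun ξ => (g ξ).2, ?_, ?_, congrArg Prod.fst hself, congrArg Prod.snd hself, ?_⟩
  · exact ContDiffAt.analyticAt (contDiffAt_fst.comp _ hC)
  · exact ContDiffAt.analyticAt (contDiffAt_snd.comp _ hC)
  · filter_upwards [hev] with ξ hξ
    have h1 : F (0, (Q₀, m₀)) = (0, 1) := by simp [F, h₀, hΛQ]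
    rw [h1, Prod.mk.injEq, sub_eq_zero] at hξ
    exact hξ

end InvariantGraph

/-- The objects that describe a holomorphic family `M` of Floquet operators near a critical
eigenvalue `1`, with conservation laws `ℓ`, and their expansions. -/
structure ModulationData (E C : Type*) [NormedAddCommGroup E] [NormedSpace ℂ E]
    [NormedAddCommGroup C] [NormedSpace ℂ C] where
  M : ℂ → E →L[ℂ] E
  ℓ : ℂ → E →L[ℂ] C
  n : ℂ → E →L[ℂ] C
  -- For a wave, `φ`, `ψ` and `χ` are the derivatives of the profile in the phase, in `k` and in
  -- `(M, E)`; `(θ, ϑ)` and `(Gk, Gc)` are the derivatives of the frequency and of the averaged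
  -- fluxes, divided by the frequency. The vector `s` is the discrepancy between the cell mean and
  -- the period mean of the fluxes, divided by the frequency.
  φ : E
  ψ : E
  χ : C →L[ℂ] E
  θ : ℂ
  ϑ : C →L[ℂ] ℂ
  s : C
  Gk : C
  Gc : C →L[ℂ] C
  analytic_M : AnalyticAt ℂ M 0
  analytic_ℓ : AnalyticAt ℂ ℓ 0
  analytic_n : AnalyticAt ℂ n 0
  conservation : ∀ ξ v, ℓ ξ (M ξ v - v) = (Complex.exp (Complex.I * ξ) - 1) • n ξ v
  M_φ : M 0 φ = φ
  M_χ : ∀ c, M 0 (χ c) = χ c + ϑ c • φ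
  -- To first order a Bloch factor `e^{ijξ}` in front of `φ` is a wavenumber shift by `iξ`; hence
  -- the coefficient `iξ` of `ψ`.
  M_ψ : HasDerivAt (fun ξ : ℂ => M ξ (φ + ξ • (Complex.I • ψ))) (Complex.I • (ψ + θ • φ)) 0
  ℓ_φ : ℓ 0 φ = 0
  ℓ_χ : ∀ c, ℓ 0 (χ c) = c
  ℓ_ψ : HasDerivAt (fun ξ : ℂ => ℓ ξ (φ + ξ • (Complex.I • ψ))) (Complex.I • s) 0
  n_φ : n 0 φ = 0
  n_χ : ∀ c, n 0 (χ c) = Gc c + ϑ c • s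
  n_ψ : HasDerivAt (fun ξ : ℂ => n ξ (φ + ξ • (Complex.I • ψ))) (Complex.I • (Gk + θ • s)) 0
  φ_ne_zero : φ ≠ 0
  mem_of_pow_eq_zero : ∀ k v, ((M 0 - 1 : E →L[ℂ] E) ^ k : E →L[ℂ] E) v = 0 → ∃ (a : ℂ) (c : C), v = a • φ + χ c

namespace ModulationData

variable {E C : Type*} [NormedAddCommGroup E] [NormedSpace ℂ E]
  [NormedAddCommGroup C] [NormedSpace ℂ C] (D : ModulationData E C)

/-- The operator `(a b; g d)` on `ℂ × C`. -/
def block (a : ℂ) (b : C →L[ℂ] ℂ) (g : C) (d : C →L[ℂ] C) : (ℂ × C) →L[ℂ] (ℂ × C) :=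
  .inl ℂ ℂ C ∘L (a • .fst ℂ ℂ C) + .inl ℂ ℂ C ∘L (b ∘L .snd ℂ ℂ C) +
    (.inr ℂ ℂ C ∘L (ContinuousLinearMap.smulRightL ℂ (ℂ × C) C (.fst ℂ ℂ C) g) +
      .inr ℂ ℂ C ∘L (d ∘L .snd ℂ ℂ C))

@[simp] theorem block_apply (a : ℂ) (b : C →L[ℂ] ℂ) (g : C) (d : C →L[ℂ] C) (y : ℂ × C) :
    block a b g d y = (a * y.1 + b y.2, y.1 • g + d y.2) := by
  simp [block]

theorem analyticAt_block {a : ℂ → ℂ} {b : ℂ → C →L[ℂ] ℂ} {g : ℂ → C} {d : ℂ → C →L[ℂ] C}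
    [CompleteSpace C] {z : ℂ}
    (ha : AnalyticAt ℂ a z) (hb : AnalyticAt ℂ b z) (hg : AnalyticAt ℂ g z)
    (hd : AnalyticAt ℂ d z) : AnalyticAt ℂ (fun ξ => block (a ξ) (b ξ) (g ξ) (d ξ)) z := by
  have ha' : ContDiffAt ℂ ω a z := ha.contDiffAt
  have hb' : ContDiffAt ℂ ω b z := hb.contDiffAt
  have hg' : ContDiffAt ℂ ω g z := hg.contDiffAt
  have hd' : ContDiffAt ℂ ω d z := hd.contDiffAt
  refine ContDiffAt.analyticAt (ContDiffAt.add (ContDiffAt.add ?_ ?_) (ContDiffAt.add ?_ ?_))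
  · exact contDiffAt_const.clm_comp (ha'.smul contDiffAt_const)
  · exact contDiffAt_const.clm_comp (hb'.clm_comp contDiffAt_const)
  · exact contDiffAt_const.clm_comp (contDiffAt_const.clm_apply hg')
  · exact contDiffAt_const.clm_comp (hd'.clm_comp contDiffAt_const)

/-- The averaged operator in the coordinates `ℂ × C`. -/
def averaged : (ℂ × C) →L[ℂ] (ℂ × C) := block D.θ D.ϑ D.Gk D.Gc

/-- The critical vectors `a φ + χ c`. -/
def frame : (ℂ × C) →L[ℂ] E :=
  (ContinuousLinearMap.fst ℂ ℂ C).smulRight D.φ + D.χ ∘L .snd ℂ ℂ C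

@[simp] theorem frame_apply (y : ℂ × C) : D.frame y = y.1 • D.φ + D.χ y.2 := by simp [frame]

/-- `ℓ 0` reads off the component in `C` and kills `φ`; then `φ ≠ 0` settles the remaining scalar.
-/
theorem frame_injective : Function.Injective D.frame := by
  rw [injective_iff_map_eq_zero]
  rintro ⟨a, c⟩ h
  have h1 := congrArg (D.ℓ 0) h
  simp only [frame_apply, map_add, map_smul, D.ℓ_φ, D.ℓ_χ, smul_zero, zero_add, map_zero] at h1
  subst h1
  simp only [frame_apply, map_zero, add_zero, smul_eq_zero, D.φ_ne_zero, or_false] at h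
  simp [h]

theorem sub_one_frame (y : ℂ × C) : (D.M 0 - 1) (D.frame y) = D.frame (D.ϑ y.2, 0) := by
  simp [D.M_φ, D.M_χ]

theorem sq_sub_one_frame (y : ℂ × C) : (D.M 0 - 1) ((D.M 0 - 1) (D.frame y)) = 0 := by
  rw [sub_one_frame, sub_one_frame]; simp

theorem mem_range_frame (k : ℕ) (v : E) (h : ((D.M 0 - 1) ^ k : E →L[ℂ] E) v = 0) : ∃ y, v = D.frame y := by
  obtain ⟨a, c, h⟩ := D.mem_of_pow_eq_zero k v h
  exact ⟨(a, c), by simp [h]⟩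

variable [FiniteDimensional ℂ E]

/-- The conservation laws give only the coordinates in `C`; `π`, the first component of a left
inverse of the frame, supplies the missing phase coordinate. -/
theorem exists_functional : ∃ π : E →L[ℂ] ℂ, π D.φ = 1 ∧ ∀ c, π (D.χ c) = 0 := by
  obtain ⟨g, hg⟩ := (D.frame : (ℂ × C) →ₗ[ℂ] E).exists_leftInverse_of_injective
    (LinearMap.ker_eq_bot.2 D.frame_injective)
  have hg' : ∀ y, g (D.frame y) = y := fun y => LinearMap.congr_fun hg y
  refine ⟨LinearMap.toContinuousLinearMap (LinearMap.fst ℂ ℂ C ∘ₗ g), ?_, fun c => ?_⟩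
  · have := hg' (1, 0)
    simp only [frame_apply, one_smul, map_zero, add_zero] at this
    simp [this]
  · have := hg' (0, c)
    simp only [frame_apply, zero_smul, zero_add] at this
    simp [this]

variable [FiniteDimensional ℂ C]

/-- The critical block: a holomorphic family of invariant subspaces, in coordinates in which its
lower rows are governed by the conservation laws. -/
theorem exists_critical_block :
    ∃ (π : E →L[ℂ] ℂ) (Q : ℂ → (ℂ × C) →L[ℂ] E) (m : ℂ → (ℂ × C) →L[ℂ] (ℂ × C)),
      AnalyticAt ℂ Q 0 ∧ AnalyticAt ℂ m 0 ∧ Q 0 = D.frame ∧ (∀ y, m 0 y = (y.1 + D.ϑ y.2, y.2)) ∧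
      ∀ᶠ ξ in 𝓝 0, (∀ y, D.M ξ (Q ξ y) = Q ξ (m ξ y)) ∧
        ∀ y, π (Q ξ y) = y.1 ∧ D.ℓ ξ (Q ξ y) = y.2 := by
  have : CompleteSpace C := FiniteDimensional.complete ℂ C
  obtain ⟨π, hπφ, hπχ⟩ := D.exists_functional
  have hΛ : AnalyticAt ℂ (fun ξ => ContinuousLinearMap.inl ℂ ℂ C ∘L π +
      ContinuousLinearMap.inr ℂ ℂ C ∘L D.ℓ ξ) 0 := by
    have h : ContDiffAt ℂ ω D.ℓ 0 := D.analytic_ℓ.contDiffAt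
    exact (contDiffAt_const.add (contDiffAt_const.clm_comp h)).analyticAt
  set Λ : ℂ → E →L[ℂ] ℂ × C := fun ξ => ContinuousLinearMap.inl ℂ ℂ C ∘L π +
      ContinuousLinearMap.inr ℂ ℂ C ∘L D.ℓ ξ with hΛdef
  have hΛa : ∀ ξ v, Λ ξ v = (π v, D.ℓ ξ v) := fun ξ v => by simp [hΛdef]
  have hΛQ : ∀ y, Λ 0 (D.frame y) = y := fun y => by
    rw [hΛa]; simp [hπφ, hπχ, D.ℓ_φ, D.ℓ_χ]
  let m₀ : (ℂ × C) →L[ℂ] (ℂ × C) := block 1 D.ϑ 0 1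
  have hm₀ : ∀ y, m₀ y = y + (D.ϑ y.2, 0) := fun y => by
    ext <;> simp [m₀]
  obtain ⟨Q, m, hQ, hm, hQ0, hm0, hev⟩ := exists_analytic_invariant D.analytic_M hΛ
    (Q₀ := D.frame) (m₀ := m₀) (by
      refine ContinuousLinearMap.ext fun y => ?_
      have := D.sub_one_frame y
      rw [sub_apply, sub_eq_iff_eq_add'] at this
      simp only [ContinuousLinearMap.comp_apply, hm₀, map_add]
      simpa using this)
    (ContinuousLinearMap.ext fun y => hΛQ y)
    (by
      intro X ν h1 h2
      set A := D.M 0 - 1 with hA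
      have h1' : ∀ y, A (X y) = X (D.ϑ y.2, 0) + D.frame (ν y) := fun y => by
        have := DFunLike.congr_fun h1 y
        simp only [sub_apply, ContinuousLinearMap.comp_apply, hm₀, map_add] at this
        rw [hA, sub_apply, ← this, one_apply_eq_self]
        abel
      -- Two applications of `A` bring `X y` into the span of the frame and `A ∘ X`-terms on the
      -- frame only, because the nilpotent part of `m₀` squares to zero; two more annihilate the
      -- frame. So `A ^ 4` kills `X y`, which is therefore critical, and the normalization `Λ 0 (X
      -- y) = 0` makes it vanish.
      have hX : ∀ y, X y = 0 := by
        intro y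
        have h4 : (A ^ 4) (X y) = 0 := by
          have e2 : A (A (X y)) = D.frame (ν (D.ϑ y.2, 0)) + A (D.frame (ν y)) := by
            rw [h1' y, map_add, h1' (D.ϑ y.2, 0)]
            have : X (D.ϑ (D.ϑ y.2, (0 : C)).2, 0) = 0 := by
              rw [show ((D.ϑ (D.ϑ y.2, (0 : C)).2, 0) : ℂ × C) = 0 by simp, map_zero]
            rw [this, zero_add]
          have : (A ^ 4) (X y) = A (A (A (A (X y)))) := by simp [pow_succ]
          rw [this, e2, map_add, map_add, D.sq_sub_one_frame, D.sq_sub_one_frame (ν y), map_zero,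
            add_zero]
        obtain ⟨z, hz⟩ := D.mem_range_frame 4 (X y) h4
        have h5 : Λ 0 (X y) = 0 := DFunLike.congr_fun h2 y
        rw [hz, hΛQ] at h5
        rw [hz, h5, map_zero]
      have hX' : X = 0 := ContinuousLinearMap.ext hX
      refine ⟨hX', ?_⟩
      refine ContinuousLinearMap.ext fun y => ?_
      have := h1' y
      rw [hX', zero_apply, zero_apply, map_zero, zero_add] at this
      have h6 := congrArg (Λ 0) this
      rw [hΛQ, map_zero] at h6
      exact h6.symm)
  refine ⟨π, Q, m, hQ, hm, hQ0, fun y => by rw [hm0]; simp [m₀], ?_⟩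
  filter_upwards [hev] with ξ hξ
  refine ⟨fun y => DFunLike.congr_fun hξ.1 y, fun y => ?_⟩
  have := DFunLike.congr_fun hξ.2 y
  rw [ContinuousLinearMap.comp_apply, hΛa] at this
  exact Prod.mk.inj this

end ModulationData

theorem analyticAt_dslope {F : Type*} [NormedAddCommGroup F] [NormedSpace ℂ F] {f : ℂ → F} {z : ℂ}
    (hf : AnalyticAt ℂ f z) : AnalyticAt ℂ (dslope f z) z := by
  obtain ⟨p, hp⟩ := hf
  exact hp.has_fpower_series_dslope_fslope.analyticAt

namespace ModulationData

variable {E C : Type*} [NormedAddCommGroup E] [NormedSpace ℂ E]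
  [NormedAddCommGroup C] [NormedSpace ℂ C] (D : ModulationData E C)

/-- Since `M 0` fixes `φ`, `(M 0 - 1)²` kills `v`, so `v` is critical, and comparing coefficients of
`φ` fixes `ϑ c`. This is what makes the first order correction of a critical vector computable. -/
theorem mem_frame_of_sub_one_eq {v : E} {a : ℂ} (h : D.M 0 v - v = a • D.φ) :
    ∃ (b : ℂ) (c : C), v = b • D.φ + D.χ c ∧ D.ϑ c = a := by
  have h2 : ((D.M 0 - 1) ^ 2 : E →L[ℂ] E) v = 0 := by
    have : ((D.M 0 - 1) ^ 2 : E →L[ℂ] E) v = (D.M 0 - 1) ((D.M 0 - 1) v) := by simp [pow_succ]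
    rw [this]
    simp [h, D.M_φ]
  obtain ⟨b, c, hv⟩ := D.mem_of_pow_eq_zero 2 v h2
  refine ⟨b, c, hv, ?_⟩
  rw [hv] at h
  simp only [map_add, map_smul, D.M_φ, D.M_χ] at h
  have h3 : (D.ϑ c - a) • D.φ = 0 := by
    rw [sub_smul, ← h]; abel
  rw [smul_eq_zero, or_iff_left D.φ_ne_zero, sub_eq_zero] at h3
  exact h3

/-- Expansion of the critical vector that continues `φ`. -/
theorem critical_vector_expansion {Q : ℂ → (ℂ × C) →L[ℂ] E} {m : ℂ → (ℂ × C) →L[ℂ] (ℂ × C)}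
    (hQ : AnalyticAt ℂ Q 0) (hm : AnalyticAt ℂ m 0) (hQ0 : Q 0 = D.frame)
    (hm0 : ∀ y, m 0 y = (y.1 + D.ϑ y.2, y.2))
    (hMQ : ∀ᶠ ξ in 𝓝 0, ∀ y, D.M ξ (Q ξ y) = Q ξ (m ξ y))
    (hℓ : ∀ᶠ ξ in 𝓝 0, ∀ y, D.ℓ ξ (Q ξ y) = y.2)
    (hγ : HasDerivAt (fun ξ => (m ξ (1, 0)).2) 0 0) :
    HasDerivAt (fun ξ => (m ξ (1, 0)).1) (Complex.I * (D.θ - D.ϑ D.s)) 0 ∧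
    HasDerivAt (fun ξ => D.n ξ (Q ξ (1, 0)))
      (Complex.I • (D.Gk + D.θ • D.s - D.Gc D.s - D.ϑ D.s • D.s)) 0 := by
  set φ₁ := deriv Q 0 (1, 0) with hφ₁
  have hq : HasDerivAt (fun ξ => Q ξ (1, 0)) φ₁ 0 := by
    simpa using hQ.differentiableAt.hasDerivAt.clm_apply (hasDerivAt_const (0 : ℂ) ((1 : ℂ), (0 : C)))
  have hq0 : Q 0 (1, 0) = D.φ := by rw [hQ0]; simp
  have hM := D.analytic_M.differentiableAt.hasDerivAt
  have hℓ' := D.analytic_ℓ.differentiableAt.hasDerivAt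
  have hn := D.analytic_n.differentiableAt.hasDerivAt
  have hline : HasDerivAt (fun ξ : ℂ => D.φ + ξ • (Complex.I • D.ψ)) (Complex.I • D.ψ) 0 := by
    simpa using ((hasDerivAt_id (0 : ℂ)).smul_const (Complex.I • D.ψ)).const_add D.φ
  -- the three expansions along `φ + ξ I ψ`
  have eM := (hM.clm_apply hline).unique D.M_ψ
  have eℓ := (hℓ'.clm_apply hline).unique D.ℓ_ψ
  have en := (hn.clm_apply hline).unique D.n_ψ
  simp only [zero_smul, add_zero] at eM eℓ en
  -- the same along the critical vector
  have hα : HasDerivAt (fun ξ => (m ξ (1, 0)).1) (deriv m 0 (1, 0)).1 0 := by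
    have h1 : HasDerivAt (fun ξ => m ξ (1, 0)) (deriv m 0 (1, 0)) 0 := by
      simpa using hm.differentiableAt.hasDerivAt.clm_apply
        (hasDerivAt_const (0 : ℂ) ((1 : ℂ), (0 : C)))
    exact h1.fst
  set α := (deriv m 0 (1, 0)).1
  have hmd : HasDerivAt (fun ξ => m ξ (1, 0)) ((α, 0) : ℂ × C) 0 := hα.prodMk hγ
  have f1 := hM.clm_apply hq
  have f2 := hQ.differentiableAt.hasDerivAt.clm_apply hmd
  have f3 := (f1.congr_of_eventuallyEq (hMQ.mono fun ξ h => (h (1, 0)).symm)).unique f2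
  have g1 := (hℓ'.clm_apply hq).congr_of_eventuallyEq (hℓ.mono fun ξ h => (h (1, 0)).symm)
  have g2 := g1.unique (hasDerivAt_const (0 : ℂ) (0 : C))
  have hm01 : m 0 (1, 0) = (1, 0) := by rw [hm0]; simp
  rw [hm01, hq0, hQ0, ← hφ₁] at f3
  rw [hq0] at g2
  simp only [frame_apply, map_zero, add_zero] at f3
  -- the difference of the two first order corrections
  obtain ⟨b, c, hbc, hϑ⟩ := D.mem_frame_of_sub_one_eq (v := φ₁ - Complex.I • D.ψ)
    (a := α - Complex.I * D.θ) (by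
      have e1 := eq_sub_of_add_eq' f3
      have e2 := eq_sub_of_add_eq' eM
      rw [map_sub, e1, e2, sub_smul, mul_smul, smul_add]
      abel)
  -- `ℓ ξ` vanishes identically on the critical vector, whereas along `φ + ξIψ` it grows like `ξ I
  -- s`. So the correction is `Iψ` minus `I χ(s)`, up to a multiple `b` of `φ`; that multiple
  -- disappears from the result because `n 0 φ = 0`.
  have hc : c = -(Complex.I • D.s) := by
    have := congrArg (D.ℓ 0) hbc
    rw [map_sub, map_add, D.ℓ_χ, map_smul (D.ℓ 0) b, D.ℓ_φ, smul_zero, zero_add] at this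
    rw [← this, ← eℓ, eq_neg_of_add_eq_zero_right g2]
    abel
  have hα' : α = Complex.I * (D.θ - D.ϑ D.s) := by
    rw [hc, map_neg, map_smul, smul_eq_mul] at hϑ
    linear_combination -hϑ
  refine ⟨hα' ▸ hα, ?_⟩
  refine (hn.clm_apply hq).congr_deriv ?_
  have hφ₁' : φ₁ = Complex.I • D.ψ + (b • D.φ + D.χ c) := by rw [← hbc]; abel
  rw [hq0, hφ₁', map_add, ← add_assoc, en, map_add, map_smul, D.n_φ, D.n_χ, hc]
  simp only [map_neg, map_smul, smul_add, smul_sub, smul_zero, zero_add, neg_smul, smul_assoc]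
  abel

variable [FiniteDimensional ℂ E]

/-- The critical block contains the whole spectrum near `1`. -/
theorem quotient_injective [FiniteDimensional ℂ C] {π : E →L[ℂ] ℂ} {Q : ℂ → (ℂ × C) →L[ℂ] E}
    {m : ℂ → (ℂ × C) →L[ℂ] (ℂ × C)} (hQ : AnalyticAt ℂ Q 0) (hQ0 : Q 0 = D.frame)
    (hev : ∀ᶠ ξ in 𝓝 0, (∀ y, D.M ξ (Q ξ y) = Q ξ (m ξ y)) ∧
        ∀ y, π (Q ξ y) = y.1 ∧ D.ℓ ξ (Q ξ y) = y.2) :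
    ∃ ε > 0, ∀ᶠ ξ in 𝓝 0, ∀ l ∈ Metric.ball (1 : ℂ) ε, ∀ x y, D.M ξ x - l • x = Q ξ y →
      ∃ z, x = Q ξ z := by
  set Λ : ℂ → E →L[ℂ] ℂ × C := fun ξ => ContinuousLinearMap.inl ℂ ℂ C ∘L π +
      ContinuousLinearMap.inr ℂ ℂ C ∘L D.ℓ ξ with hΛdef
  have hΛa : ∀ ξ v, Λ ξ v = (π v, D.ℓ ξ v) := fun ξ v => by simp [hΛdef]
  have hΛc : ContinuousAt Λ 0 :=
    continuousAt_const.add (continuousAt_const.clm_comp D.analytic_ℓ.continuousAt)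
  -- `B (ξ, l)` pairs `M ξ - l`, projected along the range of `Q ξ`, with the coordinates `Λ ξ`. Its
  -- injectivity says that no vector outside that range is sent into it by `M ξ - l`. At `(0, 1)`
  -- this follows from the description of generalized eigenvectors, and injectivity is an open
  -- condition.
  let B : ℂ × ℂ → E →L[ℂ] (E × (ℂ × C)) := fun q =>
    .inl ℂ E (ℂ × C) ∘L ((1 - Q q.1 ∘L Λ q.1) ∘L (D.M q.1 - q.2 • 1)) + .inr ℂ E (ℂ × C) ∘L Λ q.1
  have hBa : ∀ q x, B q x = ((D.M q.1 x - q.2 • x) - Q q.1 (Λ q.1 (D.M q.1 x - q.2 • x)), Λ q.1 x) :=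
    fun q x => by simp [B, smul_sub]; try abel
  have hBc : ContinuousAt B (0, 1) := by
    have h1 : ContinuousAt (fun q : ℂ × ℂ => q.1) (0, 1) := continuousAt_fst
    have h2 : ContinuousAt (fun q : ℂ × ℂ => q.2) (0, 1) := continuousAt_snd
    have hM : ContinuousAt (fun q : ℂ × ℂ => D.M q.1) (0, 1) :=
      ContinuousAt.comp (f := fun q : ℂ × ℂ => q.1) (x := (0, 1)) D.analytic_M.continuousAt h1
    have hQ' : ContinuousAt (fun q : ℂ × ℂ => Q q.1) (0, 1) :=
      ContinuousAt.comp (f := fun q : ℂ × ℂ => q.1) (x := (0, 1)) hQ.continuousAt h1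
    have hΛ' : ContinuousAt (fun q : ℂ × ℂ => Λ q.1) (0, 1) :=
      ContinuousAt.comp (f := fun q : ℂ × ℂ => q.1) (x := (0, 1)) hΛc h1
    exact (continuousAt_const.clm_comp ((continuousAt_const.sub (hQ'.clm_comp hΛ')).clm_comp
      (hM.sub (h2.smul continuousAt_const)))).add (continuousAt_const.clm_comp hΛ')
  have hΛQ : ∀ᶠ ξ in 𝓝 0, ∀ y, Λ ξ (Q ξ y) = y := by
    filter_upwards [hev] with ξ hξ y
    rw [hΛa, (hξ.2 y).1, (hξ.2 y).2]
  have hB0 : Function.Injective (B (0, 1)) := by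
    rw [injective_iff_map_eq_zero]
    intro x hx
    rw [hBa, Prod.mk_eq_zero] at hx
    obtain ⟨h1, h2⟩ := hx
    simp only [one_smul] at h1 h2
    set z := Λ 0 (D.M 0 x - x)
    have h3 : (D.M 0 - 1) x = D.frame z := by
      rw [← hQ0]; simpa [sub_eq_zero] using h1
    have h4 : ((D.M 0 - 1) ^ 3 : E →L[ℂ] E) x = 0 := by
      have : ((D.M 0 - 1) ^ 3 : E →L[ℂ] E) x = (D.M 0 - 1) ((D.M 0 - 1) ((D.M 0 - 1) x)) := by
        simp [pow_succ]
      rw [this, h3, D.sq_sub_one_frame]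
    obtain ⟨y, hy⟩ := D.mem_range_frame 3 x h4
    have h5 := hΛQ.self_of_nhds y
    rw [hQ0, ← hy, h2] at h5
    rw [hy, ← h5, map_zero]
  have hBinj : ∀ᶠ q in 𝓝 ((0 : ℂ), (1 : ℂ)), Function.Injective (B q) :=
    hBc.eventually (ContinuousLinearMap.isOpen_injective.mem_nhds hB0)
  rw [nhds_prod_eq, eventually_prod_iff] at hBinj
  obtain ⟨p, hp, p', hp', hpp⟩ := hBinj
  obtain ⟨ε, hε, hεp⟩ := Metric.eventually_nhds_iff_ball.1 hp'
  refine ⟨ε, hε, ?_⟩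
  filter_upwards [hp, hev, hΛQ] with ξ hξp hξ hΛξ l hl x y hxy
  have hinj := hpp hξp (hεp l hl)
  refine ⟨Λ ξ x, ?_⟩
  have h0 : B (ξ, l) (x - Q ξ (Λ ξ x)) = 0 := by
    have e1 : D.M ξ (x - Q ξ (Λ ξ x)) - l • (x - Q ξ (Λ ξ x))
        = Q ξ (y - (m ξ (Λ ξ x) - l • Λ ξ x)) := by
      simp only [map_sub, map_smul, hξ.1, smul_sub, ← hxy]
      abel
    rw [hBa]
    refine Prod.ext ?_ ?_
    · change (D.M ξ (x - Q ξ (Λ ξ x)) - l • (x - Q ξ (Λ ξ x)))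
        - Q ξ (Λ ξ (D.M ξ (x - Q ξ (Λ ξ x)) - l • (x - Q ξ (Λ ξ x)))) = 0
      rw [e1, hΛξ, sub_self]
    · change Λ ξ (x - Q ξ (Λ ξ x)) = 0
      rw [map_sub, hΛξ, sub_self]
  have := (injective_iff_map_eq_zero _).1 hinj _ h0
  exact sub_eq_zero.1 this

/-- Slow scaling of the phase direction. -/
def scale (ξ : ℂ) (y : ℂ × C) : ℂ × C := (Complex.I * ξ * y.1, y.2)

/-- In slow variables the critical block is `1 + I ξ W(ξ)`, with `W` holomorphic and `W(0)` conjugate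
to the averaged operator. -/
theorem exists_scaled_block [FiniteDimensional ℂ C] :
    ∃ (Q : ℂ → (ℂ × C) →L[ℂ] E) (m W : ℂ → (ℂ × C) →L[ℂ] (ℂ × C)) (T : (ℂ × C) ≃ₗ[ℂ] (ℂ × C)),
      AnalyticAt ℂ W 0 ∧ (∀ y, W 0 (T y) = T (D.averaged y)) ∧
      (∀ y, m 0 y = (y.1 + D.ϑ y.2, y.2)) ∧
      (∀ᶠ ξ in 𝓝 0, (∀ y, D.M ξ (Q ξ y) = Q ξ (m ξ y)) ∧ Function.Injective (Q ξ) ∧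
        ∀ y, scale ξ (m ξ y - y) = (Complex.I * ξ) • W ξ (scale ξ y)) ∧
      ∃ ε > 0, ∀ᶠ ξ in 𝓝 0, ∀ l ∈ Metric.ball (1 : ℂ) ε, ∀ x y, D.M ξ x - l • x = Q ξ y →
        ∃ z, x = Q ξ z := by
  have : CompleteSpace C := FiniteDimensional.complete ℂ C
  obtain ⟨π, Q, m, hQ, hm, hQ0, hm0, hev⟩ := D.exists_critical_block
  set e : ℂ → ℂ := fun ξ => Complex.exp (Complex.I * ξ) with he
  have hea : AnalyticAt ℂ e 0 := by
    apply AnalyticAt.cexp; exact analyticAt_const.mul analyticAt_id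
  have he' : deriv e 0 = Complex.I := by
    have : HasDerivAt e (Complex.exp (Complex.I * 0) * (Complex.I * 1)) 0 :=
      ((hasDerivAt_id (0 : ℂ)).const_mul Complex.I).cexp
    simpa using this.deriv
  set e₁ := dslope e 0 with he₁
  have he₁a : AnalyticAt ℂ e₁ 0 := analyticAt_dslope hea
  have he₁0 : e₁ 0 = Complex.I := by rw [he₁, dslope_same, he']
  have hee : ∀ ξ, e ξ - 1 = ξ * e₁ ξ := fun ξ => by
    have := sub_smul_dslope e 0 ξ
    simp only [sub_zero, smul_eq_mul] at this
    rw [he₁, this]; simp [he]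
  -- lower rows of the block
  have hlow : ∀ᶠ ξ in 𝓝 0, ∀ y, (m ξ y - y).2 = (ξ * e₁ ξ) • D.n ξ (Q ξ y) := by
    filter_upwards [hev] with ξ hξ y
    rw [← hee, ← D.conservation, hξ.1, ← map_sub, (hξ.2 _).2]
  have hna : AnalyticAt ℂ (fun ξ => D.n ξ ∘L Q ξ) 0 := by
    have h1 : ContDiffAt ℂ ω D.n 0 := D.analytic_n.contDiffAt
    have h2 : ContDiffAt ℂ ω Q 0 := hQ.contDiffAt
    exact (h1.clm_comp h2).analyticAt
  set ν : ℂ → C := fun ξ => D.n ξ (Q ξ (1, 0)) with hν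
  have hνa : AnalyticAt ℂ ν 0 := by
    have h1 : ContDiffAt ℂ ω (fun ξ => D.n ξ ∘L Q ξ) 0 := hna.contDiffAt
    exact (h1.clm_apply contDiffAt_const).analyticAt
  have hν0 : ν 0 = 0 := by
    simp [hν, hQ0, D.n_φ]
  set ν₁ := dslope ν 0 with hν₁
  have hν₁a : AnalyticAt ℂ ν₁ 0 := analyticAt_dslope hνa
  have hνν : ∀ ξ, ν ξ = ξ • ν₁ ξ := fun ξ => by
    have := sub_smul_dslope ν 0 ξ
    rw [sub_zero, hν0, sub_zero] at this
    exact this.symm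
  -- One factor `ξ` comes from `e^{iξ} - 1` and another from `n 0 φ = 0`. The lower left entry is
  -- thus of order `ξ²`, which pays both for the scaling and for the division by `iξ`.
  have hγ : HasDerivAt (fun ξ => (m ξ (1, 0)).2) 0 0 := by
    have h1 : HasDerivAt (fun ξ : ℂ => (ξ * ξ) • (e₁ ξ • ν₁ ξ)) 0 0 := by
      have := ((hasDerivAt_id (0 : ℂ)).mul (hasDerivAt_id (0 : ℂ))).fun_smul
        (he₁a.smul hν₁a).differentiableAt.hasDerivAt
      simpa using this
    refine h1.congr_of_eventuallyEq ?_
    filter_upwards [hlow] with ξ hξ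
    have := hξ (1, 0)
    simp only [Prod.snd_sub, sub_zero] at this
    rw [this]
    change (ξ * e₁ ξ) • ν ξ = _
    rw [hνν]
    simp only [smul_smul]
    ring_nf
  obtain ⟨hα, hν'⟩ := D.critical_vector_expansion hQ hm hQ0 hm0 (hev.mono fun ξ h => h.1)
    (hev.mono fun ξ h y => (h.2 y).2) hγ
  set a : ℂ → ℂ := fun ξ => (m ξ (1, 0)).1 with ha
  have haa : AnalyticAt ℂ a 0 := by
    have h1 : ContDiffAt ℂ ω m 0 := hm.contDiffAt
    have h2 : ContDiffAt ℂ ω (fun ξ => m ξ (1, 0)) 0 := h1.clm_apply contDiffAt_const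
    exact (contDiffAt_fst.comp _ h2).analyticAt
  have ha0 : a 0 = 1 := by simp [ha, hm0]
  have haξ : ∀ ξ, a ξ - 1 = ξ * dslope a 0 ξ := fun ξ => by
    have := sub_smul_dslope a 0 ξ
    rw [sub_zero, ha0] at this
    exact this.symm
  set I := Complex.I
  have hI : I * I = -1 := Complex.I_mul_I
  -- Conjugation by the scaling multiplies the upper right entry of `m - 1` by `iξ` and divides the
  -- lower left one by it; these are the four entries after a further division by `iξ`.
  let W : ℂ → (ℂ × C) →L[ℂ] (ℂ × C) := fun ξ => block (-I * dslope a 0 ξ)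
    (.fst ℂ ℂ C ∘L (m ξ ∘L .inr ℂ ℂ C)) (-(e₁ ξ) • ν₁ ξ)
    ((-I * e₁ ξ) • ((D.n ξ ∘L Q ξ) ∘L .inr ℂ ℂ C))
  -- The coordinate `ℓ` sees the wavenumber direction with an offset `s`; this shear removes it.
  let T : (ℂ × C) ≃ₗ[ℂ] (ℂ × C) :=
    { toFun := fun y => (y.1, y.2 + y.1 • D.s)
      invFun := fun y => (y.1, y.2 - y.1 • D.s)
      map_add' := fun y z => by ext <;> simp [add_smul]; abel
      map_smul' := fun r y => by ext <;> simp [smul_smul]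
      left_inv := fun y => by simp
      right_inv := fun y => by simp }
  refine ⟨Q, m, W, T, ?_, ?_, hm0, ?_, D.quotient_injective hQ hQ0 hev⟩
  · have h1 : ContDiffAt ℂ ω m 0 := hm.contDiffAt
    have h2 : ContDiffAt ℂ ω (fun ξ => D.n ξ ∘L Q ξ) 0 := hna.contDiffAt
    refine analyticAt_block (analyticAt_const.mul (analyticAt_dslope haa)) ?_ (he₁a.neg.smul hν₁a)
      ((analyticAt_const.mul he₁a).smul ?_)
    · exact (contDiffAt_const.clm_comp (h1.clm_comp contDiffAt_const)).analyticAt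
    · exact (h2.clm_comp contDiffAt_const).analyticAt
  · rintro ⟨κ, c⟩
    have hTa : ∀ y, T y = (y.1, y.2 + y.1 • D.s) := fun y => rfl
    have d1 : dslope a 0 0 = I * (D.θ - D.ϑ D.s) := by rw [dslope_same, hα.deriv]
    have d2 : ν₁ 0 = I • (D.Gk + D.θ • D.s - D.Gc D.s - D.ϑ D.s • D.s) := by
      rw [hν₁, dslope_same]; exact hν'.deriv
    simp only [W, hTa, averaged, block_apply, d1, d2, he₁0, ContinuousLinearMap.comp_apply,
      ContinuousLinearMap.inr_apply, ContinuousLinearMap.coe_fst', hm0, smul_apply, hQ0,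
      frame_apply, zero_smul, zero_add, D.n_χ]
    refine Prod.ext ?_ ?_
    · simp only [map_add, map_smul, smul_eq_mul]
      linear_combination (-(D.θ - D.ϑ D.s) * κ) * hI
    · have e1 : -I * I = 1 := by rw [neg_mul, hI, neg_neg]
      simp only [map_add, map_smul, smul_eq_mul, smul_smul, e1, one_smul]
      module
  · filter_upwards [hev, hlow] with ξ hξ hlowξ
    refine ⟨hξ.1, ?_, ?_⟩
    · rw [injective_iff_map_eq_zero]
      intro y hy
      have := hξ.2 y
      rw [hy, map_zero, map_zero] at this
      exact Prod.ext this.1.symm this.2.symm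
    · rintro ⟨κ, c⟩
      have hsplit : ((κ, c) : ℂ × C) = κ • (1, 0) + (0, c) := by simp
      have hmy : m ξ (κ, c) = κ • m ξ (1, 0) + m ξ (0, c) := by
        rw [hsplit, map_add, map_smul]
      have hl1 := hlowξ (κ, c)
      have hQy : D.n ξ (Q ξ (κ, c)) = κ • ν ξ + D.n ξ (Q ξ (0, c)) := by
        rw [hsplit, map_add, map_smul, map_add, map_smul]
      refine Prod.ext ?_ ?_
      · have h1 := haξ ξ
        simp only [scale, W, block_apply, Prod.fst_sub, hmy, Prod.fst_add, Prod.smul_fst,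
          ContinuousLinearMap.comp_apply, ContinuousLinearMap.inr_apply,
          ContinuousLinearMap.coe_fst', smul_eq_mul]
        change I * ξ * (κ * a ξ + _ - κ) = _
        linear_combination (I * ξ * κ) * h1 + (I * ξ * κ * ξ * dslope a 0 ξ) * hI
      · simp only [scale, W, block_apply, Prod.smul_snd, hl1, hQy, hνν,
          ContinuousLinearMap.comp_apply, ContinuousLinearMap.inr_apply, smul_apply, smul_add,
          smul_smul]
        congr 1
        · congr 1
          linear_combination (ξ * ξ * κ * e₁ ξ) * hI
        · congr 1
          linear_combination (ξ * e₁ ξ) * hI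

end ModulationData

/-! ### Perturbation of the critical eigenvalues -/

section LinearAlgebra

open Polynomial

variable {E V : Type*} [AddCommGroup E] [Module ℂ E] [FiniteDimensional ℂ E]
  [AddCommGroup V] [Module ℂ V] [FiniteDimensional ℂ V]

/-- Algebraic multiplicities are carried by an invariant subspace that contains the corresponding
generalized eigenvectors. -/
theorem rootMultiplicity_charpoly_eq_of_intertwining {f : Module.End ℂ E} {g : Module.End ℂ V}
    {Q : V →ₗ[ℂ] E} (hQ : Function.Injective Q) {c ν : ℂ} (hc : c ≠ 0)
    (hfg : ∀ z, f (Q z) = Q (z + c • g z))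
    (hmem : ∀ x y, f x - (1 + c * ν) • x = Q y → ∃ z, x = Q z) :
    f.charpoly.rootMultiplicity (1 + c * ν) = g.charpoly.rootMultiplicity ν := by
  rw [← LinearMap.finrank_maxGenEigenspace_eq, ← LinearMap.finrank_maxGenEigenspace_eq]
  have hpow : ∀ k z, ((f - (1 + c * ν) • 1) ^ k) (Q z) = c ^ k • Q (((g - ν • 1) ^ k) z) := by
    intro k
    induction k with
    | zero => simp
    | succ k ih =>
      intro z
      have h1 : (f - (1 + c * ν) • 1) (Q z) = c • Q ((g - ν • 1) z) := by
        simp only [LinearMap.sub_apply, hfg, LinearMap.smul_apply, Module.End.one_apply, map_add,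
          map_smul, map_sub]
        module
      rw [pow_succ, Module.End.mul_apply, h1, map_smul, ih, pow_succ (g - ν • 1),
        Module.End.mul_apply, smul_smul, ← pow_succ']
  have hmap : f.maxGenEigenspace (1 + c * ν) = (g.maxGenEigenspace ν).map Q := by
    ext x
    rw [Submodule.mem_map, Module.End.mem_maxGenEigenspace]
    constructor
    · rintro ⟨k, hk⟩
      have hx : ∃ z, x = Q z := by
        induction k generalizing x with
        | zero => exact ⟨0, by simpa using hk⟩
        | succ k ih =>
          rw [pow_succ, Module.End.mul_apply] at hk
          obtain ⟨y, hy⟩ := ih _ hk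
          exact hmem x y (by simpa using hy)
      obtain ⟨z, rfl⟩ := hx
      refine ⟨z, (Module.End.mem_maxGenEigenspace _ _ _).2 ⟨k, ?_⟩, rfl⟩
      rw [hpow, smul_eq_zero, or_iff_right (pow_ne_zero _ hc)] at hk
      exact (map_eq_zero_iff Q hQ).1 hk
    · rintro ⟨z, hz, rfl⟩
      obtain ⟨k, hk⟩ := (Module.End.mem_maxGenEigenspace _ _ _).1 hz
      exact ⟨k, by rw [hpow, hk, map_zero, smul_zero]⟩
  rw [hmap]
  exact (Submodule.equivMapOfInjective Q hQ _).finrank_eq.symm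

/-- `g - l = -l g (f - l⁻¹)`, and the invertible factor commutes with the other, so the generalized
eigenspaces coincide. -/
theorem rootMultiplicity_charpoly_inv {f g : Module.End ℂ E} (h : g * f = 1) {l : ℂ} (hl : l ≠ 0) :
    g.charpoly.rootMultiplicity l = f.charpoly.rootMultiplicity l⁻¹ := by
  rw [← LinearMap.finrank_maxGenEigenspace_eq, ← LinearMap.finrank_maxGenEigenspace_eq]
  have h' : f * g = 1 := mul_eq_one_comm.1 h
  have e1 : g - l • 1 = (-l • g) * (f - l⁻¹ • 1) := by
    rw [mul_sub, smul_mul_assoc, h, smul_mul_assoc, mul_smul_comm, mul_one, smul_smul]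
    rw [neg_mul, mul_inv_cancel₀ hl]
    simp only [neg_smul, one_smul]; abel
  have hcomm : Commute (-l • g) (f - l⁻¹ • 1) := by
    refine Commute.smul_left (Commute.sub_right ?_ (Commute.smul_right (Commute.one_right _) _)) _
    rw [Commute, SemiconjBy, h, h']
  have hinj : ∀ k x, ((-l • g) ^ k) x = 0 → x = 0 := by
    intro k x hx
    have : (-l⁻¹ • f) * (-l • g) = 1 := by
      rw [smul_mul_smul_comm, h', neg_mul_neg, inv_mul_cancel₀ hl, one_smul]
    have h2 : (-l⁻¹ • f) ^ k * (-l • g) ^ k = 1 := by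
      rw [← Commute.mul_pow, this, one_pow]
      exact this.trans (mul_eq_one_comm.1 this).symm
    have := congrArg (fun F : Module.End ℂ E => F x) h2
    rw [Module.End.mul_apply, hx, map_zero] at this
    exact this.symm
  have : g.maxGenEigenspace l = f.maxGenEigenspace l⁻¹ := by
    ext x
    rw [Module.End.mem_maxGenEigenspace, Module.End.mem_maxGenEigenspace]
    refine exists_congr fun k => ?_
    rw [e1, hcomm.mul_pow, Module.End.mul_apply]
    exact ⟨hinj k _, fun h => by rw [h, map_zero]⟩
  rw [this]

theorem rootMultiplicity_prod_X_sub_C {r : ℕ} (x : Fin r → ℂ) (w : ℂ) :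
    (∏ α, (X - C (x α))).rootMultiplicity w = (Finset.univ.val.map x).count w := by
  classical
  rw [← count_roots]
  congr 1
  rw [Finset.prod_eq_multiset_prod, ← Function.comp_def (fun a => X - C a) x, ← Multiset.map_map,
    roots_multiset_prod_X_sub_C]

/-- The homogeneous form of the characteristic polynomial, valid also at `t = 0`. It evaluates
products over Möbius images of the eigenvalues as quotients of determinants. -/
theorem det_smul_sub_smul {r : ℕ} {f : Module.End ℂ V} {x : Fin r → ℂ}
    (hf : f.charpoly = ∏ α, (X - C (x α))) (s t : ℂ) :
    LinearMap.det (s • (1 : Module.End ℂ V) - t • f) = ∏ α, (s - t * x α) := by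
  have hr : Module.finrank ℂ V = r := by
    rw [← f.charpoly_natDegree, hf, natDegree_prod_of_monic _ _ fun α _ => monic_X_sub_C _]
    simp
  rcases eq_or_ne t 0 with rfl | ht
  · simp [LinearMap.det_smul, hr]
  · have h1 : s • (1 : Module.End ℂ V) - t • f
        = t • (algebraMap ℂ (Module.End ℂ V) (s / t) - f) := by
      rw [smul_sub, Algebra.algebraMap_eq_smul_one, smul_smul, mul_div_cancel₀ _ ht]
    rw [h1, LinearMap.det_smul, ← LinearMap.eval_charpoly, hf, eval_prod, hr]
    rw [← Fin.prod_const, ← Finset.prod_mul_distrib]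
    refine Finset.prod_congr rfl fun α _ => ?_
    rw [eval_sub, eval_X, eval_C, mul_sub, mul_div_cancel₀ _ ht]

theorem exists_roots_charpoly (f : Module.End ℂ V) {r : ℕ} (hr : Module.finrank ℂ V = r) :
    ∃ x : Fin r → ℂ, f.charpoly = ∏ α, (X - C (x α)) := by
  have h1 := (IsAlgClosed.splits f.charpoly).eq_prod_roots_of_monic f.charpoly_monic
  have h2 : f.charpoly.roots.card = r := by
    rw [← hr, ← f.charpoly_natDegree, (IsAlgClosed.splits f.charpoly).natDegree_eq_card_roots]
  have h3 : f.charpoly.roots.toList.length = r := by rw [Multiset.length_toList, h2]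
  subst h3
  refine ⟨fun α => f.charpoly.roots.toList.get α, ?_⟩
  conv_lhs => rw [h1, ← Multiset.coe_toList f.charpoly.roots, Multiset.map_coe, Multiset.prod_coe]
  rw [← List.prod_ofFn]
  congr 1
  refine List.ext_get (by simp) fun n h h' => by simp

/-- A polynomial that vanishes at `f` and has at `b` a root of the order of the index of `b`. -/
theorem exists_aeval_eq_zero_of_index (f : Module.End ℂ V) (b : ℂ) (m : ℕ)
    (h : f.maxGenEigenspace b ≤ f.genEigenspace b m) :
    ∃ g : ℂ[X], g.eval b ≠ 0 ∧ aeval f ((X - C b) ^ m * g) = 0 := by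
  obtain ⟨g, hg, hgb⟩ :=
    exists_eq_pow_rootMultiplicity_mul_and_not_dvd f.charpoly f.charpoly_monic.ne_zero b
  refine ⟨g, fun h0 => hgb (dvd_iff_isRoot.2 h0), LinearMap.ext fun v => ?_⟩
  have e : aeval f (X - C b) = f - b • 1 := by
    simp [Algebra.algebraMap_eq_smul_one]
  -- By Cayley–Hamilton the cofactor `g` of the full power of `X - b` in the characteristic
  -- polynomial maps into the generalized eigenspace, on which the `m`-th power of `f - b` already
  -- vanishes.
  have h1 : aeval f g v ∈ f.maxGenEigenspace b := by
    rw [Module.End.mem_maxGenEigenspace]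
    refine ⟨f.charpoly.rootMultiplicity b, ?_⟩
    rw [← e, ← map_pow, ← Module.End.mul_apply, ← map_mul, ← hg, LinearMap.aeval_self_charpoly]
    rfl
  have h2 := Module.End.mem_genEigenspace_nat.1 (h h1)
  rw [map_mul, Module.End.mul_apply, map_pow, e]
  exact h2

end LinearAlgebra

/-! ### Orders of approximation of perturbed eigenvalues -/

section Asymptotics

open Polynomial Asymptotics

variable {V : Type*} [NormedAddCommGroup V] [NormedSpace ℂ V] [FiniteDimensional ℂ V]

theorem analyticAt_det {A : ℂ → V →L[ℂ] V} {z : ℂ} (hA : AnalyticAt ℂ A z) :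
    AnalyticAt ℂ (fun ξ => LinearMap.det (A ξ : V →ₗ[ℂ] V)) z := by
  let b := Module.finBasis ℂ V
  have h : (fun ξ => LinearMap.det (A ξ : V →ₗ[ℂ] V)) = fun ξ =>
      ∑ σ : Equiv.Perm (Fin (Module.finrank ℂ V)), Equiv.Perm.sign σ • ∏ i,
        LinearMap.toContinuousLinearMap (b.coord (σ i)) (A ξ (b i)) := by
    funext ξ
    rw [← LinearMap.det_toMatrix b, Matrix.det_apply]
    simp [LinearMap.toMatrix_apply]
  rw [h]
  have hA' : ContDiffAt ℂ ω A z := hA.contDiffAt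
  refine Finset.analyticAt_fun_sum _ fun σ _ => ?_
  have h1 : AnalyticAt ℂ (fun ξ => ∏ i,
      LinearMap.toContinuousLinearMap (b.coord (σ i)) (A ξ (b i))) z := by
    refine Finset.analyticAt_fun_prod _ fun i _ => ContDiffAt.analyticAt ?_
    exact contDiffAt_const.clm_apply (hA'.clm_apply contDiffAt_const)
  have h2 : (fun ξ => Equiv.Perm.sign σ • ∏ i,
      LinearMap.toContinuousLinearMap (b.coord (σ i)) (A ξ (b i))) = fun ξ =>
      ((Equiv.Perm.sign σ : ℤ) : ℂ) * ∏ i,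
      LinearMap.toContinuousLinearMap (b.coord (σ i)) (A ξ (b i)) := by
    funext ξ
    rw [Units.smul_def, zsmul_eq_mul]
  rw [h2]
  exact analyticAt_const.mul h1

theorem analyticAt_aeval {A : ℂ → V →L[ℂ] V} {z : ℂ} (hA : AnalyticAt ℂ A z) (q : ℂ[X]) :
    AnalyticAt ℂ (fun ξ => aeval (A ξ) q) z := by
  have : CompleteSpace V := FiniteDimensional.complete ℂ V
  simp only [aeval_eq_sum_range]
  exact Finset.analyticAt_fun_sum _ fun i _ => analyticAt_const.fun_smul (hA.fun_pow i)

/-- Evenness on the real axis forces `deriv G 0 = 0`, after which `G - G 0` is `ξ²` times a second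
slope that is bounded near 0. -/
theorem isBigO_sq_of_even {G : ℂ → ℂ} (hG : AnalyticAt ℂ G 0)
    (heven : ∀ᶠ ξ : ℝ in 𝓝 0, G ((-ξ : ℝ) : ℂ) = G ξ) :
    (fun ξ : ℝ => G ξ - G 0) =O[𝓝 0] fun ξ : ℝ => |ξ| ^ 2 := by
  have hc : Tendsto (fun ξ : ℝ => (ξ : ℂ)) (𝓝 0) (𝓝 0) := by
    simpa using Complex.continuous_ofReal.tendsto 0
  have hd : HasDerivAt (fun ξ : ℝ => G ξ) (deriv G 0) 0 := by
    have h1 : HasDerivAt G (deriv G 0) ((0 : ℝ) : ℂ) := by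
      simpa using hG.differentiableAt.hasDerivAt
    exact h1.comp_ofReal
  have hd0 : deriv G 0 = 0 := by
    have h2 : HasDerivAt (fun ξ : ℝ => G ((-ξ : ℝ) : ℂ)) (-deriv G 0) 0 := by
      have h3 : HasDerivAt (fun ξ : ℝ => G ξ) (deriv G 0) (-(0 : ℝ)) := by simpa using hd
      have h5 := HasDerivAt.scomp (0 : ℝ) h3 (hasDerivAt_neg (0 : ℝ))
      rw [neg_one_smul] at h5
      exact h5
    have h4 := (hd.congr_of_eventuallyEq heven).unique h2
    linear_combination (1 / 2) * h4
  have hs : ∀ ξ, G ξ - G 0 = ξ ^ 2 * dslope (dslope G 0) 0 ξ := fun ξ => by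
    have e1 := sub_smul_dslope G 0 ξ
    have e2 := sub_smul_dslope (dslope G 0) 0 ξ
    rw [dslope_same, hd0] at e2
    simp only [sub_zero, smul_eq_mul] at e1 e2
    rw [← e1, ← e2]; ring
  have hO := (analyticAt_dslope (analyticAt_dslope hG)).continuousAt.tendsto.isBigO_one ℝ
  have hO' := (hO.comp_tendsto hc)
  have h5 : (fun ξ : ℝ => ((ξ : ℂ)) ^ 2) =O[𝓝 0] fun ξ : ℝ => |ξ| ^ 2 :=
    IsBigO.of_bound 1 (Eventually.of_forall fun ξ => by simp)
  refine (h5.mul hO').congr (fun ξ => (hs ξ).symm) fun ξ => by simp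

/-- Near `b` the cofactor `g` stays away from 0, so dividing by it turns the bound on `p (κ)` into
one on `(κ - b)^m`; then take `m`-th roots. -/
theorem isBigO_root {p g : ℂ[X]} {b : ℂ} {m : ℕ} (hm : m ≠ 0) (hp : p = (X - C b) ^ m * g)
    (hg : g.eval b ≠ 0) {κ : ℝ → ℂ} (hκ : Tendsto κ (𝓝 0) (𝓝 b)) {h : ℝ → ℝ}
    (hO : (fun ξ => p.eval (κ ξ)) =O[𝓝 0] fun ξ => h ξ ^ m) :
    (fun ξ => κ ξ - b) =O[𝓝 0] h := by
  refine IsBigO.of_pow hm ?_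
  have h1 : Tendsto (fun ξ => (g.eval (κ ξ))⁻¹) (𝓝 0) (𝓝 (g.eval b)⁻¹) :=
    ((g.continuous.tendsto b).comp hκ).inv₀ hg
  have h2 := hO.mul (h1.isBigO_one ℝ)
  have h3 : ∀ᶠ ξ in 𝓝 0, g.eval (κ ξ) ≠ 0 :=
    ((g.continuous.tendsto b).comp hκ).eventually_ne hg
  refine h2.congr' ?_ (Eventually.of_forall fun ξ => by simp)
  filter_upwards [h3] with ξ hξ
  rw [hp]
  simp only [eval_mul, eval_pow, eval_sub, eval_X, eval_C, Pi.pow_apply]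
  rw [mul_assoc, mul_inv_cancel₀ hξ, mul_one]

/-- Lagrange interpolation at the nodes `0, …, r` expresses the value at the moving point through
values at fixed points, with weights that converge. -/
theorem isBigO_eval_of_forall {r : ℕ} {q : ℝ → ℂ[X]} (hdeg : ∀ ξ, (q ξ).natDegree ≤ r) {h : ℝ → ℝ}
    (hO : ∀ w, (fun ξ => (q ξ).eval w) =O[𝓝 0] h) {κ : ℝ → ℂ} {b : ℂ}
    (hκ : Tendsto κ (𝓝 0) (𝓝 b)) : (fun ξ => (q ξ).eval (κ ξ)) =O[𝓝 0] h := by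
  have hinj : Set.InjOn (fun i : Fin (r + 1) => ((i : ℕ) : ℂ)) (Finset.univ : Finset (Fin (r + 1))) :=
    fun i _ j _ hij => Fin.ext (Nat.cast_injective (R := ℂ) hij)
  have h1 : ∀ ξ, (q ξ).eval (κ ξ) = ∑ i : Fin (r + 1), (q ξ).eval ((i : ℕ) : ℂ) *
      (Lagrange.basis Finset.univ (fun i : Fin (r + 1) => ((i : ℕ) : ℂ)) i).eval (κ ξ) := by
    intro ξ
    conv_lhs => rw [Lagrange.eq_interpolate (f := q ξ) hinj (by
      rw [Finset.card_univ, Fintype.card_fin]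
      exact lt_of_le_of_lt degree_le_natDegree (by exact_mod_cast Nat.lt_succ_of_le (hdeg ξ)))]
    simp [Lagrange.interpolate_apply, eval_finsetSum]
  simp only [h1]
  refine IsBigO.fun_sum fun i _ => ?_
  have h2 := ((Polynomial.continuous (Lagrange.basis Finset.univ
    (fun i : Fin (r + 1) => ((i : ℕ) : ℂ)) i)).tendsto b).comp hκ
  simpa using (hO _).mul (h2.isBigO_one ℝ)

/-- The factor `iξ` raises the exponent of the error in `ν` by one, and the quadratic remainder of
the exponential is admissible because `1 + s ≤ 2`. -/
theorem isBigO_multiplier {ν : ℝ → ℂ} {b : ℂ} {s : ℝ} (hs : 0 < s) (hs1 : s ≤ 1)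
    (hν : (fun ξ => ν ξ - b) =O[𝓝 0] fun ξ : ℝ => |ξ| ^ s) :
    (fun ξ : ℝ => 1 + Complex.I * ξ * ν ξ - Complex.exp (Complex.I * ξ * b))
      =O[𝓝 0] fun ξ : ℝ => |ξ| ^ (1 + s) := by
  have hξ : (fun ξ : ℝ => Complex.I * (ξ : ℂ)) =O[𝓝 0] fun ξ : ℝ => |ξ| :=
    IsBigO.of_bound 1 (Eventually.of_forall fun ξ => by simp)
  have h1 : (fun ξ : ℝ => Complex.I * ξ * (ν ξ - b)) =O[𝓝 0] fun ξ : ℝ => |ξ| ^ (1 + s) := by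
    refine (hξ.mul hν).congr_right fun ξ => ?_
    rw [Real.rpow_add' (abs_nonneg _) (by linarith), Real.rpow_one]
  have h2 : (fun ξ : ℝ => Complex.exp (Complex.I * ξ * b) - 1 - Complex.I * ξ * b)
      =O[𝓝 0] fun ξ : ℝ => |ξ| ^ (1 + s) := by
    have hsmall : ∀ᶠ ξ : ℝ in 𝓝 0, ‖Complex.I * ξ * b‖ < 1 := by
      have : Continuous fun ξ : ℝ => ‖Complex.I * ξ * b‖ := by fun_prop
      exact (this.tendsto 0).eventually_lt_const (by simp)
    have hξ1 : ∀ᶠ ξ : ℝ in 𝓝 0, |ξ| < 1 :=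
      (continuous_abs.tendsto (0 : ℝ)).eventually_lt_const (by simp)
    refine IsBigO.of_bound (‖b‖ ^ 2) ?_
    filter_upwards [hsmall, hξ1] with ξ h h'
    refine (Complex.norm_exp_sub_one_sub_id_le h.le).trans ?_
    rw [norm_mul, norm_mul, Complex.norm_I, one_mul, Complex.norm_real, mul_pow, mul_comm,
      Real.norm_eq_abs, Real.norm_of_nonneg (Real.rpow_nonneg (abs_nonneg _) _)]
    refine mul_le_mul_of_nonneg_left ?_ (by positivity)
    rw [← Real.rpow_natCast]
    exact Real.rpow_le_rpow_of_exponent_ge_of_imp (abs_nonneg _) h'.le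
      (by push_cast; linarith) (fun _ h1 => absurd h1 (by norm_num))
  refine (h1.sub h2).congr_left fun ξ => ?_
  ring

end Asymptotics

/-! ### Critical eigenvalue curves of a modulation problem -/

namespace ModulationData

open Polynomial Asymptotics

variable {E C : Type*} [NormedAddCommGroup E] [NormedSpace ℂ E] [FiniteDimensional ℂ E]
  [NormedAddCommGroup C] [NormedSpace ℂ C] [FiniteDimensional ℂ C] (D : ModulationData E C)

/-- Near `1`, the eigenvalues of `M(ξ)` are the `1 + I ξ ν` with `ν` an eigenvalue of `W(ξ)`, with
the same algebraic multiplicities. -/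
theorem exists_reduced_family :
    ∃ (W : ℂ → (ℂ × C) →L[ℂ] (ℂ × C)) (T : (ℂ × C) ≃ₗ[ℂ] (ℂ × C)),
      AnalyticAt ℂ W 0 ∧
      (W 0 : Module.End ℂ (ℂ × C)) = T.conj (D.averaged : Module.End ℂ (ℂ × C)) ∧
      ∃ ε > 0, (∀ l ∈ Metric.ball (1 : ℂ) ε,
          (D.M 0 : Module.End ℂ E).charpoly.IsRoot l ↔ l = 1) ∧
        ∀ᶠ ξ in 𝓝 (0 : ℂ), ξ ≠ 0 → ∀ ν, 1 + Complex.I * ξ * ν ∈ Metric.ball (1 : ℂ) ε →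
          (D.M ξ : Module.End ℂ E).charpoly.rootMultiplicity (1 + Complex.I * ξ * ν)
            = (W ξ : Module.End ℂ (ℂ × C)).charpoly.rootMultiplicity ν := by
  obtain ⟨Q, m, W, T, hW, hWT, hm0, hev, ε, hε, hres⟩ := D.exists_scaled_block
  refine ⟨W, T, hW, ?_, ε, hε, fun l hl => ?_, ?_⟩
  · refine LinearMap.ext fun y => ?_
    have := hWT (T.symm y)
    rw [LinearEquiv.apply_symm_apply] at this
    rw [LinearEquiv.conj_apply_apply]
    exact this
  · obtain ⟨hMQ, hQ, -⟩ := hev.self_of_nhds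
    have hres0 := hres.self_of_nhds l hl
    rw [← Module.End.hasEigenvalue_iff_isRoot_charpoly]
    constructor
    · intro h
      obtain ⟨x, hx⟩ := h.exists_hasEigenvector
      have hx1 : D.M 0 x = l • x := hx.apply_eq_smul
      obtain ⟨z, rfl⟩ := hres0 x 0 (by rw [hx1, sub_self, map_zero])
      rw [hMQ, ← map_smul] at hx1
      have hz := hQ hx1
      rw [hm0] at hz
      by_contra hl1
      have hz2 : z.2 = 0 := by
        have h2 : (1 - l) • z.2 = 0 := by
          rw [sub_smul, one_smul, sub_eq_zero]; exact congrArg Prod.snd hz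
        exact (smul_eq_zero.1 h2).resolve_left (sub_ne_zero.2 (Ne.symm hl1))
      have hz1 : z.1 = 0 := by
        have h1 : z.1 + D.ϑ z.2 = l * z.1 := congrArg Prod.fst hz
        rw [hz2, map_zero, add_zero] at h1
        have h2 : (1 - l) * z.1 = 0 := by linear_combination h1
        exact (mul_eq_zero.1 h2).resolve_left (sub_ne_zero.2 (Ne.symm hl1))
      exact hx.2 (by rw [Prod.ext hz1 hz2 (y := (0 : ℂ × C)), map_zero])
    · rintro rfl
      refine Module.End.hasEigenvalue_of_hasEigenvector (x := D.φ) ⟨?_, D.φ_ne_zero⟩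
      rw [Module.End.mem_eigenspace_iff, one_smul]
      exact D.M_φ
  · filter_upwards [hev, hres] with ξ hξ hresξ hξ0 ν hν
    obtain ⟨hMQ, hQ, hsc⟩ := hξ
    have hc : Complex.I * ξ ≠ 0 := mul_ne_zero Complex.I_ne_zero hξ0
    -- The scaling is invertible only for `ξ ≠ 0`; there `Q ξ ∘ Sc⁻¹` intertwines `1 + iξ W(ξ)` with
    -- `M(ξ)`.
    let Sc : (ℂ × C) ≃ₗ[ℂ] (ℂ × C) :=
      LinearEquiv.prodCongr (LinearEquiv.smulOfNeZero ℂ ℂ (Complex.I * ξ) hc) (LinearEquiv.refl ℂ C)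
    have hSc : ∀ y, Sc y = scale ξ y := fun y => rfl
    refine rootMultiplicity_charpoly_eq_of_intertwining
      (Q := (Q ξ : (ℂ × C) →ₗ[ℂ] E) ∘ₗ (Sc.symm : (ℂ × C) →ₗ[ℂ] (ℂ × C))) ?_ hc ?_ ?_
    · exact hQ.comp Sc.symm.injective
    · intro z
      obtain ⟨y, rfl⟩ := Sc.surjective z
      change D.M ξ (Q ξ (Sc.symm (Sc y))) = Q ξ (Sc.symm (Sc y + (Complex.I * ξ) • W ξ (Sc y)))
      rw [hSc, ← hsc, ← hSc, ← hSc, ← map_add, LinearEquiv.symm_apply_apply,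
        LinearEquiv.symm_apply_apply, hMQ, add_sub_cancel]
    · intro x y hxy
      obtain ⟨z, hz⟩ := hresξ _ hν x (Sc.symm y) hxy
      exact ⟨Sc z, by rw [hz]; simp⟩

/-- The curves are `1 + iξν` with `ν` a continuous root of the characteristic polynomial of `W(ξ)`.
The bound in terms of the index `m` is pure perturbation theory. The inversion symmetry `hsymm` is
needed only for the last clause, where a Jordan block of size two would otherwise cost half a power
of `ξ`. -/
theorem exists_curves {r : ℕ} {b : Fin r → ℂ}
    (hb : (D.averaged : Module.End ℂ (ℂ × C)).charpoly = ∏ α, (X - Polynomial.C (b α)))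
    (hsymm : ∀ ξ : ℝ, ∃ R : Module.End ℂ E, R * (D.M ((-ξ : ℝ) : ℂ) : Module.End ℂ E) = 1 ∧
      (D.M ξ : Module.End ℂ E).charpoly = R.charpoly) {c : ℝ} (hc : 0 < c) :
    ∃ ε₀ : ℝ, 0 < ε₀ ∧ ∃ ξ₀ ∈ Set.Ioo (0 : ℝ) c, ∃ lam : Fin r → ℝ → ℂ,
      (∀ α, ContinuousOn (lam α) (Set.Icc (-ξ₀) ξ₀)) ∧
      (∀ ξ ∈ Set.Icc (-ξ₀) ξ₀,
        spectrum ℂ (D.M (ξ : ℂ)) ∩ Metric.ball 1 ε₀ = Set.range fun α => lam α ξ) ∧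
      ∀ α,
        (∀ m : ℕ, 1 ≤ m →
          Module.End.maxGenEigenspace (D.averaged : Module.End ℂ (ℂ × C)) (b α)
            ≤ Module.End.genEigenspace (D.averaged : Module.End ℂ (ℂ × C)) (b α) m →
          (fun ξ : ℝ => lam α ξ - Complex.exp (Complex.I * ξ * b α))
            =O[𝓝 0] fun ξ : ℝ => |ξ| ^ (1 + 1 / (m : ℝ))) ∧
        ((D.averaged : Module.End ℂ (ℂ × C)).charpoly.rootMultiplicity (b α) ≤ 2 →
          (fun ξ : ℝ => lam α ξ - Complex.exp (Complex.I * ξ * b α))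
            =O[𝓝 0] fun ξ : ℝ => |ξ| ^ 2) := by
  have : CompleteSpace C := FiniteDimensional.complete ℂ C
  obtain ⟨W, T, hW, hWT, ε, hε, hM0, hmult⟩ := D.exists_reduced_family
  set I := Complex.I
  have hr : Module.finrank ℂ (ℂ × C) = r := by
    rw [← LinearMap.charpoly_natDegree (D.averaged : Module.End ℂ (ℂ × C)), hb,
      natDegree_prod_of_monic _ _ fun α _ => monic_X_sub_C _]
    simp
  -- At `ξ = 0` all curves pass through 1, and some index must exist for the range of the curves to
  -- contain it.
  have hr0 : 0 < r := by
    rw [← hr, Module.finrank_prod, Module.finrank_self]; omega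
  have hW0 : (W 0 : Module.End ℂ (ℂ × C)).charpoly = ∏ α, (X - Polynomial.C (b α)) := by
    rw [hWT, LinearEquiv.charpoly_conj, hb]
  -- a bound for the eigenvalues of `W ξ`
  obtain ⟨R, hR0, hR⟩ : ∃ R > 0, ∀ᶠ ξ in 𝓝 (0 : ℂ), ∀ ν,
      (W ξ : Module.End ℂ (ℂ × C)).charpoly.IsRoot ν → ‖ν‖ ≤ R := by
    have h1 : ∀ᶠ ξ in 𝓝 (0 : ℂ), ‖W ξ‖ < ‖W 0‖ + 1 :=
      hW.continuousAt.norm.eventually_lt_const (by simp)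
    refine ⟨‖W 0‖ + 1, by positivity, ?_⟩
    filter_upwards [h1] with ξ hξ ν hν
    obtain ⟨x, hx⟩ := ((Module.End.hasEigenvalue_iff_isRoot_charpoly _ _).2 hν).exists_hasEigenvector
    have hx1 : W ξ x = ν • x := hx.apply_eq_smul
    have h2 := (W ξ).le_opNorm x
    rw [hx1, norm_smul] at h2
    exact (le_of_mul_le_mul_right h2 (norm_pos_iff.2 hx.2)).trans hξ.le
  -- a smaller disc, stable under inversion
  obtain ⟨ρ, hρ, hρinv⟩ : ∃ ρ > 0, ∀ l ∈ Metric.ball (1 : ℂ) ρ, l ≠ 0 ∧ l ∈ Metric.ball 1 ε ∧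
      l⁻¹ ∈ Metric.ball 1 ε := by
    have h1 : ∀ᶠ l in 𝓝 (1 : ℂ), l⁻¹ ∈ Metric.ball 1 ε :=
      (continuousAt_inv₀ (one_ne_zero (α := ℂ))).eventually
        (by rw [inv_one]; exact Metric.ball_mem_nhds _ hε)
    have h2 : ∀ᶠ l in 𝓝 (1 : ℂ), l ≠ 0 ∧ l ∈ Metric.ball 1 ε ∧ l⁻¹ ∈ Metric.ball 1 ε :=
      (eventually_ne_nhds one_ne_zero).and (Filter.Eventually.and (Metric.ball_mem_nhds _ hε) h1)
    exact Metric.eventually_nhds_iff_ball.1 h2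
  obtain ⟨δ, hδ, hδev⟩ := Metric.eventually_nhds_iff_ball.1
    ((hmult.and hR).and (hW.eventually_analyticAt))
  -- Eigenvalues of `W ξ` are bounded by `R`. The reflection `w ↦ w / (1 + iξw)` at most doubles a
  -- modulus, as its denominator stays above 1/2, so starting from moduli up to `2R` everything
  -- stays below `4R` and `1 + iξw` stays in the disc of radius `ρ`.
  obtain ⟨ξ₀, hξ₀0, hξ₀⟩ : ∃ ξ₀ > 0, ξ₀ < c ∧ ξ₀ < δ ∧ ξ₀ * (4 * R) < ρ ∧ ξ₀ * (4 * R) < 1 / 2 := by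
    have h1 : Tendsto (fun x : ℝ => x * (4 * R)) (𝓝[>] 0) (𝓝 0) := by
      have : Continuous fun x : ℝ => x * (4 * R) := by fun_prop
      simpa using (this.tendsto 0).mono_left nhdsWithin_le_nhds
    have h2 : Tendsto (fun x : ℝ => x) (𝓝[>] 0) (𝓝 0) := nhdsWithin_le_nhds
    obtain ⟨x, hx⟩ := (Filter.Eventually.and (self_mem_nhdsWithin : Set.Ioi (0 : ℝ) ∈ 𝓝[>] 0) ((h2.eventually_lt_const hc).and
      ((h2.eventually_lt_const hδ).and ((h1.eventually_lt_const hρ).and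
        (h1.eventually_lt_const one_half_pos))))).exists
    exact ⟨x, hx⟩
  obtain ⟨hξc, hξδ, hξρ, hξ1⟩ := hξ₀
  have habs : ∀ ξ ∈ Set.Icc (-ξ₀) ξ₀, |ξ| ≤ ξ₀ := fun ξ hξ => abs_le.2 hξ
  have hball : ∀ ξ ∈ Set.Icc (-ξ₀) ξ₀, (ξ : ℂ) ∈ Metric.ball (0 : ℂ) δ := fun ξ hξ => by
    rw [mem_ball_zero_iff, Complex.norm_real, Real.norm_eq_abs]
    exact (habs ξ hξ).trans_lt hξδ
  have hsmall : ∀ ξ ∈ Set.Icc (-ξ₀) ξ₀, ∀ ν : ℂ, ‖ν‖ ≤ 4 * R → ‖I * ξ * ν‖ ≤ ξ₀ * (4 * R) := by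
    intro ξ hξ ν hν
    rw [norm_mul, norm_mul, Complex.norm_I, one_mul, Complex.norm_real, Real.norm_eq_abs]
    exact mul_le_mul (habs ξ hξ) hν (norm_nonneg _) hξ₀0.le
  have hmem : ∀ ξ ∈ Set.Icc (-ξ₀) ξ₀, ∀ ν : ℂ, ‖ν‖ ≤ 4 * R → 1 + I * ξ * ν ∈ Metric.ball (1 : ℂ) ρ := by
    intro ξ hξ ν hν
    rw [Metric.mem_ball, dist_eq_norm, add_sub_cancel_left]
    exact (hsmall ξ hξ ν hν).trans_lt hξρ
  -- the eigenvalues of `W ξ`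
  have hdet : ∀ ξ ∈ Metric.ball (0 : ℂ) δ, ∀ w, ContinuousAt
      (fun ξ => (W ξ : Module.End ℂ (ℂ × C)).charpoly.eval w) ξ := by
    intro ξ hξ w
    have h1 : AnalyticAt ℂ (fun ξ => w • (1 : (ℂ × C) →L[ℂ] (ℂ × C)) - W ξ) ξ :=
      analyticAt_const.sub (hδev ξ hξ).2
    refine (analyticAt_det h1).continuousAt.congr (Eventually.of_forall fun ζ => ?_)
    simp only [LinearMap.eval_charpoly, Algebra.algebraMap_eq_smul_one]
    rfl
  obtain ⟨ν', hν'c, hν'⟩ := exists_continuous_roots (r := r) (R := R)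
    (P := fun ξ : ℝ => (W ξ : Module.End ℂ (ℂ × C)).charpoly) (a := -ξ₀) (b := ξ₀) (by linarith)
    (fun w ξ hξ => (ContinuousAt.comp (f := fun ξ : ℝ => (ξ : ℂ)) (hdet _ (hball ξ hξ) w)
      Complex.continuous_ofReal.continuousAt).continuousWithinAt)
    (fun ξ hξ => by
      obtain ⟨x, hx⟩ := exists_roots_charpoly (W ξ : Module.End ℂ (ℂ × C)) hr
      refine ⟨x, fun α => (hδev _ (hball ξ hξ)).1.2 _ ?_, hx⟩
      rw [hx, IsRoot, eval_prod]
      exact Finset.prod_eq_zero (Finset.mem_univ α) (by simp))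
  have h0mem : (0 : ℝ) ∈ Set.Icc (-ξ₀) ξ₀ := ⟨by linarith, hξ₀0.le⟩
  -- Relabel the curves so that the one of index `α` starts at `b α`.
  obtain ⟨σ, hσ⟩ := exists_perm_of_prod_X_sub_C_eq (x := b) (y := fun α => ν' α 0) (by
    rw [← hν' 0 h0mem, Complex.ofReal_zero, hW0])
  set ν : Fin r → ℝ → ℂ := fun α => ν' (σ α) with hνdef
  have hνc : ∀ α, ContinuousOn (ν α) (Set.Icc (-ξ₀) ξ₀) := fun α => hν'c _
  have hν : ∀ ξ ∈ Set.Icc (-ξ₀) ξ₀, (W ξ : Module.End ℂ (ℂ × C)).charpoly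
      = ∏ α, (X - Polynomial.C (ν α ξ)) := fun ξ hξ => by
    rw [hν' ξ hξ]
    exact (Equiv.prod_comp σ fun α => X - Polynomial.C (ν' α ξ)).symm
  have hν0 : ∀ α, ν α 0 = b α := fun α => by rw [hσ]; rfl
  have hroot : ∀ ξ ∈ Set.Icc (-ξ₀) ξ₀, ∀ w,
      (W ξ : Module.End ℂ (ℂ × C)).charpoly.IsRoot w ↔ ∃ α, w = ν α ξ := by
    intro ξ hξ w
    rw [hν ξ hξ, IsRoot, eval_prod, Finset.prod_eq_zero_iff]
    simp [sub_eq_zero]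
  have hνR : ∀ ξ ∈ Set.Icc (-ξ₀) ξ₀, ∀ α, ‖ν α ξ‖ ≤ R := fun ξ hξ α =>
    (hδev _ (hball ξ hξ)).1.2 _ ((hroot ξ hξ _).2 ⟨α, rfl⟩)
  have hnhds : ∀ᶠ ξ : ℝ in 𝓝 0, ξ ∈ Set.Icc (-ξ₀) ξ₀ := Icc_mem_nhds (by linarith) hξ₀0
  have hνt : ∀ α, Tendsto (ν α) (𝓝 0) (𝓝 (b α)) := fun α => by
    rw [← hν0]
    exact (hνc α).continuousAt hnhds
  have hc0 : Tendsto (fun ξ : ℝ => (ξ : ℂ)) (𝓝 0) (𝓝 0) := by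
    simpa using Complex.continuous_ofReal.tendsto 0
  refine ⟨ε, hε, ξ₀, ⟨hξ₀0, hξc⟩, fun α ξ => 1 + I * ξ * ν α ξ, fun α => ?_, fun ξ hξ => ?_,
    fun α => ⟨fun m hm hindex => ?_, fun hb2 => ?_⟩⟩
  · have : Continuous fun ξ : ℝ => I * (ξ : ℂ) := by fun_prop
    exact continuousOn_const.add (this.continuousOn.mul (hνc α))
  · ext l
    have hspec : l ∈ spectrum ℂ (D.M (ξ : ℂ)) ↔
        (D.M (ξ : ℂ) : Module.End ℂ E).charpoly.IsRoot l := by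
      rw [← Module.End.mem_spectrum_iff_isRoot_charpoly,
        ← AlgEquiv.spectrum_eq (Module.End.toContinuousLinearMap E)]
      rfl
    rw [Set.mem_inter_iff, hspec, Set.mem_range]
    rcases eq_or_ne ξ 0 with rfl | hξ0
    · constructor
      · rintro ⟨h1, h2⟩
        rw [Complex.ofReal_zero] at h1
        exact ⟨⟨0, hr0⟩, by rw [(hM0 l h2).1 h1]; simp⟩
      · rintro ⟨α, rfl⟩
        simp only [Complex.ofReal_zero, mul_zero, zero_mul, add_zero]
        exact ⟨(hM0 1 (Metric.mem_ball_self hε)).2 rfl, Metric.mem_ball_self hε⟩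
    · have hξ0' : (ξ : ℂ) ≠ 0 := by exact_mod_cast hξ0
      have hm := (hδev _ (hball ξ hξ)).1.1 hξ0'
      have hiff : ∀ w, 1 + I * ξ * w ∈ Metric.ball (1 : ℂ) ε →
          ((D.M (ξ : ℂ) : Module.End ℂ E).charpoly.IsRoot (1 + I * ξ * w) ↔ ∃ α, w = ν α ξ) := by
        intro w hw
        rw [← rootMultiplicity_pos (LinearMap.charpoly_monic _).ne_zero, hm w hw,
          rootMultiplicity_pos (LinearMap.charpoly_monic _).ne_zero, hroot ξ hξ]
      constructor
      · rintro ⟨h1, h2⟩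
        have hIξ : I * (ξ : ℂ) ≠ 0 := mul_ne_zero Complex.I_ne_zero hξ0'
        have hl : l = 1 + I * ξ * ((l - 1) / (I * ξ)) := by
          rw [mul_div_cancel₀ _ hIξ]; ring
        rw [hl] at h1 h2
        obtain ⟨α, hα⟩ := (hiff _ h2).1 h1
        exact ⟨α, by dsimp only; rw [← hα]; exact hl.symm⟩
      · rintro ⟨α, rfl⟩
        have h2 := (hρinv _ (hmem ξ hξ (ν α ξ) ((hνR ξ hξ α).trans (by linarith)))).2.1
        exact ⟨(hiff _ h2).2 ⟨α, rfl⟩, h2⟩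
  · have hm0 : (m : ℝ) ≠ 0 := by positivity
    have hm1 : (1 : ℝ) ≤ m := by exact_mod_cast hm
    refine isBigO_multiplier (s := 1 / (m : ℝ)) (by positivity)
      (by rw [div_le_one (by positivity)]; exact hm1) ?_
    -- A polynomial annihilating `W 0` is `O(ξ)` at `W ξ`. Its value at an eigenvalue `ν` is an
    -- eigenvalue of that small operator, hence bounded by its norm.
    obtain ⟨g, hg, hann⟩ := exists_aeval_eq_zero_of_index _ _ m hindex
    refine isBigO_root (Nat.one_le_iff_ne_zero.1 hm) rfl hg (hνt α) ?_
    set q := (X - Polynomial.C (b α)) ^ m * g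
    have h1 : aeval (W 0) q = 0 := by
      have h2 : aeval (W 0 : Module.End ℂ (ℂ × C)) q = 0 := by
        have h4 := Polynomial.aeval_algHom_apply (T.conjAlgEquiv ℂ).toAlgHom
          (D.averaged : Module.End ℂ (ℂ × C)) q
        rw [hann, map_zero] at h4
        rw [hWT]
        exact h4
      have h3 := Polynomial.aeval_algHom_apply
        (Module.End.toContinuousLinearMap (𝕜 := ℂ) (ℂ × C)).toAlgHom (W 0 : Module.End ℂ (ℂ × C)) q
      rw [h2, map_zero] at h3
      exact h3
    have h2 := ((analyticAt_aeval hW q).differentiableAt.isBigO_sub).comp_tendsto hc0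
    have h3 : (fun ξ : ℝ => q.eval (ν α ξ)) =O[𝓝 0] fun ξ : ℝ => aeval (W ξ) q := by
      refine IsBigO.of_bound 1 (hnhds.mono fun ξ hξ => ?_)
      obtain ⟨x, hx⟩ := ((Module.End.hasEigenvalue_iff_isRoot_charpoly _ _).2
        ((hroot ξ hξ _).2 ⟨α, rfl⟩)).exists_hasEigenvector
      have h5 : aeval (W ξ) q x = q.eval (ν α ξ) • x := by
        rw [← Module.End.aeval_apply_of_hasEigenvector hx]
        have := Polynomial.aeval_algHom_apply
          (Module.End.toContinuousLinearMap (𝕜 := ℂ) (ℂ × C)).toAlgHom (W ξ : Module.End ℂ (ℂ × C)) q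
        exact DFunLike.congr_fun this x
      have h6 := (aeval (W ξ) q).le_opNorm x
      rw [h5, norm_smul] at h6
      rw [one_mul]
      exact le_of_mul_le_mul_right h6 (norm_pos_iff.2 hx.2)
    refine h3.trans (IsBigO.trans (h2.congr_left fun ξ => ?_) ?_)
    · simp [h1]
    · refine IsBigO.of_bound 1 (Eventually.of_forall fun ξ => ?_)
      rw [← Real.rpow_natCast, ← Real.rpow_mul (abs_nonneg _), one_div, inv_mul_cancel₀ hm0]
      simp
  · have hhalf : ∀ ξ ∈ Set.Icc (-ξ₀) ξ₀, ∀ w : ℂ, ‖w‖ ≤ 4 * R → 1 / 2 ≤ ‖1 + I * ξ * w‖ := by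
      intro ξ hξ w hw
      have h1 := (hsmall ξ hξ w hw).trans_lt hξ1
      have h2 := norm_sub_le (1 + I * ξ * w) (I * ξ * w)
      rw [add_sub_cancel_right, norm_one] at h2
      linarith
    have hne : ∀ ξ ∈ Set.Icc (-ξ₀) ξ₀, ∀ w : ℂ, ‖w‖ ≤ 4 * R → 1 + I * ξ * w ≠ 0 := by
      intro ξ hξ w hw h
      have := hhalf ξ hξ w hw
      rw [h, norm_zero] at this
      linarith
    -- reflection of the eigenvalues
    have hrefl : ∀ ξ ∈ Set.Icc (-ξ₀) ξ₀, ξ ≠ 0 →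
        Finset.univ.val.map (fun α => ν α (-ξ))
          = Finset.univ.val.map (fun α => ν α ξ / (1 + I * ξ * ν α ξ)) := by
      classical
      intro ξ hξ hξ0
      have hξ' : -ξ ∈ Set.Icc (-ξ₀) ξ₀ := ⟨by linarith [hξ.2], by linarith [hξ.1]⟩
      have hξ0' : (ξ : ℂ) ≠ 0 := by exact_mod_cast hξ0
      have hξ0'' : ((-ξ : ℝ) : ℂ) ≠ 0 := by exact_mod_cast neg_ne_zero.2 hξ0
      have hR4 : R ≤ 4 * R := by linarith
      ext x
      -- Multiplicities are compared pointwise. For `‖x‖ ≤ 2R` the value `x` at `-ξ` corresponds to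
      -- `y = x / (1 - iξx)` at `ξ`, since the associated multipliers are inverse to each other; a
      -- larger `x` belongs to neither multiset.
      rcases le_or_gt ‖x‖ (2 * R) with hx | hx
      · have hx4 : ‖x‖ ≤ 4 * R := hx.trans (by linarith)
        set y := x / (1 + I * ((-ξ : ℝ) : ℂ) * x) with hy
        have hx0 := hne _ hξ' x hx4
        have hy4 : ‖y‖ ≤ 4 * R := by
          rw [hy, norm_div, div_le_iff₀ (norm_pos_iff.2 hx0)]
          have := hhalf _ hξ' x hx4
          nlinarith
        have hinv : (1 + I * ξ * y)⁻¹ = 1 + I * ((-ξ : ℝ) : ℂ) * x := by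
          have h1 : y * (1 + I * ((-ξ : ℝ) : ℂ) * x) = x := div_mul_cancel₀ _ hx0
          refine inv_eq_of_mul_eq_one_right ?_
          push_cast at h1 ⊢
          linear_combination (I * ξ) * h1
        have hyb := hρinv _ (hmem ξ hξ y hy4)
        obtain ⟨Rinv, hRinv, hRc⟩ := hsymm ξ
        have e1 := (hδev _ (hball _ hξ')).1.1 hξ0'' x (hρinv _ (hmem _ hξ' x hx4)).2.1
        have e2 := (hδev _ (hball _ hξ)).1.1 hξ0' y hyb.2.1
        rw [← rootMultiplicity_prod_X_sub_C, ← hν _ hξ', ← e1, ← hinv,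
          ← rootMultiplicity_charpoly_inv hRinv hyb.1, ← hRc, e2, hν _ hξ,
          rootMultiplicity_prod_X_sub_C, Multiset.count_map, Multiset.count_map]
        congr 1
        refine Multiset.filter_congr fun α _ => ?_
        have hα := hne ξ hξ (ν α ξ) ((hνR ξ hξ α).trans hR4)
        rw [hy, div_eq_iff hx0, eq_div_iff hα]
        push_cast
        constructor <;> intro h <;> linear_combination h
      · rw [Multiset.count_eq_zero_of_notMem, Multiset.count_eq_zero_of_notMem]
        · intro h
          obtain ⟨α, -, rfl⟩ := Multiset.mem_map.1 h
          have h1 := hhalf ξ hξ (ν α ξ) ((hνR ξ hξ α).trans hR4)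
          rw [norm_div, lt_div_iff₀ (by linarith)] at hx
          nlinarith [hνR ξ hξ α]
        · intro h
          obtain ⟨α, -, rfl⟩ := Multiset.mem_map.1 h
          linarith [hνR _ hξ' α]
    -- For the multiplier `λ = 1 + iξν` one has `iξκ/2 = (λ - 1)/(λ + 1)`, which is odd under `λ ↦
    -- λ⁻¹`. As `ξ` changes sign too, the multiset of the `κ` is even in `ξ`.
    set κ : Fin r → ℝ → ℂ := fun α ξ => ν α ξ / (1 + I * ξ * (ν α ξ / 2)) with hκdef
    have hR2 : ∀ ξ ∈ Set.Icc (-ξ₀) ξ₀, ∀ α, ‖ν α ξ / 2‖ ≤ 4 * R := fun ξ hξ α => by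
      rw [norm_div]
      have := hνR ξ hξ α
      simp only [Complex.norm_ofNat]
      linarith
    have hκ0 : ∀ α, κ α 0 = b α := fun α => by simp [hκdef, hν0]
    have hκt : ∀ α, Tendsto (κ α) (𝓝 0) (𝓝 (b α)) := fun α => by
      have h1 : Tendsto (fun ξ : ℝ => 1 + I * ξ * (ν α ξ / 2)) (𝓝 0)
          (𝓝 (1 + I * 0 * (b α / 2))) :=
        tendsto_const_nhds.add ((tendsto_const_nhds.mul hc0).mul ((hνt α).div_const 2))
      have h2 := (hνt α).div h1 (by simp)
      simp only [mul_zero, zero_mul, add_zero, div_one] at h2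
      exact h2
    -- The product of the `w - κ` as a quotient of determinants: analytic in `ξ`, although the
    -- individual `κ` need not be.
    let G : ℂ → ℂ → ℂ := fun w ξ =>
      LinearMap.det ((w • (1 : (ℂ × C) →L[ℂ] (ℂ × C)) - (1 - w * (I * ξ / 2)) • W ξ :
          (ℂ × C) →L[ℂ] (ℂ × C)) : Module.End ℂ (ℂ × C)) /
        LinearMap.det (((1 : ℂ) • (1 : (ℂ × C) →L[ℂ] (ℂ × C)) - (-(I * ξ / 2)) • W ξ :
          (ℂ × C) →L[ℂ] (ℂ × C)) : Module.End ℂ (ℂ × C))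
    have hG : ∀ w, AnalyticAt ℂ (G w) 0 := by
      intro w
      have hlin : AnalyticAt ℂ (fun ξ : ℂ => I * ξ / 2) 0 := by fun_prop
      refine (analyticAt_det (analyticAt_const.sub ((analyticAt_const.sub
        (analyticAt_const.mul hlin)).smul hW))).div
        (analyticAt_det (analyticAt_const.sub (hlin.neg.smul hW))) ?_
      have : (((1 : ℂ) • (1 : (ℂ × C) →L[ℂ] (ℂ × C)) - (-(I * 0 / 2)) • W 0 :
          (ℂ × C) →L[ℂ] (ℂ × C)) : Module.End ℂ (ℂ × C)) = 1 := by
        refine LinearMap.ext fun y => ?_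
        simp
      rw [this, map_one]
      exact one_ne_zero
    have hGκ : ∀ w, ∀ ξ ∈ Set.Icc (-ξ₀) ξ₀, G w ξ = ∏ α, (w - κ α ξ) := by
      intro w ξ hξ
      have h1 := det_smul_sub_smul (hν ξ hξ) w (1 - w * (I * ξ / 2))
      have h2 := det_smul_sub_smul (hν ξ hξ) 1 (-(I * ξ / 2))
      change LinearMap.det (w • (1 : Module.End ℂ (ℂ × C)) - (1 - w * (I * ξ / 2)) •
        (W ξ : Module.End ℂ (ℂ × C))) / LinearMap.det ((1 : ℂ) • (1 : Module.End ℂ (ℂ × C)) -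
        (-(I * ξ / 2)) • (W ξ : Module.End ℂ (ℂ × C))) = _
      rw [h1, h2, ← Finset.prod_div_distrib]
      refine Finset.prod_congr rfl fun α _ => ?_
      have h3 := hne ξ hξ _ (hR2 ξ hξ α)
      have h4 : 1 - -(I * ξ / 2) * ν α ξ = 1 + I * ξ * (ν α ξ / 2) := by ring
      have h5 : κ α ξ * (1 + I * ξ * (ν α ξ / 2)) = ν α ξ := div_mul_cancel₀ _ h3
      rw [h4, div_eq_iff h3]
      linear_combination h5
    have heven : ∀ w, ∀ᶠ ξ : ℝ in 𝓝 0, G w ((-ξ : ℝ) : ℂ) = G w ξ := by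
      intro w
      filter_upwards [hnhds] with ξ hξ
      rcases eq_or_ne ξ 0 with rfl | hξ0
      · simp
      have hξ' : -ξ ∈ Set.Icc (-ξ₀) ξ₀ := ⟨by linarith [hξ.2], by linarith [hξ.1]⟩
      rw [hGκ w _ hξ', hGκ w _ hξ]
      have h1 := congrArg (fun s : Multiset ℂ =>
        (s.map fun x => w - x / (1 + I * ((-ξ : ℝ) : ℂ) * (x / 2))).prod) (hrefl ξ hξ hξ0)
      simp only [Multiset.map_map] at h1
      refine h1.trans (Finset.prod_congr rfl fun α _ => ?_)
      have h3 := hne ξ hξ _ (hR2 ξ hξ α)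
      have h4 := hne ξ hξ (ν α ξ) ((hνR ξ hξ α).trans (by linarith))
      have h5 : 1 + I * ((-ξ : ℝ) : ℂ) * (ν α ξ / (1 + I * ξ * ν α ξ) / 2)
          = (1 + I * ξ * (ν α ξ / 2)) / (1 + I * ξ * ν α ξ) := by
        have h6 : ν α ξ / (1 + I * ξ * ν α ξ) * (1 + I * ξ * ν α ξ) = ν α ξ :=
          div_mul_cancel₀ _ h4
        rw [eq_div_iff h4]
        push_cast
        linear_combination (-(I * ξ) / 2) * h6
      simp only [Function.comp_apply]
      rw [h5, div_div_div_cancel_right₀ h4]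
    have hκO : ∀ α, (fun ξ => (∏ β, (X - Polynomial.C (b β))).eval (κ α ξ))
        =O[𝓝 0] fun ξ : ℝ => |ξ| ^ 2 := by
      intro α
      let q : ℝ → ℂ[X] := fun ξ =>
        ∏ β, (X - Polynomial.C (κ β ξ)) - ∏ β, (X - Polynomial.C (b β))
      have hdeg : ∀ x : Fin r → ℂ, (∏ β, (X - Polynomial.C (x β))).natDegree = r := fun x => by
        rw [natDegree_prod_of_monic _ _ fun α _ => monic_X_sub_C _]; simp
      have h1 := isBigO_eval_of_forall (r := r) (q := q) (h := fun ξ => |ξ| ^ 2)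
        (fun ξ => (natDegree_sub_le _ _).trans (by rw [hdeg, hdeg, max_self])) (fun w => by
          refine (isBigO_sq_of_even (hG w) (heven w)).congr' ?_ EventuallyEq.rfl
          filter_upwards [hnhds] with ξ hξ
          have h0 := hGκ w 0 h0mem
          rw [Complex.ofReal_zero] at h0
          rw [hGκ w ξ hξ, h0]
          simp [q, eval_prod, hκ0]) (hκt α)
      refine h1.neg_left.congr_left fun ξ => ?_
      have h2 : (∏ β, (X - Polynomial.C (κ β ξ))).eval (κ α ξ) = 0 := by
        rw [eval_prod]
        exact Finset.prod_eq_zero (Finset.mem_univ α) (by simp)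
      simp only [q, eval_sub, h2, zero_sub, neg_neg]
    obtain ⟨g, hg, hgb⟩ := exists_eq_pow_rootMultiplicity_mul_and_not_dvd _
      (monic_prod_of_monic Finset.univ (fun β => X - Polynomial.C (b β))
        fun α _ => monic_X_sub_C _).ne_zero (b α)
    rw [hb] at hb2
    set μ := (∏ β, (X - Polynomial.C (b β))).rootMultiplicity (b α) with hμ
    have hμ0 : μ ≠ 0 := by
      refine (Nat.pos_iff_ne_zero.1 ((rootMultiplicity_pos (monic_prod_of_monic Finset.univ
        (fun β => X - Polynomial.C (b β)) fun α _ => monic_X_sub_C _).ne_zero).2 ?_))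
      rw [IsRoot, eval_prod]
      exact Finset.prod_eq_zero (Finset.mem_univ α) (by simp)
    -- This is where multiplicity at most two enters: `|ξ|²` must be dominated by `|ξ|^μ`.
    have h1 : (fun ξ => κ α ξ - b α) =O[𝓝 0] fun ξ : ℝ => |ξ| := by
      refine isBigO_root hμ0 hg (fun h0 => hgb (dvd_iff_isRoot.2 h0)) (hκt α)
        ((hκO α).trans (IsBigO.of_bound 1 ?_))
      have hξ1 : ∀ᶠ ξ : ℝ in 𝓝 0, |ξ| < 1 :=
        (continuous_abs.tendsto (0 : ℝ)).eventually_lt_const (by simp)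
      filter_upwards [hξ1] with ξ h
      rw [norm_pow, norm_pow, one_mul, Real.norm_eq_abs, abs_abs]
      exact pow_le_pow_of_le_one (abs_nonneg _) h.le hb2
    have h2 : (fun ξ : ℝ => κ α ξ * (I * ξ * (ν α ξ / 2))) =O[𝓝 0] fun ξ : ℝ => |ξ| := by
      have h3 := ((hκt α).isBigO_one ℝ)
      have h4 := (((hνt α).div_const 2).isBigO_one ℝ)
      have h5 : (fun ξ : ℝ => I * (ξ : ℂ)) =O[𝓝 0] fun ξ : ℝ => |ξ| :=
        IsBigO.of_bound 1 (Eventually.of_forall fun ξ => by simp [I])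
      exact (h3.mul (h5.mul h4)).congr_right fun ξ => by simp
    have h3 : (fun ξ => ν α ξ - b α) =O[𝓝 0] fun ξ : ℝ => |ξ| ^ (1 : ℝ) := by
      refine (h1.add h2).congr' ?_ (Eventually.of_forall fun ξ => by simp)
      filter_upwards [hnhds] with ξ hξ
      have h4 : κ α ξ * (1 + I * ξ * (ν α ξ / 2)) = ν α ξ :=
        div_mul_cancel₀ _ (hne ξ hξ _ (hR2 ξ hξ α))
      linear_combination h4
    refine (isBigO_multiplier one_pos le_rfl h3).congr_right fun ξ => ?_
    rw [one_add_one_eq_two]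
    exact_mod_cast Real.rpow_natCast |ξ| 2

end ModulationData

/-! ### The lattice system on windows of five values -/

/-- The values of `v` at the points `x - 2h`, …, `x + 2h`. -/
def window {G X : Type*} [AddCommGroup G] (h : G) (v : G → X) (x : G) : Fin 5 → X :=
  fun m => v (x + ((m : ℤ) - 2) • h)

section Window

variable {G X : Type*} [AddCommGroup G] (h : G) (v : G → X) (x : G)

@[simp] theorem window_zero : window h v x 0 = v (x - h - h) := by
  simp only [window]; congr 1; simp; abel

@[simp] theorem window_one : window h v x 1 = v (x - h) := by
  simp only [window]; congr 1; simp; abel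

@[simp] theorem window_two : window h v x 2 = v x := by
  simp only [window]; congr 1; simp

@[simp] theorem window_three : window h v x 3 = v (x + h) := by
  simp only [window]; congr 1; simp

@[simp] theorem window_four : window h v x 4 = v (x + h + h) := by
  simp only [window]; congr 1; simp; abel

end Window

namespace System

variable {d : ℕ} (L : System d)

/-- The Euler operator as a function of three consecutive values. -/
def euler₃ (a b c : Fin d → ℝ) : Fin d → ℝ :=
  L.gradU (b, L.η • (c - b)) + L.η • (L.gradW (a, L.η • (b - a)) - L.gradW (b, L.η • (c - b)))

/-- The vector field of the lattice system as a function of five consecutive values. -/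
def field (w : Fin 5 → Fin d → ℝ) : Fin d → ℝ :=
  (L.η / 2) • (L.B *ᵥ L.euler₃ (w 2) (w 3) (w 4) - L.B *ᵥ L.euler₃ (w 0) (w 1) (w 2))

/-- The densities of the conserved quantities: the components and the Hamiltonian. -/
def density (w : Fin 5 → Fin d → ℝ) : Option (Fin d) → ℝ :=
  fun o => o.elim (L.H (w 2, L.η • (w 3 - w 2))) fun i => w 2 i

/-- The fluxes of the conserved quantities. -/
def flux (w : Fin 5 → Fin d → ℝ) : Option (Fin d) → ℝ :=
  fun o => o.elim
    (L.η * ((1 / 2) * (L.euler₃ (w 0) (w 1) (w 2) ⬝ᵥ (L.B *ᵥ L.euler₃ (w 1) (w 2) (w 3)))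
      + L.gradW (w 1, L.η • (w 2 - w 1)) ⬝ᵥ L.field w))
    -- Summing two neighbouring values writes the centered difference of the field as a forward
    -- difference of the flux.
    fun i => (L.η / 2) * (L.B *ᵥ (L.euler₃ (w 1) (w 2) (w 3) + L.euler₃ (w 0) (w 1) (w 2))) i

section Smooth

theorem contDiff_gradU : ContDiff ℝ ∞ L.gradU := by
  rw [contDiff_pi]
  intro i
  exact (L.smooth.fderiv_right (m := ∞) (by simp)).clm_apply contDiff_const

theorem contDiff_gradW : ContDiff ℝ ∞ L.gradW := by
  rw [contDiff_pi]
  intro i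
  exact (L.smooth.fderiv_right (m := ∞) (by simp)).clm_apply contDiff_const

theorem contDiff_mulVec {X : Type*} [NormedAddCommGroup X] [NormedSpace ℝ X]
    {f : X → Fin d → ℝ} (hf : ContDiff ℝ ∞ f) : ContDiff ℝ ∞ fun x => L.B *ᵥ f x :=
  (LinearMap.toContinuousLinearMap (Matrix.mulVecLin L.B)).contDiff.comp hf

theorem contDiff_dotProduct {X : Type*} [NormedAddCommGroup X] [NormedSpace ℝ X]
    {f g : X → Fin d → ℝ} (hf : ContDiff ℝ ∞ f) (hg : ContDiff ℝ ∞ g) :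
    ContDiff ℝ ∞ fun x => f x ⬝ᵥ g x :=
  ContDiff.sum fun i _ => ((contDiff_pi.1 hf) i).mul ((contDiff_pi.1 hg) i)

theorem contDiff_coord (m : Fin 5) : ContDiff ℝ ∞ fun w : Fin 5 → Fin d → ℝ => w m :=
  contDiff_apply ℝ (Fin d → ℝ) m

theorem contDiff_jet₂ (m n : Fin 5) :
    ContDiff ℝ ∞ fun w : Fin 5 → Fin d → ℝ => (w m, L.η • (w n - w m)) :=
  (contDiff_coord m).prodMk (((contDiff_coord n).sub (contDiff_coord m)).const_smul L.η)

theorem contDiff_euler₃ (l m n : Fin 5) :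
    ContDiff ℝ ∞ fun w : Fin 5 → Fin d → ℝ => L.euler₃ (w l) (w m) (w n) :=
  (L.contDiff_gradU.comp (L.contDiff_jet₂ m n)).add
    (((L.contDiff_gradW.comp (L.contDiff_jet₂ l m)).sub
      (L.contDiff_gradW.comp (L.contDiff_jet₂ m n))).const_smul L.η)

theorem contDiff_field : ContDiff ℝ ∞ L.field :=
  ((L.contDiff_mulVec (L.contDiff_euler₃ 2 3 4)).sub
    (L.contDiff_mulVec (L.contDiff_euler₃ 0 1 2))).const_smul (L.η / 2)

theorem contDiff_density : ContDiff ℝ ∞ L.density := by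
  rw [contDiff_pi]
  rintro (_ | i)
  · exact L.smooth.comp (L.contDiff_jet₂ 2 3)
  · exact contDiff_pi.1 (contDiff_coord 2) i

theorem contDiff_flux : ContDiff ℝ ∞ L.flux := by
  rw [contDiff_pi]
  rintro (_ | i)
  · exact contDiff_const.mul ((contDiff_const.mul (contDiff_dotProduct (L.contDiff_euler₃ 0 1 2)
      (L.contDiff_mulVec (L.contDiff_euler₃ 1 2 3)))).add
      (contDiff_dotProduct (L.contDiff_gradW.comp (L.contDiff_jet₂ 1 2)) L.contDiff_field))
  · exact contDiff_const.mul (contDiff_pi.1 (L.contDiff_mulVec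
      ((L.contDiff_euler₃ 1 2 3).add (L.contDiff_euler₃ 0 1 2))) i)

end Smooth

/-! ### Local conservation laws and their linearization -/

section Laws

variable {G : Type*} [AddCommGroup G] (h : G)

theorem euler_eq (v : G → Fin d → ℝ) (x : G) :
    L.euler h v x = L.euler₃ (v (x - h)) (v x) (v (x + h)) := by
  simp [euler, euler₃, jet, fwd, fwdAdj]

theorem J_euler_eq (v : G → Fin d → ℝ) (x : G) :
    L.J h (L.euler h v) x = L.field (window h v x) := by
  simp [J, ctr, field, euler_eq]

theorem fderiv_H (p : (Fin d → ℝ) × (Fin d → ℝ)) (a b : Fin d → ℝ) :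
    fderiv ℝ L.H p (a, b) = L.gradU p ⬝ᵥ a + L.gradW p ⬝ᵥ b := by
  have h1 : ∀ v : Fin d → ℝ, v = ∑ i, v i • (Pi.single i 1 : Fin d → ℝ) := fun v => by
    simpa using pi_eq_sum_univ' v
  have h2 : (a, b) = (ContinuousLinearMap.inl ℝ (Fin d → ℝ) (Fin d → ℝ)) a +
      (ContinuousLinearMap.inr ℝ (Fin d → ℝ) (Fin d → ℝ)) b := by simp
  rw [h2, map_add]
  conv_lhs => rw [h1 a, h1 b]
  simp only [map_sum, map_smul, dotProduct, gradU, gradW, smul_eq_mul,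
    ContinuousLinearMap.inl_apply, ContinuousLinearMap.inr_apply, mul_comm]

theorem fderiv_density_some (w z : Fin 5 → Fin d → ℝ) (i : Fin d) :
    fderiv ℝ L.density w z (some i) = z 2 i := by
  have h1 := hasFDerivAt_pi'.1 ((L.contDiff_density.differentiable (by simp) w).hasFDerivAt) (some i)
  have h2 : HasFDerivAt (fun w : Fin 5 → Fin d → ℝ => w 2 i)
      ((ContinuousLinearMap.proj i : (Fin d → ℝ) →L[ℝ] ℝ) ∘L
        (ContinuousLinearMap.proj 2 : (Fin 5 → Fin d → ℝ) →L[ℝ] (Fin d → ℝ))) w :=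
    ((ContinuousLinearMap.proj i : (Fin d → ℝ) →L[ℝ] ℝ) ∘L
        (ContinuousLinearMap.proj 2 : (Fin 5 → Fin d → ℝ) →L[ℝ] (Fin d → ℝ))).hasFDerivAt
  exact DFunLike.congr_fun (h1.unique h2) z

theorem fderiv_density_none (w z : Fin 5 → Fin d → ℝ) :
    fderiv ℝ L.density w z none = L.gradU (w 2, L.η • (w 3 - w 2)) ⬝ᵥ z 2
      + L.gradW (w 2, L.η • (w 3 - w 2)) ⬝ᵥ (L.η • (z 3 - z 2)) := by
  have h1 := hasFDerivAt_pi'.1 ((L.contDiff_density.differentiable (by simp) w).hasFDerivAt) none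
  have e (m : Fin 5) : HasFDerivAt (fun w : Fin 5 → Fin d → ℝ => w m)
      (ContinuousLinearMap.proj m : (Fin 5 → Fin d → ℝ) →L[ℝ] (Fin d → ℝ)) w :=
    (ContinuousLinearMap.proj m : (Fin 5 → Fin d → ℝ) →L[ℝ] (Fin d → ℝ)).hasFDerivAt
  have h2 : HasFDerivAt (fun w : Fin 5 → Fin d → ℝ => L.H (w 2, L.η • (w 3 - w 2))) _ w :=
    ((L.smooth.differentiable (by simp) _).hasFDerivAt).comp w
      ((e 2).prodMk (((e 3).fun_sub (e 2)).fun_const_smul L.η))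
  rw [← fderiv_H]
  exact DFunLike.congr_fun (h1.unique h2) z

/-- The local conservation laws of the lattice system. -/
theorem conservation (v : G → Fin d → ℝ) (x : G) :
    fderiv ℝ L.density (window h v x) (window h (fun y => L.field (window h v y)) x)
      = L.flux (window h v (x + h)) - L.flux (window h v x) := by
  funext o
  set e : G → Fin d → ℝ := L.euler h v with he
  have e3 : ∀ y, L.euler₃ (v (y - h)) (v y) (v (y + h)) = e y := fun y => (L.euler_eq h v y).symm
  have hf : ∀ y, L.field (window h v y) = (L.η / 2) • (L.B *ᵥ e (y + h) - L.B *ᵥ e (y - h)) :=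
    fun y => by rw [← J_euler_eq]; rfl
  rcases o with _ | i
  · rw [fderiv_density_none]
    simp only [flux, Option.elim, Pi.sub_apply, window_zero, window_one, window_two, window_three,
      add_sub_cancel_right]
    have e1 := e3 (x - h)
    have e2 := e3 x
    have e4 := e3 (x + h)
    simp only [sub_add_cancel, add_sub_cancel_right] at e1 e2 e4
    rw [e1, e2, e4]
    -- With the gradient in `U` expressed through the Euler operator, the terms in `gradW` combine
    -- into a forward difference. What remains is `e · field`, a forward difference too because `B`
    -- is symmetric (`hsym`).
    have hU : L.gradU (v x, L.η • (v (x + h) - v x)) = e x - L.η •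
        (L.gradW (v (x - h), L.η • (v x - v (x - h))) - L.gradW (v x, L.η • (v (x + h) - v x))) := by
      rw [← e2, euler₃]; abel
    rw [hU]
    have hsym : e x ⬝ᵥ (L.B *ᵥ e (x - h)) = e (x - h) ⬝ᵥ (L.B *ᵥ e x) := by
      rw [Matrix.dotProduct_mulVec, dotProduct_comm, ← Matrix.mulVec_transpose, L.symm.eq]
    have hfx : e x ⬝ᵥ L.field (window h v x)
        = (L.η / 2) * (e x ⬝ᵥ (L.B *ᵥ e (x + h)) - e (x - h) ⬝ᵥ (L.B *ᵥ e x)) := by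
      rw [hf, dotProduct_smul, dotProduct_sub, hsym, smul_eq_mul]
    simp only [sub_dotProduct, smul_dotProduct, dotProduct_smul, dotProduct_sub, smul_eq_mul, hfx]
    ring
  · rw [fderiv_density_some]
    simp only [flux, Option.elim, Pi.sub_apply, window_zero, window_one, window_two, window_three,
      add_sub_cancel_right]
    have e1 := e3 (x - h)
    have e2 := e3 x
    have e4 := e3 (x + h)
    simp only [sub_add_cancel, add_sub_cancel_right] at e1 e2 e4
    rw [e1, e2, e4, hf]
    simp only [Matrix.mulVec_add, Pi.smul_apply, Pi.sub_apply, Pi.add_apply, smul_eq_mul]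
    ring

theorem window_add_smul {X : Type*} [AddCommGroup X] [Module ℝ X] (v z : G → X) (ε : ℝ) (x : G) :
    window h (v + ε • z) x = window h v x + ε • window h z x := rfl

/-- The linearized conservation laws. -/
theorem linear_conservation (v z : G → Fin d → ℝ) (x : G) :
    fderiv ℝ (fderiv ℝ L.density) (window h v x) (window h z x)
        (window h (fun y => L.field (window h v y)) x)
      + fderiv ℝ L.density (window h v x)
          (window h (fun y => fderiv ℝ L.field (window h v y) (window h z y)) x)
      = fderiv ℝ L.flux (window h v (x + h)) (window h z (x + h))
        - fderiv ℝ L.flux (window h v x) (window h z x) := by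
  -- The nonlinear law holds for every sequence, not only for solutions, so it can be differentiated
  -- along the line `v + εz`.
  have line : ∀ y, HasDerivAt (fun ε : ℝ => window h (v + ε • z) y) (window h z y) 0 := fun y => by
    simp only [window_add_smul]
    simpa using ((hasDerivAt_id (0 : ℝ)).smul_const (window h z y)).const_add (window h v y)
  have chain : ∀ {X : Type _} [NormedAddCommGroup X] [NormedSpace ℝ X]
      {Φ : (Fin 5 → Fin d → ℝ) → X} (_ : Differentiable ℝ Φ) (y : G),
      HasDerivAt (fun ε : ℝ => Φ (window h (v + ε • z) y))
        (fderiv ℝ Φ (window h v y) (window h z y)) 0 := by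
    intro X _ _ Φ hΦ y
    have h1 : HasFDerivAt Φ (fderiv ℝ Φ (window h v y)) (window h (v + (0 : ℝ) • z) y) := by
      rw [zero_smul, add_zero]; exact (hΦ _).hasFDerivAt
    exact h1.comp_hasDerivAt (0 : ℝ) (line y)
  have h1 := chain ((L.contDiff_density.fderiv_right (m := ∞) (by simp)).differentiable (by simp)) x
  have h2 : HasDerivAt (fun ε : ℝ => window h (fun y => L.field (window h (v + ε • z) y)) x)
      (window h (fun y => fderiv ℝ L.field (window h v y) (window h z y)) x) 0 :=
    hasDerivAt_pi.2 fun m => chain (L.contDiff_field.differentiable (by simp)) _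
  have h3 := h1.clm_apply h2
  have h4 := (chain (L.contDiff_flux.differentiable (by simp)) (x + h)).fun_sub
    (chain (L.contDiff_flux.differentiable (by simp)) x)
  simp only [zero_smul, add_zero] at h3
  exact h3.unique (h4.congr_of_eventuallyEq (Eventually.of_forall fun ε => L.conservation h _ x))

end Laws

end System

/-! ### Complexification and the linearized conservation laws -/

/-- A real vector seen as a complex one. -/
def cvec {κ : Type*} (v : κ → ℝ) : κ → ℂ := fun i => (v i : ℂ)

section Complexification

variable {κ : Type*}

theorem cvec_add (v w : κ → ℝ) : cvec (v + w) = cvec v + cvec w := by funext i; simp [cvec]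

theorem cvec_sub (v w : κ → ℝ) : cvec (v - w) = cvec v - cvec w := by funext i; simp [cvec]

theorem cvec_smul (r : ℝ) (v : κ → ℝ) : cvec (r • v) = (r : ℂ) • cvec v := by
  funext i; simp [cvec]

theorem cvec_smul' (r : ℝ) (v : κ → ℝ) : cvec (r • v) = r • cvec v := by
  funext i; simp [cvec]

theorem cvec_zero : cvec (0 : κ → ℝ) = 0 := by funext i; simp [cvec]

theorem cvec_sum {ι : Type*} (s : Finset ι) (v : ι → κ → ℝ) :
    cvec (∑ j ∈ s, v j) = ∑ j ∈ s, cvec (v j) := by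
  funext i; simp [cvec, Finset.sum_apply]

theorem hasDerivAt_cvec [Fintype κ] {v : ℝ → κ → ℝ} {v' : κ → ℝ} {t : ℝ} (hv : HasDerivAt v v' t) :
    HasDerivAt (fun t => cvec (v t)) (cvec v') t :=
  hasDerivAt_pi.2 fun i => (hasDerivAt_pi.1 hv i).ofReal_comp

theorem exists_cvec_add_I_smul_cvec (v : κ → ℂ) :
    v = cvec (fun i => (v i).re) + Complex.I • cvec (fun i => (v i).im) := by
  funext i
  simp only [Pi.add_apply, Pi.smul_apply, cvec, smul_eq_mul]
  rw [mul_comm, Complex.re_add_im]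

theorem mulVec_cvec {m : Type*} [Fintype κ] (A : Matrix m κ ℝ) (v : κ → ℝ) :
    A.map ((↑) : ℝ → ℂ) *ᵥ cvec v = cvec (A *ᵥ v) := by
  funext i
  simp [Matrix.mulVec, dotProduct, cvec]

variable {d : ℕ} {ι : Type*} [Fintype ι]

/-- The complexification of real linear maps on windows. -/
def cx : ((Fin 5 → Fin d → ℝ) →L[ℝ] (ι → ℝ)) →L[ℝ] ((Fin 5 → Fin d → ℂ) →L[ℂ] (ι → ℂ)) :=
  LinearMap.toContinuousLinearMap
    { toFun := fun Λ => LinearMap.toContinuousLinearMap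
        { toFun := fun Z i => ∑ m, ∑ l, ((Λ (Pi.single m (Pi.single l 1)) i : ℝ) : ℂ) * Z m l
          map_add' := fun Z Z' => by
            funext i
            simp [mul_add, Finset.sum_add_distrib]
          map_smul' := fun c Z => by
            funext i
            simp [Finset.mul_sum, mul_left_comm] }
      map_add' := fun Λ Λ' => by
        refine ContinuousLinearMap.ext fun Z => ?_
        funext i
        simp [add_mul, Finset.sum_add_distrib]
      map_smul' := fun r Λ => by
        refine ContinuousLinearMap.ext fun Z => ?_
        funext i
        simp [Finset.mul_sum, mul_assoc] }

theorem cx_cvec (Λ : (Fin 5 → Fin d → ℝ) →L[ℝ] (ι → ℝ)) (z : Fin 5 → Fin d → ℝ) :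
    cx Λ (fun m => cvec (z m)) = cvec (Λ z) := by
  funext i
  have h1 : z = ∑ m, ∑ l, z m l • (Pi.single m (Pi.single l 1) : Fin 5 → Fin d → ℝ) := by
    funext m l
    rw [Finset.sum_apply, Finset.sum_apply, Finset.sum_eq_single m, Finset.sum_apply,
      Finset.sum_apply, Finset.sum_eq_single l]
    · simp
    · intro l' _ hl
      simp [Ne.symm hl]
    · simp
    · intro m' _ hm
      simp [Finset.sum_apply, Ne.symm hm]
    · simp
  conv_rhs => rw [h1]
  simp [cx, cvec, mul_comm]

end Complexification

namespace System

variable {d : ℕ} (L : System d)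

theorem jac_mulVec_cvec (f : (Fin d → ℝ) × (Fin d → ℝ) → Fin d → ℝ) (p : (Fin d → ℝ) × (Fin d → ℝ))
    (a b : Fin d → ℝ) :
    jacU f p *ᵥ cvec a + jacW f p *ᵥ cvec b = cvec (fderiv ℝ f p (a, b)) := by
  have h1 : ∀ v : Fin d → ℝ, v = ∑ i, v i • (Pi.single i 1 : Fin d → ℝ) := fun v => by
    simpa using pi_eq_sum_univ' v
  have h2 : (a, b) = (ContinuousLinearMap.inl ℝ (Fin d → ℝ) (Fin d → ℝ)) a +
      (ContinuousLinearMap.inr ℝ (Fin d → ℝ) (Fin d → ℝ)) b := by simp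
  funext i
  conv_rhs => rw [h2, h1 a, h1 b]
  simp only [map_add, map_sum, map_smul, ContinuousLinearMap.inl_apply,
    ContinuousLinearMap.inr_apply]
  simp [jacU, jacW, Matrix.mulVec, dotProduct, cvec, Finset.sum_apply, mul_comm]

theorem linJet_cvec (f : (Fin d → ℝ) × (Fin d → ℝ) → Fin d → ℝ) (U v : ℤ → Fin d → ℝ) (j : ℤ) :
    L.linJet f U (fun j => cvec (v j)) j = cvec (fderiv ℝ f (L.jet 1 U j) (L.jet 1 v j)) := by
  rw [linJet, jet, ← jac_mulVec_cvec]
  congr 2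
  funext i
  simp [fwd, cvec, jet]

/-- Both expressions complexify the derivative at `ε = 0` of the vector field at `U + εv`, computed
once through jets and difference operators and once through windows. -/
theorem linField_cvec (U v : ℤ → Fin d → ℝ) (j : ℤ) :
    L.linField U (fun j => cvec (v j)) j
      = cvec (fderiv ℝ L.field (window 1 U j) (window 1 v j)) := by
  have hjet : ∀ y, HasDerivAt (fun ε : ℝ => L.jet 1 (U + ε • v) y) (L.jet 1 v y) 0 := by
    intro y
    have h1 : ∀ ε : ℝ, L.jet 1 (U + ε • v) y = L.jet 1 U y + ε • L.jet 1 v y := fun ε => by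
      simp only [jet, fwd, Pi.add_apply, Pi.smul_apply, Prod.smul_mk, Prod.mk_add_mk]
      congr 1
      module
    simp only [h1]
    simpa using ((hasDerivAt_id (0 : ℝ)).smul_const (L.jet 1 v y)).const_add (L.jet 1 U y)
  have chain : ∀ {Φ : (Fin d → ℝ) × (Fin d → ℝ) → Fin d → ℝ} (_ : Differentiable ℝ Φ) (y : ℤ),
      HasDerivAt (fun ε : ℝ => Φ (L.jet 1 (U + ε • v) y))
        (fderiv ℝ Φ (L.jet 1 U y) (L.jet 1 v y)) 0 := by
    intro Φ hΦ y
    have h1 : HasFDerivAt Φ (fderiv ℝ Φ (L.jet 1 U y)) (L.jet 1 (U + (0 : ℝ) • v) y) := by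
      rw [zero_smul, add_zero]; exact (hΦ _).hasFDerivAt
    exact h1.comp_hasDerivAt (0 : ℝ) (hjet y)
  have hU := chain (L.contDiff_gradU.differentiable (by simp))
  have hW := chain (L.contDiff_gradW.differentiable (by simp))
  let e' : ℤ → Fin d → ℝ := fun y => fderiv ℝ L.gradU (L.jet 1 U y) (L.jet 1 v y) +
    fwdAdj L.η 1 (fun y => fderiv ℝ L.gradW (L.jet 1 U y) (L.jet 1 v y)) y
  have he : ∀ y, HasDerivAt (fun ε : ℝ => L.euler 1 (U + ε • v) y) (e' y) 0 := fun y =>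
    (hU y).fun_add (((hW (y - 1)).fun_sub (hW y)).fun_const_smul L.η)
  have hB : ∀ y, HasDerivAt (fun ε : ℝ => L.B *ᵥ L.euler 1 (U + ε • v) y) (L.B *ᵥ e' y) 0 := fun y =>
    (LinearMap.toContinuousLinearMap (Matrix.mulVecLin L.B)).hasFDerivAt.comp_hasDerivAt (0 : ℝ) (he y)
  have hJ : HasDerivAt (fun ε : ℝ => L.J 1 (L.euler 1 (U + ε • v)) j) (L.J 1 e' j) 0 :=
    ((hB (j + 1)).fun_sub (hB (j - 1))).fun_const_smul (L.η / 2)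
  have hF : HasDerivAt (fun ε : ℝ => L.field (window 1 (U + ε • v) j))
      (fderiv ℝ L.field (window 1 U j) (window 1 v j)) 0 := by
    have h1 : HasFDerivAt L.field (fderiv ℝ L.field (window 1 U j))
        (window 1 (U + (0 : ℝ) • v) j) := by
      rw [zero_smul, add_zero]
      exact (L.contDiff_field.differentiable (by simp) _).hasFDerivAt
    have h2 : HasDerivAt (fun ε : ℝ => window 1 (U + ε • v) j) (window 1 v j) 0 := by
      simp only [window_add_smul]
      simpa using ((hasDerivAt_id (0 : ℝ)).smul_const (window 1 v j)).const_add (window 1 U j)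
    exact h1.comp_hasDerivAt (0 : ℝ) h2
  simp only [J_euler_eq] at hJ
  rw [hF.unique hJ]
  have hE : ∀ y, L.linEuler U (fun j => cvec (v j)) y = cvec (e' y) := by
    intro y
    simp only [linEuler, fwdAdj, linJet_cvec, e', cvec_add, cvec_smul', cvec_sub]
  change ctr L.η 1 (fun j => L.B.map ((↑) : ℝ → ℂ) *ᵥ L.linEuler U (fun j => cvec (v j)) j) j = _
  simp only [ctr, hE, mulVec_cvec, J, cvec_smul', cvec_sub]

theorem complex_induction {X : Type*} [AddCommGroup X] [Module ℂ X]
    {f g : (ℤ → Fin d → ℂ) →ₗ[ℂ] X} (h : ∀ v : ℤ → Fin d → ℝ, f (fun j => cvec (v j)) = g fun j => cvec (v j))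
    (V : ℤ → Fin d → ℂ) : f V = g V := by
  have : V = (fun j => cvec fun i => (V j i).re) + Complex.I • fun j => cvec fun i => (V j i).im := by
    funext j
    exact exists_cvec_add_I_smul_cvec (V j)
  rw [this, map_add, map_add, map_smul, map_smul, h, h]

/-- Windows of complex sequences, as a linear map. -/
def windowₗ (j : ℤ) : (ℤ → Fin d → ℂ) →ₗ[ℂ] (Fin 5 → Fin d → ℂ) where
  toFun V := window 1 V j
  map_add' _ _ := rfl
  map_smul' _ _ := rfl

theorem linField_eq (U : ℤ → Fin d → ℝ) (V : ℤ → Fin d → ℂ) (j : ℤ) :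
    L.linField U V j = cx (fderiv ℝ L.field (window 1 U j)) (window 1 V j) := by
  refine complex_induction (f := LinearMap.proj j ∘ₗ L.linField U)
    (g := (cx (fderiv ℝ L.field (window 1 U j)) : _ →ₗ[ℂ] _) ∘ₗ windowₗ j) (fun v => ?_) V
  exact (L.linField_cvec U v j).trans (cx_cvec _ _).symm

/-- Real sequences span the complex ones, so the real linearized law suffices. Symmetry of the
second derivative puts the perturbation in the last slot, where the complexification acts on it. -/
theorem complex_conservation (U : ℤ → Fin d → ℝ) (Z : ℤ → Fin d → ℂ) (x : ℤ) :
    cx (fderiv ℝ (fderiv ℝ L.density) (window 1 U x)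
        (window 1 (fun y => L.field (window 1 U y)) x)) (window 1 Z x)
      + cx (fderiv ℝ L.density (window 1 U x))
          (window 1 (fun y => cx (fderiv ℝ L.field (window 1 U y)) (window 1 Z y)) x)
      = cx (fderiv ℝ L.flux (window 1 U (x + 1))) (window 1 Z (x + 1))
        - cx (fderiv ℝ L.flux (window 1 U x)) (window 1 Z x) := by
  let f : (ℤ → Fin d → ℂ) →ₗ[ℂ] (Option (Fin d) → ℂ) :=
    (cx (fderiv ℝ (fderiv ℝ L.density) (window 1 U x)
        (window 1 (fun y => L.field (window 1 U y)) x)) : _ →ₗ[ℂ] _) ∘ₗ windowₗ x +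
      (cx (fderiv ℝ L.density (window 1 U x)) : _ →ₗ[ℂ] _) ∘ₗ windowₗ x ∘ₗ
        LinearMap.pi fun y =>
          (cx (fderiv ℝ L.field (window 1 U y)) : (Fin 5 → Fin d → ℂ) →ₗ[ℂ] (Fin d → ℂ)) ∘ₗ windowₗ y
  let g : (ℤ → Fin d → ℂ) →ₗ[ℂ] (Option (Fin d) → ℂ) :=
    (cx (fderiv ℝ L.flux (window 1 U (x + 1))) : _ →ₗ[ℂ] _) ∘ₗ windowₗ (x + 1) -
      (cx (fderiv ℝ L.flux (window 1 U x)) : _ →ₗ[ℂ] _) ∘ₗ windowₗ x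
  refine complex_induction (f := f) (g := g) (fun z => ?_) Z
  have hs := (L.contDiff_density.contDiffAt (x := window 1 U x)).isSymmSndFDerivAt
    (by rw [minSmoothness_of_isRCLikeNormedField]; exact WithTop.coe_le_coe.2 (le_top : (2 : ℕ∞) ≤ ⊤))
  have h1 := congrArg cvec (L.linear_conservation 1 U z x)
  rw [hs.eq, cvec_add, cvec_sub, ← cx_cvec, ← cx_cvec, ← cx_cvec, ← cx_cvec] at h1
  refine Eq.trans ?_ h1
  change _ + cx _ (window 1 (fun y => cx (fderiv ℝ L.field (window 1 U y))
    (fun m => cvec (window 1 z y m))) x) = _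
  rw [funext fun y => cx_cvec (fderiv ℝ L.field (window 1 U y)) (window 1 z y)]
  rfl

end System

/-! ### Bloch operators with periodic coefficients -/

theorem hasDerivAt_complex_clm_apply {E F : Type*} [NormedAddCommGroup E] [NormedSpace ℂ E]
    [NormedAddCommGroup F] [NormedSpace ℂ F] {c : ℝ → E →L[ℂ] F} {c' : E →L[ℂ] F} {v : ℝ → E} {v' : E}
    {t : ℝ} (hc : HasDerivAt c c' t) (hv : HasDerivAt v v' t) :
    HasDerivAt (fun t => c t (v t)) (c' (v t) + c t v') t := by
  have h := (ContinuousLinearMap.restrictScalarsL ℂ E F ℝ ℝ).hasFDerivAt.comp_hasDerivAt t hc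
  exact h.clm_apply hv

section Stencil

variable {d N : ℕ} {ι : Type*} [Fintype ι]

/-- The values at `j - 2, …, j + 2` of `e^{i(· - j)ξ} f`. -/
def blochWindow (ξ : ℂ) (j : ZMod N) : PerSeq d N →L[ℂ] (Fin 5 → Fin d → ℂ) :=
  ContinuousLinearMap.pi fun m => Complex.exp (Complex.I * ((((m : ℕ) : ℤ) - 2 : ℤ) : ℂ) * ξ) •
    (ContinuousLinearMap.proj (j + ((((m : ℕ) : ℤ) - 2 : ℤ) : ZMod N)) :
      (ZMod N → Fin d → ℂ) →L[ℂ] (Fin d → ℂ))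

theorem blochWindow_apply (ξ : ℂ) (j : ZMod N) (f : PerSeq d N) (m : Fin 5) :
    blochWindow ξ j f m = Complex.exp (Complex.I * ((((m : ℕ) : ℤ) - 2 : ℤ) : ℂ) * ξ) •
      f (j + ((((m : ℕ) : ℤ) - 2 : ℤ) : ZMod N)) := rfl

/-- The sequence `e^{i·ξ} f`. -/
def modulate (ξ : ℂ) (f : PerSeq d N) : ℤ → Fin d → ℂ :=
  fun l => Complex.exp (Complex.I * (l : ℂ) * ξ) • f (l : ZMod N)

/-- Pulling out the factor `e^{ixξ}` leaves an expression in the class of `x` modulo `N` only; this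
is how operators on sequences become Bloch symbols. -/
theorem window_modulate (ξ : ℂ) (f : PerSeq d N) (x : ℤ) :
    window 1 (modulate ξ f) x = Complex.exp (Complex.I * (x : ℂ) * ξ) • blochWindow ξ (x : ZMod N) f := by
  funext m
  simp only [window, modulate, Pi.smul_apply, blochWindow_apply, smul_smul, ← Complex.exp_add]
  congr 2
  · push_cast; simp; ring
  · simp

/-- The operator with symbol `ξ` and real coefficients `K j` on windows. -/
def stencilOp (K : ZMod N → ((Fin 5 → Fin d → ℝ) →L[ℝ] (ι → ℝ))) (ξ : ℂ) :
    PerSeq d N →L[ℂ] (ZMod N → ι → ℂ) :=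
  ContinuousLinearMap.pi fun j => cx (K j) ∘L blochWindow ξ j

theorem stencilOp_apply (K : ZMod N → ((Fin 5 → Fin d → ℝ) →L[ℝ] (ι → ℝ))) (ξ : ℂ) (f : PerSeq d N)
    (j : ZMod N) : stencilOp K ξ f j = cx (K j) (blochWindow ξ j f) := rfl

variable [NeZero N]

theorem continuous_stencilOp {K : ℝ → ZMod N → ((Fin 5 → Fin d → ℝ) →L[ℝ] (ι → ℝ))}
    (hK : ∀ j, Continuous fun t => K t j) :
    Continuous (Function.uncurry fun (ξ : ℂ) (t : ℝ) => stencilOp (K t) ξ) := by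
  rw [continuous_clm_apply]
  intro f
  refine continuous_pi fun j => ?_
  have h1 : Continuous fun q : ℂ × ℝ => cx (K q.2 j) := cx.continuous.comp ((hK j).comp continuous_snd)
  refine h1.clm_apply (continuous_pi fun m => ?_)
  have : Continuous fun q : ℂ × ℝ =>
      Complex.exp (Complex.I * ((((m : ℕ) : ℤ) - 2 : ℤ) : ℂ) * q.1) := by fun_prop
  exact this.smul continuous_const

theorem hasDerivAt_blochWindow (ξ : ℂ) (f : PerSeq d N) (j : ZMod N) :
    HasDerivAt (fun ξ => blochWindow ξ j f) (fun m =>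
      (Complex.exp (Complex.I * ((((m : ℕ) : ℤ) - 2 : ℤ) : ℂ) * ξ) *
        (Complex.I * ((((m : ℕ) : ℤ) - 2 : ℤ) : ℂ))) • f (j + ((((m : ℕ) : ℤ) - 2 : ℤ) : ZMod N))) ξ := by
  refine hasDerivAt_pi.2 fun m => ?_
  have h1 : HasDerivAt (fun ξ : ℂ => Complex.exp (Complex.I * ((((m : ℕ) : ℤ) - 2 : ℤ) : ℂ) * ξ))
      (Complex.exp (Complex.I * ((((m : ℕ) : ℤ) - 2 : ℤ) : ℂ) * ξ) *
        (Complex.I * ((((m : ℕ) : ℤ) - 2 : ℤ) : ℂ))) ξ := by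
    simpa using ((hasDerivAt_id ξ).const_mul (Complex.I * ((((m : ℕ) : ℤ) - 2 : ℤ) : ℂ))).cexp
  exact h1.smul_const _

theorem differentiable_stencilOp (K : ZMod N → ((Fin 5 → Fin d → ℝ) →L[ℝ] (ι → ℝ))) :
    Differentiable ℂ fun ξ => stencilOp K ξ := by
  have h : ContDiff ℂ 1 fun ξ => stencilOp K ξ := by
    rw [contDiff_clm_apply_iff]
    intro f
    rw [contDiff_pi]
    intro j
    refine (contDiff_const (c := cx (K j))).clm_apply (contDiff_pi.2 fun m => ?_)
    have : ContDiff ℂ 1 fun ξ : ℂ =>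
      Complex.exp (Complex.I * ((((m : ℕ) : ℤ) - 2 : ℤ) : ℂ) * ξ) := by fun_prop
    exact this.smul contDiff_const
  exact h.differentiable (by simp)

theorem deriv_stencilOp (K : ZMod N → ((Fin 5 → Fin d → ℝ) →L[ℝ] (ι → ℝ))) (f : PerSeq d N)
    (j : ZMod N) : deriv (fun ξ => stencilOp K ξ) 0 f j = cx (K j) (fun m =>
      (Complex.I * ((((m : ℕ) : ℤ) - 2 : ℤ) : ℂ)) • f (j + ((((m : ℕ) : ℤ) - 2 : ℤ) : ZMod N))) := by
  have h1 : HasDerivAt (fun ξ => stencilOp K ξ f) (deriv (fun ξ => stencilOp K ξ) 0 f) 0 := by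
    simpa using ((differentiable_stencilOp K) 0).hasDerivAt.clm_apply (hasDerivAt_const (0 : ℂ) f)
  have h2 := (hasDerivAt_const (0 : ℂ) (cx (K j))).clm_apply (hasDerivAt_blochWindow 0 f j)
  have h3 := (hasDerivAt_pi.1 h1 j).unique h2
  rw [h3]
  simp

/-- The mean of a periodic sequence. -/
def mean : (ZMod N → ι → ℂ) →L[ℂ] (ι → ℂ) :=
  (1 / (N : ℂ)) • ∑ j, (ContinuousLinearMap.proj j : (ZMod N → ι → ℂ) →L[ℂ] (ι → ℂ))

theorem mean_apply (f : ZMod N → ι → ℂ) : mean f = (1 / (N : ℂ)) • ∑ j, f j := by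
  simp [mean, sum_apply]

/-- The generator augmented with the fluxes of conserved quantities. -/
def augmentedOp (K : ZMod N → ((Fin 5 → Fin d → ℝ) →L[ℝ] (Fin d → ℝ)))
    (K' : ZMod N → ((Fin 5 → Fin d → ℝ) →L[ℝ] (ι → ℝ))) (ξ : ℂ) :
    (PerSeq d N × (ι → ℂ)) →L[ℂ] (PerSeq d N × (ι → ℂ)) :=
  (stencilOp K ξ ∘L .fst ℂ _ _).prod ((mean ∘L stencilOp K' ξ) ∘L .fst ℂ _ _)

theorem augmentedOp_apply (K : ZMod N → ((Fin 5 → Fin d → ℝ) →L[ℝ] (Fin d → ℝ)))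
    (K' : ZMod N → ((Fin 5 → Fin d → ℝ) →L[ℝ] (ι → ℝ))) (ξ : ℂ) (y : PerSeq d N × (ι → ℂ)) :
    augmentedOp K K' ξ y = (stencilOp K ξ y.1, mean (stencilOp K' ξ y.1)) := rfl

theorem continuous_augmentedOp {K : ℝ → ZMod N → ((Fin 5 → Fin d → ℝ) →L[ℝ] (Fin d → ℝ))}
    {K' : ℝ → ZMod N → ((Fin 5 → Fin d → ℝ) →L[ℝ] (ι → ℝ))}
    (hK : ∀ j, Continuous fun t => K t j) (hK' : ∀ j, Continuous fun t => K' t j) :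
    Continuous (Function.uncurry fun (ξ : ℂ) (t : ℝ) => augmentedOp (K t) (K' t) ξ) := by
  have h1 := continuous_stencilOp hK
  have h2 := continuous_stencilOp hK'
  rw [continuous_clm_apply]
  intro y
  exact (h1.clm_apply continuous_const).prodMk
    (mean.continuous.comp (h2.clm_apply continuous_const))

theorem differentiable_augmentedOp (K : ZMod N → ((Fin 5 → Fin d → ℝ) →L[ℝ] (Fin d → ℝ)))
    (K' : ZMod N → ((Fin 5 → Fin d → ℝ) →L[ℝ] (ι → ℝ))) :
    Differentiable ℂ fun ξ => augmentedOp K K' ξ := by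
  have h : ContDiff ℂ 1 fun ξ => augmentedOp K K' ξ := by
    rw [contDiff_clm_apply_iff]
    intro y
    have h1 := contDiff_clm_apply_iff.1
      (Differentiable.contDiff (n := 1) (differentiable_stencilOp K)) y.1
    have h2 := contDiff_clm_apply_iff.1
      (Differentiable.contDiff (n := 1) (differentiable_stencilOp K')) y.1
    have h3 : ContDiff ℂ 1 fun ξ => mean (stencilOp K' ξ y.1) :=
      (mean (N := N) (ι := ι)).contDiff.comp h2
    exact h1.prodMk h3
  exact h.differentiable (by simp)

theorem deriv_augmentedOp (K : ZMod N → ((Fin 5 → Fin d → ℝ) →L[ℝ] (Fin d → ℝ)))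
    (K' : ZMod N → ((Fin 5 → Fin d → ℝ) →L[ℝ] (ι → ℝ))) (y : PerSeq d N × (ι → ℂ)) :
    deriv (fun ξ => augmentedOp K K' ξ) 0 y = (deriv (fun ξ => stencilOp K ξ) 0 y.1,
      mean (deriv (fun ξ => stencilOp K' ξ) 0 y.1)) := by
  have h1 := ((differentiable_augmentedOp K K') 0).hasDerivAt.clm_apply (hasDerivAt_const (0 : ℂ) y)
  have h2 := ((differentiable_stencilOp K) 0).hasDerivAt.clm_apply (hasDerivAt_const (0 : ℂ) y.1)
  have h3 := ((differentiable_stencilOp K') 0).hasDerivAt.clm_apply (hasDerivAt_const (0 : ℂ) y.1)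
  simp only [map_zero, add_zero] at h1 h2 h3
  have h4 : HasDerivAt (fun ξ => mean (stencilOp K' ξ y.1))
      (mean (deriv (fun ξ => stencilOp K' ξ) 0 y.1)) 0 :=
    (mean (N := N) (ι := ι)).hasFDerivAt.comp_hasDerivAt (0 : ℂ) h3
  exact h1.unique (h2.prodMk h4)

end Stencil

/-! ### The linearization about a wave with `N` cells per period -/

section Wave

variable {d : ℕ} (L : System d) (N : ℕ) [NeZero N] (u : ℝ → Fin d → ℝ) (w : ℝ)

/-- The window of the profile `u` at the cell `j`, at the time at which it is shifted by `t`. -/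
def waveWindow (t : ℝ) (j : ZMod N) : Fin 5 → Fin d → ℝ :=
  window (1 / (N : ℝ)) u ((j.val : ℝ) / N + t)

/-- The representative of `l` differs from `l` by a multiple of `N`, that is by an integer after
division by `N`. -/
theorem periodic_val {X : Type*} {u : ℝ → X} (hu : Function.Periodic u 1) (l : ℤ) (x : ℝ) :
    u (((l : ZMod N).val : ℝ) / N + x) = u ((l : ℝ) / N + x) := by
  have hN : (N : ℝ) ≠ 0 := Nat.cast_ne_zero.2 (NeZero.ne N)
  have h1 : (((l : ZMod N).val : ℤ)) = l % (N : ℤ) := ZMod.val_intCast l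
  have h2 : ((l : ZMod N).val : ℝ) = (l : ℝ) - (N : ℝ) * ((l / (N : ℤ) : ℤ) : ℝ) := by
    have h3 : ((l : ZMod N).val : ℤ) = l - N * (l / N) := by rw [h1, Int.emod_def]
    exact_mod_cast congrArg (fun z : ℤ => (z : ℝ)) h3
  have h4 : ((l : ZMod N).val : ℝ) / N + x = ((l : ℝ) / N + x) - ((l / (N : ℤ) : ℤ) : ℝ) * 1 := by
    rw [h2]; field_simp; ring
  rw [h4]
  exact hu.sub_int_mul_eq _

theorem window_intCast (t : ℝ) (x : ℤ) :
    window 1 (fun l : ℤ => u ((l : ℝ) / N + t)) x = window (1 / (N : ℝ)) u ((x : ℝ) / N + t) := by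
  funext m
  simp only [window]
  congr 1
  push_cast
  simp
  ring

variable {u} in
theorem waveWindow_intCast (hu : Function.Periodic u 1) (t : ℝ) (x : ℤ) :
    waveWindow N u t (x : ZMod N) = window 1 (fun l : ℤ => u ((l : ℝ) / N + t)) x := by
  funext m
  have h1 := periodic_val N hu x (t + (((m : ℕ) : ℤ) - 2) • (1 / (N : ℝ)))
  rw [window_intCast]
  simp only [waveWindow, window]
  rw [add_assoc, h1, add_assoc]

variable {u} in
theorem waveWindow_add_one (hu : Function.Periodic u 1) (t : ℝ) (j : ZMod N) :
    waveWindow N u (t + 1) j = waveWindow N u t j := by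
  funext m
  simp only [waveWindow, window]
  refine Eq.trans (congrArg u ?_) (hu _)
  ring

variable {u} in
theorem continuous_waveWindow (hu : Continuous u) (j : ZMod N) : Continuous fun t => waveWindow N u t j :=
  continuous_pi fun m => hu.comp (by fun_prop)

/-- The Bloch generator in the time `t` of the profile. -/
def generator (ξ : ℂ) (t : ℝ) : PerSeq d N →L[ℂ] PerSeq d N :=
  stencilOp (fun j => w⁻¹ • fderiv ℝ L.field (waveWindow N u t j)) ξ

/-- The generator augmented with the fluxes. -/
def augmentedGenerator (ξ : ℂ) (t : ℝ) :
    (PerSeq d N × (Option (Fin d) → ℂ)) →L[ℂ] (PerSeq d N × (Option (Fin d) → ℂ)) :=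
  augmentedOp (fun j => w⁻¹ • fderiv ℝ L.field (waveWindow N u t j))
    (fun j => w⁻¹ • fderiv ℝ L.flux (waveWindow N u t j)) ξ

/-- The mean of the linearized densities. -/
def meanDensity (ξ : ℂ) (t : ℝ) : PerSeq d N →L[ℂ] (Option (Fin d) → ℂ) :=
  mean ∘L stencilOp (fun j => fderiv ℝ L.density (waveWindow N u t j)) ξ

/-- The Floquet operators. -/
def monodromy (ξ : ℂ) : PerSeq d N →L[ℂ] PerSeq d N := evolution (generator L N u w ξ) 1 0

/-- The integrated fluxes. -/
def meanFlux (ξ : ℂ) : PerSeq d N →L[ℂ] (Option (Fin d) → ℂ) :=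
  .snd ℂ _ _ ∘L (evolution (augmentedGenerator L N u w ξ) 1 0 ∘L .inl ℂ _ _)

variable {u} (hu : Continuous u)
include hu

theorem continuous_generator : Continuous (Function.uncurry (generator L N u w)) := by
  refine continuous_stencilOp fun j => ?_
  have h := (L.contDiff_field.continuous_fderiv (by simp)).comp (continuous_waveWindow N hu j)
  exact h.const_smul w⁻¹

theorem continuous_augmentedGenerator :
    Continuous (Function.uncurry (augmentedGenerator L N u w)) := by
  refine continuous_augmentedOp (fun j => ?_) fun j => ?_
  · have h := (L.contDiff_field.continuous_fderiv (by simp)).comp (continuous_waveWindow N hu j)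
    exact h.const_smul w⁻¹
  · have h := (L.contDiff_flux.continuous_fderiv (by simp)).comp (continuous_waveWindow N hu j)
    exact h.const_smul w⁻¹

theorem continuous_generator_left (ξ : ℂ) : Continuous (generator L N u w ξ) :=
  (continuous_generator L N w hu).uncurry_left ξ

theorem continuous_augmentedGenerator_left (ξ : ℂ) : Continuous (augmentedGenerator L N u w ξ) :=
  (continuous_augmentedGenerator L N w hu).uncurry_left ξ

/-- The augmented generator is triangular: fluxes are driven by the perturbation without acting back
on it. A single first variation formula can thus serve both the Floquet operator and the integrated
fluxes. -/
theorem fst_evolution_augmentedGenerator (ξ : ℂ) (y : PerSeq d N × (Option (Fin d) → ℂ)) {t : ℝ}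
    (ht : t ∈ Icc (0 : ℝ) 1) : (evolution (augmentedGenerator L N u w ξ) t 0 y).1
      = evolution (generator L N u w ξ) t 0 y.1 := by
  have hA := continuous_augmentedGenerator_left L N w hu ξ
  have h := eq_evolution_apply (continuous_generator_left L N w hu ξ)
    (x := fun t => (evolution (augmentedGenerator L N u w ξ) t 0 y).1)
    (fun t => (hasDerivAt_evolution_apply hA 0 t y).fst) ht
  rw [evolution_self hA] at h
  exact h

theorem differentiable_monodromy : Differentiable ℂ (monodromy L N u w) :=
  differentiable_evolution (continuous_generator L N w hu) (fun _ => differentiable_stencilOp _) 0 1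

theorem differentiable_meanFlux : Differentiable ℂ (meanFlux L N u w) := by
  have h1 := differentiable_evolution (continuous_augmentedGenerator L N w hu)
    (fun _ => differentiable_augmentedOp _ _) 0 1
  exact fun ξ => (differentiableAt_const _).clm_comp ((h1 ξ).clm_comp (differentiableAt_const _))

/-- In each cell the linearized density changes at the rate `e^{iξ} G(j+1) - G(j)`. Averaging over a
period of the lattice telescopes up to the factor `e^{iξ} - 1`, and after time 1 the periodic
coefficients of the density functional are back at their initial values. -/
theorem conservation_monodromy (hper : Function.Periodic u 1) (hw : w ≠ 0)
    (hode : ∀ ζ, HasDerivAt u (w⁻¹ • L.field (window (1 / (N : ℝ)) u ζ)) ζ) (ξ : ℂ) (v : PerSeq d N) :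
    meanDensity L N u ξ 0 (monodromy L N u w ξ v - v)
      = (Complex.exp (Complex.I * ξ) - 1) • meanFlux L N u w ξ v := by
  set f : ℝ → PerSeq d N × (Option (Fin d) → ℂ) := fun t =>
    evolution (augmentedGenerator L N u w ξ) t 0 (v, 0) with hf
  have hA := continuous_augmentedGenerator_left L N w hu ξ
  have hfd : ∀ t, HasDerivAt f (augmentedGenerator L N u w ξ t (f t)) t :=
    fun t => hasDerivAt_evolution_apply hA 0 t (v, 0)
  have hf0 : f 0 = (v, 0) := by simp [hf, evolution_self hA]
  have hf1 : (f 1).1 = monodromy L N u w ξ v :=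
    fst_evolution_augmentedGenerator L N w hu ξ (v, 0) ⟨zero_le_one, le_rfl⟩
  have hf2 : (f 1).2 = meanFlux L N u w ξ v := rfl
  let G : ℝ → ZMod N → Option (Fin d) → ℂ := fun t =>
    stencilOp (fun j => w⁻¹ • fderiv ℝ L.flux (waveWindow N u t j)) ξ (f t).1
  -- the local conservation law
  have hloc : ∀ t j, HasDerivAt
      (fun t => stencilOp (fun j => fderiv ℝ L.density (waveWindow N u t j)) ξ (f t).1 j)
      (Complex.exp (Complex.I * ξ) • G t (j + 1) - G t j) t := by
    intro t j
    obtain ⟨x, rfl⟩ : ∃ x : ℤ, (x : ZMod N) = j := ZMod.intCast_surjective j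
    set U : ℤ → Fin d → ℝ := fun l => u ((l : ℝ) / N + t) with hU
    have hWU : ∀ y : ℤ, waveWindow N u t (y : ZMod N) = window 1 U y :=
      waveWindow_intCast N hper t
    have hW : HasDerivAt (fun t => waveWindow N u t (x : ZMod N))
        (w⁻¹ • window 1 (fun y => L.field (window 1 U y)) x) t := by
      have h1 : (fun t => waveWindow N u t (x : ZMod N))
          = fun t => window 1 (fun l : ℤ => u ((l : ℝ) / N + t)) x :=
        funext fun t => waveWindow_intCast N hper t x
      rw [h1]
      refine hasDerivAt_pi.2 fun m => ?_
      have h2 := (hode (((x + (((m : ℕ) : ℤ) - 2) • 1 : ℤ) : ℝ) / N + t)).scomp t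
        ((hasDerivAt_id t).const_add (((x + (((m : ℕ) : ℤ) - 2) • 1 : ℤ) : ℝ) / N))
      rw [one_smul, ← window_intCast] at h2
      exact h2
    have h1 : HasDerivAt (fun t => fderiv ℝ L.density (waveWindow N u t (x : ZMod N)))
        (fderiv ℝ (fderiv ℝ L.density) (window 1 U x)
          (w⁻¹ • window 1 (fun y => L.field (window 1 U y)) x)) t := by
      have h2 : HasFDerivAt (fderiv ℝ L.density) (fderiv ℝ (fderiv ℝ L.density) (window 1 U x))
          (waveWindow N u t (x : ZMod N)) := by
        rw [hWU]
        exact ((L.contDiff_density.fderiv_right (m := ∞) (by simp)).differentiable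
          (by simp) _).hasFDerivAt
      exact h2.comp_hasDerivAt t hW
    have h3 : HasDerivAt (fun t => cx (fderiv ℝ L.density (waveWindow N u t (x : ZMod N))))
        (cx (fderiv ℝ (fderiv ℝ L.density) (window 1 U x)
          (w⁻¹ • window 1 (fun y => L.field (window 1 U y)) x))) t :=
      (cx (d := d) (ι := Option (Fin d))).hasFDerivAt.comp_hasDerivAt t h1
    have h4 : HasDerivAt (fun t => blochWindow ξ (x : ZMod N) (f t).1)
        (blochWindow ξ (x : ZMod N) (generator L N u w ξ t (f t).1)) t :=
      ((blochWindow ξ (x : ZMod N)).restrictScalars ℝ).hasFDerivAt.comp_hasDerivAt t (hfd t).fst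
    refine (hasDerivAt_complex_clm_apply h3 h4).congr_deriv ?_
    set g := (f t).1
    set E := Complex.exp (Complex.I * (x : ℂ) * ξ)
    have hw' : (w : ℂ)⁻¹ * w = 1 := inv_mul_cancel₀ (by exact_mod_cast hw)
    have hE1 : Complex.exp (Complex.I * ((x + 1 : ℤ) : ℂ) * ξ) = E * Complex.exp (Complex.I * ξ) := by
      rw [← Complex.exp_add]; congr 1; push_cast; ring
    -- The generator carries a factor `w⁻¹`, because its time is that of the profile; it has to be
    -- undone before the conservation law of the lattice system applies.
    have hgen : (fun y : ℤ => cx (fderiv ℝ L.field (window 1 U y)) (window 1 (modulate ξ g) y))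
        = w • modulate ξ (generator L N u w ξ t g) := by
      funext y i
      simp only [window_modulate, Pi.smul_apply, modulate, generator, stencilOp_apply, hWU, map_smul,
        smul_apply, smul_eq_mul, Complex.real_smul]
      push_cast
      linear_combination (-Complex.exp (Complex.I * (y : ℂ) * ξ) *
        cx (fderiv ℝ L.field (window 1 U y)) (blochWindow ξ (y : ZMod N) g) i) * hw'
    have h6 := L.complex_conservation U (modulate ξ g) x
    have hsm : window 1 (w • modulate ξ (generator L N u w ξ t g)) x
        = (w : ℂ) • window 1 (modulate ξ (generator L N u w ξ t g)) x := by
      funext m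
      simp [window]
    rw [hgen, hsm, window_modulate, window_modulate, window_modulate, hE1] at h6
    funext o
    have h7 := congrFun h6 o
    have hx1 : ((x : ZMod N) + 1) = ((x + 1 : ℤ) : ZMod N) := by push_cast; rfl
    simp only [Pi.add_apply, Pi.sub_apply, map_smul, Pi.smul_apply, smul_eq_mul] at h7
    simp only [G, hx1, stencilOp_apply, hWU, map_smul, smul_apply, Pi.add_apply, Pi.sub_apply,
      Pi.smul_apply, smul_eq_mul, Complex.real_smul, Complex.ofReal_inv]
    set b := cx (fderiv ℝ L.density (window 1 U x))
      (blochWindow ξ (x : ZMod N) (generator L N u w ξ t g)) o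
    have h8 : cx (fderiv ℝ (fderiv ℝ L.density) (window 1 U x)
          (window 1 (fun y => L.field (window 1 U y)) x)) (blochWindow ξ (x : ZMod N) g) o + w * b
        = Complex.exp (Complex.I * ξ) * cx (fderiv ℝ L.flux (window 1 U (x + 1)))
            (blochWindow ξ ((x + 1 : ℤ) : ZMod N) g) o
          - cx (fderiv ℝ L.flux (window 1 U x)) (blochWindow ξ (x : ZMod N) g) o := by
      refine mul_left_cancel₀ (Complex.exp_ne_zero (Complex.I * (x : ℂ) * ξ)) ?_
      linear_combination h7
    linear_combination ((w : ℂ)⁻¹) * h8 - b * hw'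
  have hsum : ∀ t, ∑ j, G t (j + 1) = ∑ j, G t j := fun t =>
    Equiv.sum_comp (Equiv.addRight (1 : ZMod N)) (G t)
  -- Mean density minus `e^{iξ} - 1` times the accumulated flux is a constant of motion.
  have hΨ : ∀ t, HasDerivAt (fun t => meanDensity L N u ξ t (f t).1
      - (Complex.exp (Complex.I * ξ) - 1) • (f t).2) 0 t := by
    intro t
    have h1 : HasDerivAt (fun t => mean (stencilOp (fun j => fderiv ℝ L.density (waveWindow N u t j))
        ξ (f t).1)) (mean fun j => Complex.exp (Complex.I * ξ) • G t (j + 1) - G t j) t :=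
      ((mean (N := N) (ι := Option (Fin d))).restrictScalars ℝ).hasFDerivAt.comp_hasDerivAt t
        (hasDerivAt_pi.2 fun j => hloc t j)
    have h2 : HasDerivAt (fun t => (f t).2) (mean (G t)) t := (hfd t).snd
    refine (h1.fun_sub (h2.fun_const_smul (Complex.exp (Complex.I * ξ) - 1))).congr_deriv ?_
    rw [mean_apply, mean_apply, Finset.sum_sub_distrib, ← Finset.smul_sum, hsum]
    module
  have hconst := is_const_of_deriv_eq_zero (fun t => (hΨ t).differentiableAt)
    (fun t => (hΨ t).deriv) 1 0
  have hper1 : meanDensity L N u ξ 1 = meanDensity L N u ξ 0 := by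
    have : ∀ j, waveWindow N u 1 j = waveWindow N u 0 j := fun j => by
      have := waveWindow_add_one N hper 0 j
      rwa [zero_add] at this
    simp only [meanDensity, this]
  rw [hf0, hf1, hf2, hper1, smul_zero, sub_zero] at hconst
  rw [map_sub, ← hconst]
  abel

end Wave

/-! ### Comparison with the Bloch evolution -/

section Comparison

variable {d : ℕ} (L : System d) (N : ℕ) [NeZero N] {u : ℝ → Fin d → ℝ} (w : ℝ)

theorem linField_modulate (hper : Function.Periodic u 1) (t : ℝ) (ξ : ℂ) (f : PerSeq d N) (x : ℤ) :
    L.linField (fun l : ℤ => u ((l : ℝ) / N + t)) (modulate ξ f) x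
      = Complex.exp (Complex.I * (x : ℂ) * ξ) •
        stencilOp (fun j => fderiv ℝ L.field (waveWindow N u t j)) ξ f (x : ZMod N) := by
  rw [L.linField_eq, window_modulate, map_smul, stencilOp_apply, waveWindow_intCast N hper]

theorem blochSymbol_linField (hper : Function.Periodic u 1) (t ξ : ℝ) :
    blochSymbol N (L.linField fun l : ℤ => u ((l : ℝ) / N + t)) ξ
      = stencilOp (fun j => fderiv ℝ L.field (waveWindow N u t j)) (ξ : ℂ) := by
  refine ContinuousLinearMap.ext fun f => funext fun j => ?_
  have h := linField_modulate L N hper t (ξ : ℂ) f (j.val : ℤ)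
  change Complex.exp (-(Complex.I * (j.val : ℂ) * ξ)) •
    L.linField (fun l : ℤ => u ((l : ℝ) / N + t)) (modulate (ξ : ℂ) f) (j.val : ℤ) = _
  rw [h, smul_smul, ← Complex.exp_add]
  simp

/-- The time change `t ↦ t / w` turns one evolution system into the other, by uniqueness; it sends
the period `1 / w` of the wave to 1. -/
theorem evolution_blochSymbol (hu : Continuous u) (hper : Function.Periodic u 1) (hw : w ≠ 0)
    (ξ : ℝ) : evolution (fun r => blochSymbol N (L.linField (wave (1 / (N : ℝ)) w u r)) ξ) (1 / w) 0
      = monodromy L N u w ξ := by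
  set B : ℝ → PerSeq d N →L[ℂ] PerSeq d N := fun r =>
    blochSymbol N (L.linField (wave (1 / (N : ℝ)) w u r)) ξ with hB
  have hBg : ∀ t, generator L N u w ξ t = w⁻¹ • B (t / w) := by
    intro t
    have h1 : wave (1 / (N : ℝ)) w u (t / w) = fun l : ℤ => u ((l : ℝ) / N + t) := by
      funext l
      simp only [wave]
      congr 1
      field_simp
    rw [hB]
    dsimp only
    rw [h1, blochSymbol_linField L N hper]
    refine ContinuousLinearMap.ext fun f => funext fun j => ?_
    simp only [generator, stencilOp_apply, map_smul, smul_apply, Pi.smul_apply]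
  have hgc := continuous_generator_left L N w hu (ξ : ℂ)
  have hBc : Continuous B := by
    have h1 : B = fun r => w • generator L N u w ξ (w * r) := by
      funext r
      rw [hBg, smul_smul, mul_inv_cancel₀ hw, one_smul, mul_div_cancel_left₀ _ hw]
    rw [h1]
    have h2 : Continuous fun r => generator L N u w ξ (w * r) := hgc.comp (continuous_const_mul w)
    exact h2.const_smul w
  have h1 : IsEvolutionSystem (generator L N u w ξ) fun t s => evolution B (t / w) (s / w) := by
    intro s
    obtain ⟨h2, h3⟩ := isEvolutionSystem_evolution hBc (s / w)
    refine ⟨h2, fun t => ?_⟩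
    have h4 := (h3 (t / w)).scomp t ((hasDerivAt_id t).div_const w)
    refine h4.congr_deriv ?_
    rw [hBg, one_div]
    rfl
  have h2 := IsEvolutionSystem.unique hgc h1 (isEvolutionSystem_evolution hgc)
  have h3 := congrFun (congrFun h2 1) 0
  rw [zero_div] at h3
  exact h3

end Comparison

/-! ### Hamiltonian symmetry of the spectrum -/

section Skew

variable {E : Type*} [NormedAddCommGroup E] [NormedSpace ℂ E] [FiniteDimensional ℂ E]
  {κ : Type*} [Fintype κ] [DecidableEq κ] (b : Module.Basis κ ℂ E)

/-- Transposition of operators in a basis. -/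
def transposeOp : (E →L[ℂ] E) →ₗ[ℂ] (E →L[ℂ] E) where
  toFun A := LinearMap.toContinuousLinearMap
    (Matrix.toLin b b (LinearMap.toMatrix b b (A : E →ₗ[ℂ] E))ᵀ)
  map_add' A A' := by
    rw [← map_add, ← map_add, ← Matrix.transpose_add, ← map_add]; rfl
  map_smul' c A := by
    rw [RingHom.id_apply, ← map_smul, ← map_smul, ← Matrix.transpose_smul, ← map_smul]; rfl

theorem toMatrix_transposeOp (A : E →L[ℂ] E) :
    LinearMap.toMatrix b b (transposeOp b A : E →ₗ[ℂ] E)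
      = (LinearMap.toMatrix b b (A : E →ₗ[ℂ] E))ᵀ :=
  LinearMap.toMatrix_toLin b b _

theorem eq_transposeOp {A A' : E →L[ℂ] E} (h : LinearMap.toMatrix b b (A' : E →ₗ[ℂ] E)
    = (LinearMap.toMatrix b b (A : E →ₗ[ℂ] E))ᵀ) : transposeOp b A = A' := by
  have h1 := (LinearMap.toMatrix b b).injective ((toMatrix_transposeOp b A).trans h.symm)
  exact ContinuousLinearMap.coe_injective h1

theorem transposeOp_mul (A A' : E →L[ℂ] E) :
    transposeOp b (A * A') = transposeOp b A' * transposeOp b A := by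
  refine eq_transposeOp b ?_
  have h1 : ((A * A' : E →L[ℂ] E) : E →ₗ[ℂ] E) = (A : E →ₗ[ℂ] E) ∘ₗ (A' : E →ₗ[ℂ] E) := rfl
  have h2 : ((transposeOp b A' * transposeOp b A : E →L[ℂ] E) : E →ₗ[ℂ] E)
    = (transposeOp b A' : E →ₗ[ℂ] E) ∘ₗ (transposeOp b A : E →ₗ[ℂ] E) := rfl
  rw [h1, h2, LinearMap.toMatrix_comp b b b, LinearMap.toMatrix_comp b b b, toMatrix_transposeOp,
    toMatrix_transposeOp, Matrix.transpose_mul]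

theorem transposeOp_one : transposeOp b 1 = 1 := by
  refine eq_transposeOp b ?_
  have h1 : ((1 : E →L[ℂ] E) : E →ₗ[ℂ] E) = LinearMap.id := rfl
  rw [h1, LinearMap.toMatrix_id, Matrix.transpose_one]

theorem transposeOp_transposeOp (A : E →L[ℂ] E) : transposeOp b (transposeOp b A) = A := by
  refine eq_transposeOp b ?_
  rw [toMatrix_transposeOp, Matrix.transpose_transpose]

theorem charpoly_transposeOp (A : E →L[ℂ] E) :
    (transposeOp b A : E →ₗ[ℂ] E).charpoly = (A : E →ₗ[ℂ] E).charpoly := by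
  rw [← LinearMap.charpoly_toMatrix _ b, toMatrix_transposeOp, Matrix.charpoly_transpose,
    LinearMap.charpoly_toMatrix]

theorem charpoly_one_add_mul_comm (A A' : E →L[ℂ] E) :
    ((1 + A * A' : E →L[ℂ] E) : E →ₗ[ℂ] E).charpoly
      = ((1 + A' * A : E →L[ℂ] E) : E →ₗ[ℂ] E).charpoly := by
  let b := Module.finBasis ℂ E
  have h1 : ∀ A A' : E →L[ℂ] E, ((1 + A * A' : E →L[ℂ] E) : E →ₗ[ℂ] E)
      = ((A : Module.End ℂ E) * (A' : Module.End ℂ E)) - (-1 : ℂ) • (1 : Module.End ℂ E) := by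
    intro A A'
    refine LinearMap.ext fun v => ?_
    simp [add_comm]
  rw [h1, h1, LinearMap.charpoly_sub_smul, LinearMap.charpoly_sub_smul]
  congr 1
  rw [← LinearMap.charpoly_toMatrix _ b, ← LinearMap.charpoly_toMatrix ((A' : Module.End ℂ E) * _) b,
    LinearMap.toMatrix_mul, LinearMap.toMatrix_mul, Matrix.charpoly_mul_comm]

/-- Evolutions generated by `J L` and `J' L'`, with `J'` and `L'` the opposite transpose of `J` and
the transpose of `L`. -/
theorem exists_left_inverse_of_skew {J J' : E →L[ℂ] E} {Λ Λ' : ℝ → E →L[ℂ] E} (hΛ : Continuous Λ)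
    (hΛ' : Continuous Λ') (hJ : transposeOp b J' = -J) (hL : ∀ t, transposeOp b (Λ' t) = Λ t) :
    ∃ R : Module.End ℂ E,
      R * ((evolution (fun t => J' * Λ' t) 1 0 : E →L[ℂ] E) : Module.End ℂ E) = 1 ∧
      LinearMap.charpoly ((evolution (fun t => J * Λ t) 1 0 : E →L[ℂ] E) : Module.End ℂ E) = R.charpoly := by
  have : CompleteSpace E := FiniteDimensional.complete ℂ E
  obtain ⟨hS0, hS⟩ := isEvolutionSystem_evolution
    (show Continuous fun t => J * Λ t from continuous_const.mul hΛ) 0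
  obtain ⟨hS0', hS'⟩ := isEvolutionSystem_evolution
    (show Continuous fun t => J' * Λ' t from continuous_const.mul hΛ') 0
  set S : ℝ → E →L[ℂ] E := fun t => evolution (fun t => J * Λ t) t 0
  set S' : ℝ → E →L[ℂ] E := fun t => evolution (fun t => J' * Λ' t) t 0
  have hSc : Continuous S := continuous_iff_continuousAt.2 fun t => (hS t).continuousAt
  -- `J` may be singular, so `J⁻¹ S J` is not available. Its substitute is `T = 1 + Y J`, where `S =
  -- 1 + J Y`. It satisfies `S J = J T`, has the characteristic polynomial of `S`, and solves the
  -- equation that makes the transpose of `S'` times `T` constant.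
  let Y : ℝ → E →L[ℂ] E := fun t => ∫ r in (0 : ℝ)..t, Λ r * S r
  have hY : ∀ t, HasDerivAt Y (Λ t * S t) t := fun t =>
    ((hΛ.mul hSc).integral_hasStrictDerivAt 0 t).hasDerivAt
  have hY0 : Y 0 = 0 := intervalIntegral.integral_same
  have hSY : ∀ t, S t = 1 + J * Y t := by
    intro t
    have h1 : ∀ t, HasDerivAt (fun t => S t - J * Y t) 0 t := fun t => by
      refine ((hS t).fun_sub ((hY t).const_mul J)).congr_deriv ?_
      rw [mul_assoc, sub_self]
    have h2 := is_const_of_deriv_eq_zero (fun t => (h1 t).differentiableAt)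
      (fun t => (h1 t).deriv) t 0
    have h3 : S 0 = 1 := hS0
    rw [hY0, mul_zero, sub_zero, h3, sub_eq_iff_eq_add] at h2
    exact h2
  let T : ℝ → E →L[ℂ] E := fun t => 1 + Y t * J
  have hST : ∀ t, S t * J = J * T t := fun t => by
    simp only [T, hSY]
    noncomm_ring
  have hT : ∀ t, HasDerivAt T (Λ t * (J * T t)) t := fun t => by
    refine (((hY t).mul_const J).const_add 1).congr_deriv ?_
    rw [mul_assoc, hST]
  let tr := (LinearMap.toContinuousLinearMap (transposeOp b)).restrictScalars ℝ
  have htr : ∀ A, tr A = transposeOp b A := fun A => rfl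
  have hST' : ∀ t, HasDerivAt (fun t => tr (S' t) * T t) 0 t := by
    intro t
    have h1 : HasDerivAt (fun t => tr (S' t)) (tr (J' * Λ' t * S' t)) t :=
      tr.hasFDerivAt.comp_hasDerivAt t (hS' t)
    refine (h1.mul (hT t)).congr_deriv ?_
    rw [htr, htr, transposeOp_mul, transposeOp_mul, hJ, hL]
    noncomm_ring
  have h2 := is_const_of_deriv_eq_zero (fun t => (hST' t).differentiableAt)
    (fun t => (hST' t).deriv) 1 0
  have h3 : S' 0 = 1 := hS0'
  have h4 : T 0 = 1 := by simp [T, hY0]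
  rw [h3, h4, mul_one, htr, htr, transposeOp_one] at h2
  have h5 := congrArg (transposeOp b) h2
  rw [transposeOp_mul, transposeOp_transposeOp, transposeOp_one] at h5
  refine ⟨(transposeOp b (T 1) : E →ₗ[ℂ] E), congrArg (fun A : E →L[ℂ] E => (A : E →ₗ[ℂ] E)) h5, ?_⟩
  rw [charpoly_transposeOp]
  have h6 : (S 1 : E →ₗ[ℂ] E).charpoly = (T 1 : E →ₗ[ℂ] E).charpoly := by
    rw [hSY 1]
    exact charpoly_one_add_mul_comm J (Y 1)
  exact h6

end Skew

/-! ### Factorization of the Bloch generator -/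

section Factorization

variable {d N : ℕ} [NeZero N]

/-- The Bloch symbol of the shift by `n`. -/
def shiftOp (n : ℤ) (ξ : ℂ) : PerSeq d N →L[ℂ] PerSeq d N :=
  ContinuousLinearMap.pi fun j => Complex.exp (Complex.I * (n : ℂ) * ξ) •
    (ContinuousLinearMap.proj (j + (n : ZMod N)) : (ZMod N → Fin d → ℂ) →L[ℂ] (Fin d → ℂ))

theorem shiftOp_apply (n : ℤ) (ξ : ℂ) (f : PerSeq d N) (j : ZMod N) :
    shiftOp n ξ f j = Complex.exp (Complex.I * (n : ℂ) * ξ) • f (j + (n : ZMod N)) := rfl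

/-- Multiplication by a sequence of matrices. -/
def mulOp (A : ZMod N → Matrix (Fin d) (Fin d) ℂ) : PerSeq d N →L[ℂ] PerSeq d N :=
  ContinuousLinearMap.pi fun j => LinearMap.toContinuousLinearMap (Matrix.mulVecLin (A j)) ∘L
    (ContinuousLinearMap.proj j : (ZMod N → Fin d → ℂ) →L[ℂ] (Fin d → ℂ))

theorem mulOp_apply (A : ZMod N → Matrix (Fin d) (Fin d) ℂ) (f : PerSeq d N) (j : ZMod N) :
    mulOp A f j = A j *ᵥ f j := rfl

/-- The standard basis of periodic sequences. -/
def perBasis : Module.Basis (Σ _ : ZMod N, Fin d) ℂ (PerSeq d N) :=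
  Pi.basis fun _ => Pi.basisFun ℂ (Fin d)

/-- The standard basis is orthonormal for the bilinear pairing, taken without conjugation.
Transposition therefore sends the symbol at `ξ` to one at `-ξ`, for complex `ξ` as well. -/
theorem transposeOp_eq_of_pairing {A A' : PerSeq d N →L[ℂ] PerSeq d N}
    (h : ∀ f g : PerSeq d N, ∑ j, A f j ⬝ᵥ g j = ∑ j, f j ⬝ᵥ A' g j) :
    transposeOp perBasis A = A' := by
  refine eq_transposeOp _ ?_
  ext ⟨j, i⟩ ⟨j', i'⟩
  have h1 : ∀ (f : PerSeq d N) (j : ZMod N) (i : Fin d),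
      ∑ l, f l ⬝ᵥ (perBasis ⟨j, i⟩ : PerSeq d N) l = f j i := by
    intro f j i
    rw [Finset.sum_eq_single j]
    · simp [perBasis, Pi.basis_apply]
    · intro l _ hl
      simp [perBasis, Pi.basis_apply, hl]
    · simp
  have h2 : ∀ (B : PerSeq d N →L[ℂ] PerSeq d N) (p q : Σ _ : ZMod N, Fin d),
      LinearMap.toMatrix perBasis perBasis (B : PerSeq d N →ₗ[ℂ] PerSeq d N) p q
        = B (perBasis q) p.1 p.2 := by
    intro B p q
    rw [LinearMap.toMatrix_apply]
    simp [perBasis, Pi.basis_repr]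
  rw [Matrix.transpose_apply, h2, h2]
  have h3 := h (perBasis ⟨j, i⟩) (perBasis ⟨j', i'⟩)
  rw [h1] at h3
  dsimp only
  rw [h3, ← h1 (A' (perBasis ⟨j', i'⟩)) j i]
  exact Finset.sum_congr rfl fun l _ => dotProduct_comm _ _

theorem transposeOp_shiftOp (n : ℤ) (ξ : ℂ) :
    transposeOp perBasis (shiftOp n ξ : PerSeq d N →L[ℂ] PerSeq d N) = shiftOp (-n) (-ξ) := by
  refine transposeOp_eq_of_pairing fun f g => ?_
  rw [← Equiv.sum_comp (Equiv.subRight (n : ZMod N))]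
  refine Finset.sum_congr rfl fun j _ => ?_
  simp only [Equiv.subRight_apply, shiftOp_apply, sub_add_cancel, smul_dotProduct, dotProduct_smul]
  rw [sub_eq_add_neg]
  push_cast
  congr 2
  ring

theorem transposeOp_mulOp (A : ZMod N → Matrix (Fin d) (Fin d) ℂ) :
    transposeOp perBasis (mulOp A) = mulOp fun j => (A j)ᵀ := by
  refine transposeOp_eq_of_pairing fun f g => Finset.sum_congr rfl fun j _ => ?_
  rw [mulOp_apply, mulOp_apply, Matrix.dotProduct_mulVec, Matrix.vecMul_transpose]

theorem modulate_shiftOp (n : ℤ) (ξ : ℂ) (f : PerSeq d N) (x : ℤ) :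
    modulate ξ (shiftOp n ξ f) x = modulate ξ f (x + n) := by
  simp only [modulate, shiftOp_apply, smul_smul, ← Complex.exp_add]
  push_cast
  congr 2
  ring

theorem modulate_mulOp (A : ZMod N → Matrix (Fin d) (Fin d) ℂ) (ξ : ℂ) (f : PerSeq d N) (x : ℤ) :
    modulate ξ (mulOp A f) x = A (x : ZMod N) *ᵥ modulate ξ f x := by
  simp only [modulate, mulOp_apply, Matrix.mulVec_smul]

theorem continuous_mulOp {A : ℝ → ZMod N → Matrix (Fin d) (Fin d) ℂ}
    (hA : ∀ j, Continuous fun t => A t j) : Continuous fun t => mulOp (A t) := by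
  rw [continuous_clm_apply]
  intro f
  exact continuous_pi fun j => (hA j).matrix_mulVec continuous_const

variable (L : System d) (N) (u : ℝ → Fin d → ℝ)

/-- The forward difference. -/
def fwdOp (ξ : ℂ) : PerSeq d N →L[ℂ] PerSeq d N := (L.η : ℂ) • (shiftOp 1 ξ - 1)

/-- The adjoint of the forward difference. -/
def bwdOp (ξ : ℂ) : PerSeq d N →L[ℂ] PerSeq d N := (L.η : ℂ) • (shiftOp (-1) ξ - 1)

/-- The skew-symmetric factor of the generator. -/
def skewOp (ξ : ℂ) : PerSeq d N →L[ℂ] PerSeq d N :=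
  ((L.η / 2 : ℝ) : ℂ) • ((shiftOp 1 ξ - shiftOp (-1) ξ) * mulOp fun _ => L.B.map ((↑) : ℝ → ℂ))

/-- The point at which the second derivatives of `H` are taken. -/
def waveJet (t : ℝ) (j : ZMod N) : (Fin d → ℝ) × (Fin d → ℝ) :=
  (waveWindow N u t j 2, L.η • (waveWindow N u t j 3 - waveWindow N u t j 2))

/-- The symmetric factor of the generator. -/
def hessianOp (ξ : ℂ) (t : ℝ) : PerSeq d N →L[ℂ] PerSeq d N :=
  mulOp (fun j => System.jacU L.gradU (waveJet N L u t j)) +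
    mulOp (fun j => System.jacW L.gradU (waveJet N L u t j)) * fwdOp N L ξ +
    bwdOp N L ξ * (mulOp (fun j => System.jacU L.gradW (waveJet N L u t j)) +
      mulOp (fun j => System.jacW L.gradW (waveJet N L u t j)) * fwdOp N L ξ)

theorem transposeOp_fwdOp (ξ : ℂ) :
    transposeOp perBasis (fwdOp N L ξ) = bwdOp N L (-ξ) := by
  rw [fwdOp, map_smul, map_sub, transposeOp_shiftOp, transposeOp_one, bwdOp]

theorem transposeOp_bwdOp (ξ : ℂ) :
    transposeOp perBasis (bwdOp N L ξ) = fwdOp N L (-ξ) := by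
  rw [bwdOp, map_smul, map_sub, transposeOp_shiftOp, transposeOp_one, fwdOp, neg_neg]

theorem shiftOp_mul_mulOp_const (n : ℤ) (ξ : ℂ) (A : Matrix (Fin d) (Fin d) ℂ) :
    (mulOp (fun _ => A) : PerSeq d N →L[ℂ] PerSeq d N) * shiftOp n ξ
      = shiftOp n ξ * mulOp fun _ => A := by
  refine ContinuousLinearMap.ext fun f => funext fun j => ?_
  exact Matrix.mulVec_smul A (Complex.exp (Complex.I * (n : ℂ) * ξ)) (f (j + (n : ZMod N)))

/-- The two shifts are exchanged at `-ξ`, which produces the sign; the symmetric constant matrix `B`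
commutes with them. -/
theorem transposeOp_skewOp (ξ : ℂ) :
    transposeOp perBasis (skewOp N L ξ) = -skewOp N L (-ξ) := by
  have hB : (L.B.map ((↑) : ℝ → ℂ))ᵀ = L.B.map ((↑) : ℝ → ℂ) := by
    ext i l
    exact congrArg ((↑) : ℝ → ℂ) (L.symm.apply i l)
  rw [skewOp, map_smul, transposeOp_mul, map_sub, transposeOp_shiftOp, transposeOp_shiftOp,
    transposeOp_mulOp, neg_neg, mul_sub, shiftOp_mul_mulOp_const, shiftOp_mul_mulOp_const, hB, skewOp]
  simp only [sub_mul, smul_sub, neg_sub]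

/-- The blocks of the Hessian of `H`, whose second derivative is symmetric. -/
theorem jacU_gradU_transpose (p : (Fin d → ℝ) × (Fin d → ℝ)) :
    (System.jacU L.gradU p)ᵀ = System.jacU L.gradU p ∧
    (System.jacW L.gradU p)ᵀ = System.jacU L.gradW p ∧
    (System.jacW L.gradW p)ᵀ = System.jacW L.gradW p := by
  have hs := (L.smooth.contDiffAt (x := p)).isSymmSndFDerivAt
    (by rw [minSmoothness_of_isRCLikeNormedField]; exact WithTop.coe_le_coe.2 (le_top : (2 : ℕ∞) ≤ ⊤))
  have hd : DifferentiableAt ℝ (fderiv ℝ L.H) p :=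
    (L.smooth.fderiv_right (m := ∞) (by simp)).differentiable (by simp) p
  have h1 : ∀ (e : Fin d → (Fin d → ℝ) × (Fin d → ℝ)) (v : (Fin d → ℝ) × (Fin d → ℝ)) (i : Fin d),
      fderiv ℝ (fun p i => fderiv ℝ L.H p (e i)) p v i = fderiv ℝ (fderiv ℝ L.H) p v (e i) := by
    intro e v i
    have h2 : HasFDerivAt (fun p i => fderiv ℝ L.H p (e i)) (ContinuousLinearMap.pi fun i =>
        (ContinuousLinearMap.apply ℝ ℝ (e i)) ∘L fderiv ℝ (fderiv ℝ L.H) p) p :=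
      hasFDerivAt_pi.2 fun i =>
        (ContinuousLinearMap.apply ℝ ℝ (e i)).hasFDerivAt.comp p hd.hasFDerivAt
    rw [h2.fderiv]
    rfl
  have h3 : ∀ (e e' : Fin d → (Fin d → ℝ) × (Fin d → ℝ)) (i l : Fin d),
      ((fderiv ℝ (fun p i => fderiv ℝ L.H p (e i)) p (e' i) l : ℝ) : ℂ)
        = ((fderiv ℝ (fun p i => fderiv ℝ L.H p (e' i)) p (e l) i : ℝ) : ℂ) := fun e e' i l => by
    rw [h1, h1, hs.eq]
  refine ⟨?_, ?_, ?_⟩ <;> ext i l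
  · exact h3 (fun i => (Pi.single i 1, 0)) (fun i => (Pi.single i 1, 0)) i l
  · exact h3 (fun i => (Pi.single i 1, 0)) (fun i => (0, Pi.single i 1)) i l
  · exact h3 (fun i => (0, Pi.single i 1)) (fun i => (0, Pi.single i 1)) i l

theorem transposeOp_hessianOp (ξ : ℂ) (t : ℝ) :
    transposeOp perBasis (hessianOp N L u ξ t) = hessianOp N L u (-ξ) t := by
  have h1 := fun j => (jacU_gradU_transpose L (waveJet N L u t j)).1
  have h2 := fun j => (jacU_gradU_transpose L (waveJet N L u t j)).2.1
  have h3 := fun j => (jacU_gradU_transpose L (waveJet N L u t j)).2.2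
  have h2' : ∀ j, (System.jacU L.gradW (waveJet N L u t j))ᵀ
      = System.jacW L.gradU (waveJet N L u t j) := fun j => by
    rw [← h2, Matrix.transpose_transpose]
  rw [hessianOp, map_add, map_add, transposeOp_mul, transposeOp_mul, map_add, transposeOp_mul,
    transposeOp_mulOp, transposeOp_mulOp, transposeOp_mulOp, transposeOp_mulOp, transposeOp_fwdOp,
    transposeOp_bwdOp, hessianOp]
  simp only [h1, h2, h3, h2']
  noncomm_ring

variable {u}

theorem continuous_hessianOp (hu : Continuous u) (ξ : ℂ) : Continuous (hessianOp N L u ξ) := by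
  have hp : ∀ j, Continuous fun t => waveJet N L u t j := fun j => by
    have h := continuous_pi_iff.1 (continuous_waveWindow N hu j)
    exact (h 2).prodMk (((h 3).sub (h 2)).const_smul L.η)
  have hU : ∀ {Φ : (Fin d → ℝ) × (Fin d → ℝ) → Fin d → ℝ} (_ : ContDiff ℝ ∞ Φ) (j : ZMod N)
      (e : Fin d → (Fin d → ℝ) × (Fin d → ℝ)),
      Continuous fun t => (Matrix.of fun i l => ((fderiv ℝ Φ (waveJet N L u t j) (e l) i : ℝ) : ℂ) :
        Matrix (Fin d) (Fin d) ℂ) := by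
    intro Φ hΦ j e
    refine continuous_matrix fun i l => ?_
    have h1 := (hΦ.continuous_fderiv (by simp)).comp (hp j)
    have h2 : Continuous fun t => fderiv ℝ Φ (waveJet N L u t j) (e l) :=
      h1.clm_apply continuous_const
    exact Complex.continuous_ofReal.comp ((continuous_apply i).comp h2)
  have a1 := continuous_mulOp (N := N) fun j => hU L.contDiff_gradU j fun l => (Pi.single l 1, 0)
  have a2 := continuous_mulOp (N := N) fun j => hU L.contDiff_gradU j fun l => (0, Pi.single l 1)
  have a3 := continuous_mulOp (N := N) fun j => hU L.contDiff_gradW j fun l => (Pi.single l 1, 0)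
  have a4 := continuous_mulOp (N := N) fun j => hU L.contDiff_gradW j fun l => (0, Pi.single l 1)
  exact (a1.add (a2.mul continuous_const)).add (continuous_const.mul (a3.add (a4.mul continuous_const)))

/-- On modulated sequences the Bloch symbols act as the difference operators themselves, so the
factorization `J` times Hessian of the linearized lattice system passes to symbols. -/
theorem generator_eq_skewOp_mul (hper : Function.Periodic u 1) (w : ℝ) (ξ : ℂ) (t : ℝ) :
    generator L N u w ξ t = skewOp N L ξ * (((w⁻¹ : ℝ) : ℂ) • hessianOp N L u ξ t) := by
  set U : ℤ → Fin d → ℝ := fun l => u ((l : ℝ) / N + t) with hU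
  have hjet : ∀ x : ℤ, L.jet 1 U x = waveJet N L u t (x : ZMod N) := fun x => by
    rw [waveJet, waveWindow_intCast N hper, window_two, window_three]; rfl
  have hfwd : ∀ f x, modulate ξ (fwdOp N L ξ f) x = fwd L.η 1 (modulate ξ f) x := fun f x => by
    have h1 := modulate_shiftOp 1 ξ f x
    have h2 : modulate ξ (fwdOp N L ξ f) x
        = (L.η : ℂ) • (modulate ξ (shiftOp 1 ξ f) x - modulate ξ f x) := by
      simp only [modulate, fwdOp, smul_apply, sub_apply, one_apply_eq_self, Pi.smul_apply, Pi.sub_apply]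
      module
    rw [h2, h1, fwd, Complex.coe_smul]
  have hbwd : ∀ f x, modulate ξ (bwdOp N L ξ f) x = fwdAdj L.η 1 (modulate ξ f) x := fun f x => by
    have h1 := modulate_shiftOp (-1) ξ f x
    have h2 : modulate ξ (bwdOp N L ξ f) x
        = (L.η : ℂ) • (modulate ξ (shiftOp (-1) ξ f) x - modulate ξ f x) := by
      simp only [modulate, bwdOp, smul_apply, sub_apply, one_apply_eq_self, Pi.smul_apply, Pi.sub_apply]
      module
    rw [h2, h1, fwdAdj, Complex.coe_smul]
    rfl
  have hadd : ∀ (f g : PerSeq d N) x, modulate ξ (f + g) x = modulate ξ f x + modulate ξ g x :=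
    fun f g x => by simp [modulate]
  have hE : ∀ f, L.linEuler U (modulate ξ f) = modulate ξ (hessianOp N L u ξ t f) := fun f => by
    funext x
    have hjac : ∀ (Φ : (Fin d → ℝ) × (Fin d → ℝ) → Fin d → ℝ) (y : ℤ),
        L.linJet Φ U (modulate ξ f) y
          = modulate ξ ((mulOp (fun j => System.jacU Φ (waveJet N L u t j)) +
      mulOp (fun j => System.jacW Φ (waveJet N L u t j)) * fwdOp N L ξ) f) y := fun Φ y => by
      rw [add_apply, hadd, modulate_mulOp, mul_apply_eq_comp, modulate_mulOp, hfwd,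
        System.linJet, hjet]
    rw [hessianOp, add_apply, hadd, ← hjac, mul_apply_eq_comp, hbwd, System.linEuler,
      funext (hjac L.gradW)]
  refine ContinuousLinearMap.ext fun f => funext fun j => ?_
  obtain ⟨x, rfl⟩ : ∃ x : ℤ, (x : ZMod N) = j := ZMod.intCast_surjective j
  have h1 := linField_modulate L N hper t ξ f x
  have h2 : L.linField U (modulate ξ f) x = modulate ξ (skewOp N L ξ (hessianOp N L u ξ t f)) x := by
    change ctr L.η 1 (fun j => L.B.map ((↑) : ℝ → ℂ) *ᵥ L.linEuler U (modulate ξ f) j) x = _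
    set g := hessianOp N L u ξ t f with hg
    set Bg : PerSeq d N := mulOp (fun _ => L.B.map ((↑) : ℝ → ℂ)) g with hBg
    have h3 := modulate_shiftOp 1 ξ Bg x
    have h4 := modulate_shiftOp (-1) ξ Bg x
    have h5 : modulate ξ (skewOp N L ξ g) x = ((L.η / 2 : ℝ) : ℂ) •
        (modulate ξ (shiftOp 1 ξ Bg) x - modulate ξ (shiftOp (-1) ξ Bg) x) := by
      simp only [modulate, skewOp, smul_apply, sub_apply, mul_apply_eq_comp, Pi.smul_apply,
        Pi.sub_apply, ← hBg]
      module
    rw [h5, h3, h4, hBg, modulate_mulOp, modulate_mulOp, Complex.coe_smul, ctr, hE]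
    rfl
  rw [h2] at h1
  have h6 := smul_right_injective (Fin d → ℂ) (Complex.exp_ne_zero (Complex.I * (x : ℂ) * ξ)) h1
  simp only [generator, stencilOp_apply, map_smul, smul_apply, Pi.smul_apply,
    mul_apply_eq_comp] at h6 ⊢
  rw [h6, Complex.coe_smul]

/-- The Hamiltonian symmetry of the spectrum: a left inverse of the Floquet operator at `-ξ` has the
eigenvalues of the one at `ξ`, with multiplicities. -/
theorem exists_left_inverse_monodromy (hu : Continuous u) (hper : Function.Periodic u 1) (w ξ : ℝ) :
    ∃ R : Module.End ℂ (PerSeq d N),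
      R * (monodromy L N u w ((-ξ : ℝ) : ℂ) : Module.End ℂ (PerSeq d N)) = 1 ∧
      (monodromy L N u w ξ : Module.End ℂ (PerSeq d N)).charpoly = R.charpoly := by
  have hgen : ∀ ξ, monodromy L N u w ξ = evolution (fun t =>
      skewOp N L ξ * (((w⁻¹ : ℝ) : ℂ) • hessianOp N L u ξ t)) 1 0 := fun ξ => by
    rw [monodromy, funext (generator_eq_skewOp_mul N L hper w ξ)]
  rw [hgen, hgen]
  have hc : ∀ ξ : ℂ, Continuous fun t => ((w⁻¹ : ℝ) : ℂ) • hessianOp N L u ξ t := fun ξ =>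
    (continuous_hessianOp N L hu ξ).const_smul ((w⁻¹ : ℝ) : ℂ)
  refine exists_left_inverse_of_skew perBasis (hc _) (hc _) ?_ fun t => ?_
  · rw [transposeOp_skewOp]
    push_cast
    rw [neg_neg]
  · rw [map_smul, transposeOp_hessianOp]
    push_cast
    rw [neg_neg]

end Factorization

/-! ### Smooth families of periodic functions -/

section SmoothPeriodic

variable {P X Y : Type*} [NormedAddCommGroup P] [NormedSpace ℝ P] [NormedAddCommGroup X]
  [NormedSpace ℝ X] [NormedAddCommGroup Y] [NormedSpace ℝ Y]

/-- A family of one-periodic functions, smooth for parameters in `V`. -/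
structure SmoothPeriodic (V : Set P) (F : P × ℝ → X) : Prop where
  contDiffAt : ∀ p ∈ V, ∀ ζ, ContDiffAt ℝ ∞ F (p, ζ)
  periodic : ∀ p ∈ V, Function.Periodic (fun ζ => F (p, ζ)) 1

namespace SmoothPeriodic

variable {V : Set P} {F : P × ℝ → X} {p : P}

theorem comp {Φ : X → Y} (hΦ : ContDiff ℝ ∞ Φ) (hF : SmoothPeriodic V F) :
    SmoothPeriodic V fun q => Φ (F q) where
  contDiffAt p hp ζ := hΦ.contDiffAt.comp (p, ζ) (hF.contDiffAt p hp ζ)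
  periodic p hp ζ := congrArg Φ (hF.periodic p hp ζ)

theorem shift (hF : SmoothPeriodic V F) {a : P → ℝ} (ha : ContDiff ℝ ∞ a) :
    SmoothPeriodic V fun q => F (q.1, q.2 + a q.1) where
  contDiffAt p hp ζ := by
    have h1 : ContDiff ℝ ∞ fun q : P × ℝ => (q.1, q.2 + a q.1) := by fun_prop
    exact (hF.contDiffAt p hp (ζ + a p)).comp (p, ζ) h1.contDiffAt
  periodic p hp ζ := by
    have h1 := hF.periodic p hp (ζ + a p)
    simp only at h1 ⊢
    rw [← h1]
    congr 2
    ring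

variable (hF : SmoothPeriodic V F) (hp : p ∈ V)
include hF hp

theorem differentiableAt (ζ : ℝ) : DifferentiableAt ℝ F (p, ζ) :=
  (hF.contDiffAt p hp ζ).differentiableAt (by simp)

theorem hasDerivAt (ζ : ℝ) : HasDerivAt (fun ζ => F (p, ζ)) (fderiv ℝ F (p, ζ) (0, 1)) ζ := by
  have h1 : HasDerivAt (fun ζ : ℝ => (p, ζ)) ((0 : P), (1 : ℝ)) ζ :=
    (hasDerivAt_const ζ p).prodMk (hasDerivAt_id ζ)
  exact (hF.differentiableAt hp ζ).hasFDerivAt.comp_hasDerivAt ζ h1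

theorem hasFDerivAt_left (ζ : ℝ) :
    HasFDerivAt (fun p => F (p, ζ)) (fderiv ℝ F (p, ζ) ∘L .inl ℝ P ℝ) p := by
  have h1 : HasFDerivAt (fun p : P => (p, ζ)) (ContinuousLinearMap.inl ℝ P ℝ) p :=
    (hasFDerivAt_id p).prodMk (hasFDerivAt_const ζ p)
  exact (hF.differentiableAt hp ζ).hasFDerivAt.comp p h1

theorem continuous : Continuous fun ζ => F (p, ζ) :=
  continuous_iff_continuousAt.2 fun ζ => (hF.hasDerivAt hp ζ).continuousAt

theorem continuousAt_fderiv (ζ : ℝ) : ContinuousAt (fderiv ℝ F) (p, ζ) :=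
  ((hF.contDiffAt p hp ζ).fderiv_right (m := ∞) (by simp)).continuousAt

theorem continuous_fderiv : Continuous fun ζ => fderiv ℝ F (p, ζ) :=
  continuous_iff_continuousAt.2 fun ζ =>
    (hF.continuousAt_fderiv hp ζ).comp (f := fun ζ : ℝ => (p, ζ)) (by fun_prop)

theorem periodic_fderiv (hV : IsOpen V) : Function.Periodic (fun ζ => fderiv ℝ F (p, ζ)) 1 := by
  intro ζ
  have h1 : (fun q : P × ℝ => F (q + (0, 1))) =ᶠ[𝓝 (p, ζ)] F := by
    have : ∀ᶠ q : P × ℝ in 𝓝 (p, ζ), q.1 ∈ V := continuous_fst.continuousAt.eventually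
      (hV.mem_nhds hp)
    filter_upwards [this] with q hq
    have h2 := hF.periodic q.1 hq q.2
    simpa [Prod.add_def] using h2
  have h2 := h1.fderiv_eq (𝕜 := ℝ)
  rw [fderiv_comp_add_right] at h2
  simpa using h2

/-- The derivative with respect to the parameters of a function satisfying a differential
equation. -/
theorem hasDerivAt_fderiv (hV : IsOpen V) {R : P × ℝ → X} {c : P → ℝ} {c' : P →L[ℝ] ℝ} {ζ : ℝ}
    (hR : DifferentiableAt ℝ R (p, ζ)) (hc : HasFDerivAt c c' p) (h0 : c p ≠ 0)
    (h : ∀ p ∈ V, ∀ ζ, c p • fderiv ℝ F (p, ζ) (0, 1) = R (p, ζ)) (q : P) :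
    HasDerivAt (fun ζ => fderiv ℝ F (p, ζ) (q, 0)) ((c p)⁻¹ •
      (fderiv ℝ R (p, ζ) (q, 0) - c' q • fderiv ℝ F (p, ζ) (0, 1))) ζ := by
  have hs := (hF.contDiffAt p hp ζ).isSymmSndFDerivAt
    (by rw [minSmoothness_of_isRCLikeNormedField]; exact WithTop.coe_le_coe.2 (le_top : (2 : ℕ∞) ≤ ⊤))
  have hd : HasFDerivAt (fderiv ℝ F) (fderiv ℝ (fderiv ℝ F) (p, ζ)) (p, ζ) :=
    (((hF.contDiffAt p hp ζ).fderiv_right (m := ∞) (by simp)).differentiableAt (by simp)).hasFDerivAt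
  have h1 : HasDerivAt (fun ζ : ℝ => (p, ζ)) ((0 : P), (1 : ℝ)) ζ :=
    (hasDerivAt_const ζ p).prodMk (hasDerivAt_id ζ)
  have h2 := (hd.comp_hasDerivAt ζ h1).clm_apply (hasDerivAt_const ζ (q, (0 : ℝ)))
  simp only [map_zero, add_zero] at h2
  refine h2.congr_deriv ?_
  have h3 : HasDerivAt (fun ε : ℝ => p + ε • q) q 0 := by
    simpa using ((hasDerivAt_id (0 : ℝ)).smul_const q).const_add p
  have hq : HasDerivAt (fun ε : ℝ => (p + ε • q, ζ)) (q, (0 : ℝ)) 0 :=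
    h3.prodMk (hasDerivAt_const _ _)
  have h4 : HasDerivAt (fun ε : ℝ => fderiv ℝ F (p + ε • q, ζ) (0, 1))
      (fderiv ℝ (fderiv ℝ F) (p, ζ) (q, 0) (0, 1)) 0 := by
    have h5 : HasFDerivAt (fderiv ℝ F) (fderiv ℝ (fderiv ℝ F) (p, ζ)) (p + (0 : ℝ) • q, ζ) := by
      rw [zero_smul, add_zero]; exact hd
    have h6 : HasDerivAt (fun ε : ℝ => fderiv ℝ F (p + ε • q, ζ))
        (fderiv ℝ (fderiv ℝ F) (p, ζ) (q, 0)) 0 := h5.comp_hasDerivAt (0 : ℝ) hq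
    refine (h6.clm_apply (hasDerivAt_const (0 : ℝ) ((0 : P), (1 : ℝ)))).congr_deriv ?_
    rw [map_zero, add_zero]
  have h7 : HasDerivAt (fun ε : ℝ => c (p + ε • q)) (c' q) 0 := by
    have h5 : HasFDerivAt c c' (p + (0 : ℝ) • q) := by rw [zero_smul, add_zero]; exact hc
    exact h5.comp_hasDerivAt (0 : ℝ) h3
  have h8 : HasDerivAt (fun ε : ℝ => R (p + ε • q, ζ)) (fderiv ℝ R (p, ζ) (q, 0)) 0 := by
    have h5 : HasFDerivAt R (fderiv ℝ R (p, ζ)) (p + (0 : ℝ) • q, ζ) := by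
      rw [zero_smul, add_zero]; exact hR.hasFDerivAt
    exact h5.comp_hasDerivAt (0 : ℝ) hq
  have hev : ∀ᶠ ε : ℝ in 𝓝 0, p + ε • q ∈ V :=
    h3.continuousAt.eventually (hV.mem_nhds (by simpa using hp))
  -- Differentiate `c ∂_ζ F = R` in the direction `q`; the mixed second derivatives are exchanged by
  -- symmetry.
  have h9 := (h7.fun_smul h4).unique (h8.congr_of_eventuallyEq (by
    filter_upwards [hev] with ε hε using h _ hε ζ))
  simp only [zero_smul, add_zero] at h9
  rw [← h9, hs.eq, add_sub_cancel_right, smul_smul, inv_mul_cancel₀ h0, one_smul]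

/-- Differentiation under the integral sign. -/
theorem hasFDerivAt_integral [ProperSpace P] [CompleteSpace X] (hV : IsOpen V) :
    HasFDerivAt (fun p => ∫ ζ in (0 : ℝ)..1, F (p, ζ))
      (∫ ζ in (0 : ℝ)..1, fderiv ℝ F (p, ζ) ∘L .inl ℝ P ℝ) p := by
  obtain ⟨r, hr, hrV⟩ := Metric.nhds_basis_closedBall.mem_iff.1 (hV.mem_nhds hp)
  have hcont : ContinuousOn (fderiv ℝ F) (Metric.closedBall p r ×ˢ uIcc (0 : ℝ) 1) := fun q hq =>
    (hF.continuousAt_fderiv (hrV hq.1) q.2).continuousWithinAt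
  obtain ⟨K, hK⟩ := ((isCompact_closedBall p r).prod
    isCompact_uIcc).exists_bound_of_continuousOn hcont
  refine intervalIntegral.hasFDerivAt_integral_of_dominated_of_fderiv_le
    (F' := fun p ζ => fderiv ℝ F (p, ζ) ∘L .inl ℝ P ℝ)
    (bound := fun _ => K * ‖ContinuousLinearMap.inl ℝ P ℝ‖)
    (Metric.closedBall_mem_nhds p hr) ?_ ?_ ?_ ?_ ?_ ?_
  · filter_upwards [hV.mem_nhds hp] with p hp using (hF.continuous hp).aestronglyMeasurable
  · exact (hF.continuous hp).intervalIntegrable _ _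
  · exact ((hF.continuous_fderiv hp).clm_comp continuous_const).aestronglyMeasurable
  · refine Eventually.of_forall fun ζ hζ x hx => ?_
    exact (ContinuousLinearMap.opNorm_comp_le _ _).trans
      (mul_le_mul_of_nonneg_right (hK (x, ζ) ⟨hx, uIoc_subset_uIcc hζ⟩) (norm_nonneg _))
  · exact intervalIntegrable_const
  · exact Eventually.of_forall fun ζ _ x hx => hF.hasFDerivAt_left (hrV hx) ζ

theorem fderiv_integral_apply [ProperSpace P] [CompleteSpace X] (hV : IsOpen V) (q : P) :
    fderiv ℝ (fun p => ∫ ζ in (0 : ℝ)..1, F (p, ζ)) p q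
      = ∫ ζ in (0 : ℝ)..1, fderiv ℝ F (p, ζ) (q, 0) := by
  rw [(hF.hasFDerivAt_integral hp hV).fderiv]
  exact (ContinuousLinearMap.intervalIntegral_apply
    (((hF.continuous_fderiv hp).clm_comp continuous_const).intervalIntegrable 0 1) q)

end SmoothPeriodic

end SmoothPeriodic

/-! ### Averages over the cells of a period -/

section Average

variable {X : Type*} [NormedAddCommGroup X] [NormedSpace ℝ X] (N : ℕ) [NeZero N]

/-- The average of the values of `f` at the points `τ + j / N`. -/
def cellMean (f : ℝ → X) (τ : ℝ) : X := (1 / (N : ℝ)) • ∑ j : ZMod N, f ((j.val : ℝ) / N + τ)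

variable {N} {f : ℝ → X}

theorem cellMean_add (f g : ℝ → X) (τ : ℝ) :
    cellMean N (fun ζ => f ζ + g ζ) τ = cellMean N f τ + cellMean N g τ := by
  simp [cellMean, Finset.sum_add_distrib]

theorem cellMean_sub (f g : ℝ → X) (τ : ℝ) :
    cellMean N (fun ζ => f ζ - g ζ) τ = cellMean N f τ - cellMean N g τ := by
  simp [cellMean, Finset.sum_sub_distrib, smul_sub]

theorem cellMean_smul (c : ℝ) (f : ℝ → X) (τ : ℝ) :
    cellMean N (fun ζ => c • f ζ) τ = c • cellMean N f τ := by
  simp only [cellMean, ← Finset.smul_sum]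
  rw [smul_comm]

theorem cellMean_add_one (hf : Function.Periodic f 1) (τ : ℝ) :
    cellMean N f (τ + 1) = cellMean N f τ := by
  simp only [cellMean, ← add_assoc, hf _]

/-- A shift by `1 / N` permutes the cells cyclically; this makes differences of fluxes disappear in
cell means. -/
theorem cellMean_shift (hf : Function.Periodic f 1) (τ : ℝ) :
    cellMean N (fun ζ => f (ζ + 1 / (N : ℝ))) τ = cellMean N f τ := by
  rw [cellMean, cellMean, ← Equiv.sum_comp (Equiv.addRight (1 : ZMod N))
    fun j => f ((j.val : ℝ) / N + τ)]
  congr 1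
  refine Finset.sum_congr rfl fun j _ => ?_
  have h1 := periodic_val N hf ((j.val : ℤ) + 1) τ
  have h2 : ((((j.val : ℤ) + 1 : ℤ)) : ZMod N) = j + 1 := by push_cast; simp
  rw [h2] at h1
  rw [Equiv.coe_addRight, h1]
  congr 1
  push_cast
  ring

theorem cellMean_shift_intCast (hf : Function.Periodic f 1) (n : ℤ) (τ : ℝ) :
    cellMean N (fun ζ => f (ζ + n • (1 / (N : ℝ)))) τ = cellMean N f τ := by
  induction n with
  | zero => simp
  | succ n ih =>
    rw [← ih, ← cellMean_shift (f := fun ζ => f (ζ + (n : ℤ) • (1 / (N : ℝ)))) fun x => ?_]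
    · congr 1
      funext ζ
      congr 1
      rw [add_smul, one_smul]
      ring
    · simp only [add_right_comm x 1, hf _]
  | pred n ih =>
    rw [← ih, ← cellMean_shift (f := fun ζ => f (ζ + (-(n : ℤ) - 1) • (1 / (N : ℝ)))) fun x => ?_]
    · congr 1
      funext ζ
      congr 1
      rw [sub_smul, one_smul]
      ring
    · simp only [add_right_comm x 1, hf _]

theorem hasDerivAt_cellMean {f' : ℝ → X} (hf : ∀ ζ, HasDerivAt f (f' ζ) ζ) (τ : ℝ) :
    HasDerivAt (cellMean N f) (cellMean N f' τ) τ := by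
  refine HasDerivAt.fun_const_smul _ (HasDerivAt.fun_sum fun j _ => ?_)
  have h := (hf ((j.val : ℝ) / N + τ)).scomp τ ((hasDerivAt_id τ).const_add ((j.val : ℝ) / N))
  rw [one_smul] at h
  exact h

theorem continuous_cellMean (hf : Continuous f) : Continuous (cellMean N f) := by
  have : Continuous fun τ => ∑ j : ZMod N, f ((j.val : ℝ) / N + τ) :=
    continuous_finsetSum _ fun j _ => hf.comp (by fun_prop)
  exact this.const_smul (1 / (N : ℝ))

theorem integral_cellMean (hf : Continuous f) (hper : Function.Periodic f 1) :
    ∫ τ in (0 : ℝ)..1, cellMean N f τ = ∫ τ in (0 : ℝ)..1, f τ := by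
  have h1 : ∀ j : ZMod N, ∫ τ in (0 : ℝ)..1, f ((j.val : ℝ) / N + τ) = ∫ τ in (0 : ℝ)..1, f τ := by
    intro j
    rw [intervalIntegral.integral_comp_add_left f]
    simpa using hper.intervalIntegral_add_eq ((j.val : ℝ) / N) 0
  have hN : (N : ℝ) ≠ 0 := Nat.cast_ne_zero.2 (NeZero.ne N)
  simp only [cellMean]
  rw [intervalIntegral.integral_smul, intervalIntegral.integral_finsetSum
    (f := fun (j : ZMod N) τ => f ((j.val : ℝ) / N + τ))
    fun j _ => Continuous.intervalIntegrable (hf.comp (by fun_prop)) _ _]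
  simp only [h1]
  rw [Finset.sum_const, Finset.card_univ, ZMod.card, ← Nat.cast_smul_eq_nsmul ℝ, smul_smul,
    one_div, inv_mul_cancel₀ hN, one_smul]

end Average

/-! ### Derivatives of the family of waves -/

namespace WaveFamily

variable {d : ℕ} {L : System d} {p₀ : Param d} (𝓕 : WaveFamily L p₀)

/-- The profiles as a function of the parameters and the phase. -/
def profile (q : Param d × ℝ) : Fin d → ℝ := 𝓕.u q.1 q.2

/-- The windows of the profiles. -/
def stencil (q : Param d × ℝ) : Fin 5 → Fin d → ℝ := window q.1.1 (𝓕.u q.1) q.2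

/-- The parameters of nonzero frequency. -/
def regular : Set (Param d) := 𝓕.dom ∩ 𝓕.freq ⁻¹' {0}ᶜ

theorem isOpen_regular : IsOpen 𝓕.regular :=
  𝓕.smooth_freq.continuousOn.isOpen_inter_preimage 𝓕.isOpen_dom isOpen_compl_singleton

theorem smoothPeriodic_profile : SmoothPeriodic 𝓕.regular 𝓕.profile where
  contDiffAt _ hp ζ := 𝓕.smooth_u.contDiffAt
    ((𝓕.isOpen_dom.prod isOpen_univ).mem_nhds ⟨hp.1, mem_univ ζ⟩)
  periodic p hp := 𝓕.periodic p hp.1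

theorem smoothPeriodic_stencil : SmoothPeriodic 𝓕.regular 𝓕.stencil where
  contDiffAt p hp ζ := contDiffAt_pi.2 fun m =>
    (𝓕.smoothPeriodic_profile.shift (a := fun p : Param d => (((m : ℕ) : ℤ) - 2) • p.1)
      (contDiff_fst.const_smul (((m : ℕ) : ℤ) - 2))).contDiffAt p hp ζ
  periodic p hp := by
    intro ζ
    funext m
    exact (𝓕.smoothPeriodic_profile.shift (a := fun p : Param d => (((m : ℕ) : ℤ) - 2) • p.1)
      (contDiff_fst.const_smul (((m : ℕ) : ℤ) - 2))).periodic p hp ζ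

section

variable {p : Param d} (hp : p ∈ 𝓕.regular)
include hp

/-- The sampling points `ζ + (m - 2) k` move with the wavenumber, which adds `(m - 2) q.1` to the
phase direction. -/
theorem fderiv_stencil (ζ r : ℝ) (q : Param d) (m : Fin 5) :
    fderiv ℝ 𝓕.stencil (p, ζ) (q, r) m
      = fderiv ℝ 𝓕.profile (p, ζ + (((m : ℕ) : ℤ) - 2) • p.1) (q, r + (((m : ℕ) : ℤ) - 2) • q.1) := by
  have h1 := hasFDerivAt_pi'.1 (𝓕.smoothPeriodic_stencil.differentiableAt hp ζ).hasFDerivAt m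
  let A : Param d × ℝ →L[ℝ] Param d × ℝ := (ContinuousLinearMap.fst ℝ (Param d) ℝ).prod
    (ContinuousLinearMap.snd ℝ (Param d) ℝ + (((m : ℕ) : ℤ) - 2) •
      (ContinuousLinearMap.fst ℝ ℝ _ ∘L ContinuousLinearMap.fst ℝ (Param d) ℝ))
  have hA : ∀ x, A x = (x.1, x.2 + (((m : ℕ) : ℤ) - 2) • x.1.1) := fun x => by
    simp [A]
  have h2 : HasFDerivAt 𝓕.profile (fderiv ℝ 𝓕.profile (A (p, ζ))) (A (p, ζ)) := by
    rw [hA]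
    exact (𝓕.smoothPeriodic_profile.differentiableAt hp _).hasFDerivAt
  have h3 := h2.comp (p, ζ) A.hasFDerivAt
  have h4 : (fun q => 𝓕.stencil q m) = 𝓕.profile ∘ A := funext fun q => by
    rw [Function.comp_apply, hA]; rfl
  rw [h4] at h1
  have h5 := DFunLike.congr_fun (h1.unique h3) (q, r)
  rw [ContinuousLinearMap.comp_apply, ContinuousLinearMap.comp_apply, hA, hA] at h5
  exact h5

theorem fderiv_comp_stencil {X : Type*} [NormedAddCommGroup X] [NormedSpace ℝ X]
    {Φ : (Fin 5 → Fin d → ℝ) → X} (hΦ : ContDiff ℝ ∞ Φ) (ζ : ℝ) (v : Param d × ℝ) :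
    fderiv ℝ (fun q => Φ (𝓕.stencil q)) (p, ζ) v
      = fderiv ℝ Φ (𝓕.stencil (p, ζ)) (fderiv ℝ 𝓕.stencil (p, ζ) v) := by
  have h := (hΦ.differentiable (by simp) (𝓕.stencil (p, ζ))).hasFDerivAt.comp (p, ζ)
    (𝓕.smoothPeriodic_stencil.differentiableAt hp ζ).hasFDerivAt
  exact DFunLike.congr_fun h.fderiv v

/-- The profile equation is the lattice system at cell 0 and time `ζ / ω`; this is the use of a
nonzero frequency. -/
theorem freq_smul_fderiv_profile (ζ : ℝ) :
    𝓕.freq p • fderiv ℝ 𝓕.profile (p, ζ) (0, 1) = L.field (𝓕.stencil (p, ζ)) := by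
  have h0 : 𝓕.freq p ≠ 0 := hp.2
  have h1 := 𝓕.isSolution p hp.1 (ζ / 𝓕.freq p) 0
  have h2 : HasDerivAt (𝓕.u p) (fderiv ℝ 𝓕.profile (p, ζ) (0, 1))
      (p.1 * ((0 : ℤ) : ℝ) + 𝓕.freq p * (ζ / 𝓕.freq p)) := by
    have h3 := 𝓕.smoothPeriodic_profile.hasDerivAt hp ζ
    have e : p.1 * ((0 : ℤ) : ℝ) + 𝓕.freq p * (ζ / 𝓕.freq p) = ζ := by
      rw [mul_div_cancel₀ _ h0]; simp
    rw [e]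
    exact h3
  have h3 := h2.scomp (ζ / 𝓕.freq p)
    (((hasDerivAt_id (ζ / 𝓕.freq p)).const_mul (𝓕.freq p)).const_add (p.1 * ((0 : ℤ) : ℝ)))
  rw [mul_one] at h3
  rw [h3.unique h1, L.J_euler_eq]
  congr 1
  funext m
  simp only [window, wave, stencil]
  congr 1
  rw [mul_div_cancel₀ _ h0]
  push_cast
  simp
  ring

theorem freq_smul_fderiv_density (ζ : ℝ) :
    𝓕.freq p • fderiv ℝ (fun q => L.density (𝓕.stencil q)) (p, ζ) (0, 1)
      = L.flux (𝓕.stencil (p, ζ + p.1)) - L.flux (𝓕.stencil (p, ζ)) := by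
  rw [𝓕.fderiv_comp_stencil hp L.contDiff_density, ← map_smul]
  have h1 : 𝓕.freq p • fderiv ℝ 𝓕.stencil (p, ζ) (0, 1)
      = window p.1 (fun y => L.field (window p.1 (𝓕.u p) y)) ζ := by
    funext m
    rw [Pi.smul_apply, 𝓕.fderiv_stencil hp]
    have h2 := 𝓕.freq_smul_fderiv_profile hp (ζ + (((m : ℕ) : ℤ) - 2) • p.1)
    simp only [Prod.fst_zero, smul_zero, add_zero]
    exact h2
  rw [h1]
  exact L.conservation p.1 (𝓕.u p) ζ

end

theorem hasFDerivAt_freq : HasFDerivAt 𝓕.freq (fderiv ℝ 𝓕.freq p₀) p₀ :=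
  ((𝓕.smooth_freq.contDiffAt (𝓕.isOpen_dom.mem_nhds 𝓕.mem_dom)).differentiableAt
    (by simp)).hasFDerivAt

section

variable (hω : 𝓕.freq p₀ ≠ 0)
include hω

theorem mem_regular : p₀ ∈ 𝓕.regular := ⟨𝓕.mem_dom, hω⟩

/-- The derivative of the profile solves the linearized profile equation. -/
theorem hasDerivAt_phase (ζ : ℝ) :
    HasDerivAt (fun ζ => fderiv ℝ 𝓕.profile (p₀, ζ) (0, 1)) ((𝓕.freq p₀)⁻¹ •
      fderiv ℝ L.field (𝓕.stencil (p₀, ζ)) (fderiv ℝ 𝓕.stencil (p₀, ζ) (0, 1))) ζ := by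
  have hp := 𝓕.mem_regular hω
  have h1 := (𝓕.smoothPeriodic_stencil.comp L.contDiff_field).hasDerivAt hp ζ
  rw [𝓕.fderiv_comp_stencil hp L.contDiff_field] at h1
  refine (h1.fun_const_smul (𝓕.freq p₀)⁻¹).congr_of_eventuallyEq (Eventually.of_forall fun ζ => ?_)
  simp only
  rw [← 𝓕.freq_smul_fderiv_profile hp, smul_smul, inv_mul_cancel₀ hω, one_smul]

/-- The derivatives with respect to parameters solve inhomogeneous linearized profile equations. -/
theorem hasDerivAt_param (q : Param d) (ζ : ℝ) :
    HasDerivAt (fun ζ => fderiv ℝ 𝓕.profile (p₀, ζ) (q, 0)) ((𝓕.freq p₀)⁻¹ •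
      (fderiv ℝ L.field (𝓕.stencil (p₀, ζ)) (fderiv ℝ 𝓕.stencil (p₀, ζ) (q, 0))
        - fderiv ℝ 𝓕.freq p₀ q • fderiv ℝ 𝓕.profile (p₀, ζ) (0, 1))) ζ := by
  have hp := 𝓕.mem_regular hω
  rw [← 𝓕.fderiv_comp_stencil hp L.contDiff_field]
  exact 𝓕.smoothPeriodic_profile.hasDerivAt_fderiv hp 𝓕.isOpen_regular
    ((𝓕.smoothPeriodic_stencil.comp L.contDiff_field).differentiableAt hp ζ)
    (𝓕.hasFDerivAt_freq) hω (fun p hp ζ => 𝓕.freq_smul_fderiv_profile hp ζ) q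

/-- Differentiate the balance law of the profile in the parameters. The shift `k` in the outgoing
flux is itself a parameter, hence the direction `(q, q.1)` there. -/
theorem hasDerivAt_density_param (q : Param d) (ζ : ℝ) :
    HasDerivAt (fun ζ => fderiv ℝ (fun q => L.density (𝓕.stencil q)) (p₀, ζ) (q, 0))
      ((𝓕.freq p₀)⁻¹ • (fderiv ℝ (fun q => L.flux (𝓕.stencil q)) (p₀, ζ + p₀.1) (q, q.1)
        - fderiv ℝ (fun q => L.flux (𝓕.stencil q)) (p₀, ζ) (q, 0)
        - fderiv ℝ 𝓕.freq p₀ q • fderiv ℝ (fun q => L.density (𝓕.stencil q)) (p₀, ζ) (0, 1))) ζ := by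
  have hp := 𝓕.mem_regular hω
  have hg := 𝓕.smoothPeriodic_stencil.comp L.contDiff_flux
  let A : Param d × ℝ →L[ℝ] Param d × ℝ := (ContinuousLinearMap.fst ℝ (Param d) ℝ).prod
    (ContinuousLinearMap.snd ℝ (Param d) ℝ +
      ContinuousLinearMap.fst ℝ ℝ _ ∘L ContinuousLinearMap.fst ℝ (Param d) ℝ)
  have hA : ∀ x, A x = (x.1, x.2 + x.1.1) := fun x => rfl
  have h2 : HasFDerivAt (fun q => L.flux (𝓕.stencil q))
      (fderiv ℝ (fun q => L.flux (𝓕.stencil q)) (A (p₀, ζ))) (A (p₀, ζ)) :=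
    (hg.differentiableAt hp (ζ + p₀.1)).hasFDerivAt
  have h3 := (h2.comp (p₀, ζ) A.hasFDerivAt).fun_sub (hg.differentiableAt hp ζ).hasFDerivAt
  have h4 := (𝓕.smoothPeriodic_stencil.comp L.contDiff_density).hasDerivAt_fderiv hp
    𝓕.isOpen_regular h3.differentiableAt (𝓕.hasFDerivAt_freq) hω
    (fun p hp ζ => 𝓕.freq_smul_fderiv_density hp ζ) q
  rw [h3.fderiv, sub_apply, ContinuousLinearMap.comp_apply, hA, hA, zero_add] at h4
  exact h4

end

theorem integral_flux_none {p : Param d} (hp : p ∈ 𝓕.regular) :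
    (∫ ζ in (0 : ℝ)..1, L.flux (𝓕.stencil (p, ζ))) none = 𝓕.S p := by
  have h1 := (ContinuousLinearMap.proj (R := ℝ) (φ := fun _ : Option (Fin d) => ℝ)
    none).intervalIntegral_comp_comm (((𝓕.smoothPeriodic_stencil.comp L.contDiff_flux).continuous
      hp).intervalIntegrable (μ := volume) 0 1)
  simp only [ContinuousLinearMap.proj_apply] at h1
  rw [← h1, S, ← intervalIntegral.integral_const_mul]
  refine intervalIntegral.integral_congr fun ζ _ => ?_
  have h2 : L.J p.1 (L.euler p.1 (𝓕.u p)) ζ = L.field (𝓕.stencil (p, ζ)) := L.J_euler_eq _ _ _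
  simp only [h2, System.flux, Option.elim, System.euler_eq, System.jet, fwd]
  simp [stencil]

/-- The two Euler terms of the flux differ by a shift, so they have the same average over a period.
-/
theorem integral_flux_some {p : Param d} (hp : p ∈ 𝓕.regular) (i : Fin d) :
    (∫ ζ in (0 : ℝ)..1, L.flux (𝓕.stencil (p, ζ))) (some i) = (L.B *ᵥ 𝓕.F p) i := by
  have h1 := (ContinuousLinearMap.proj (R := ℝ) (φ := fun _ : Option (Fin d) => ℝ)
    (some i)).intervalIntegral_comp_comm (((𝓕.smoothPeriodic_stencil.comp L.contDiff_flux).continuous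
      hp).intervalIntegrable (μ := volume) 0 1)
  simp only [ContinuousLinearMap.proj_apply] at h1
  let K : (Fin d → ℝ) →L[ℝ] ℝ := (ContinuousLinearMap.proj i : (Fin d → ℝ) →L[ℝ] ℝ) ∘L
    LinearMap.toContinuousLinearMap (Matrix.mulVecLin L.B)
  have hK : ∀ v, K v = (L.B *ᵥ v) i := fun v => rfl
  set e : ℝ → Fin d → ℝ := L.euler p.1 (𝓕.u p) with he
  have hs := 𝓕.smoothPeriodic_stencil.comp (L.contDiff_euler₃ 1 2 3)
  have hes : e = fun ζ => L.euler₃ (𝓕.stencil (p, ζ) 1) (𝓕.stencil (p, ζ) 2) (𝓕.stencil (p, ζ) 3) := by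
    funext ζ
    rw [he, L.euler_eq]
    simp [stencil]
  have hec : Continuous e := by rw [hes]; exact hs.continuous hp
  have hep : Function.Periodic e 1 := by rw [hes]; exact hs.periodic p hp
  have hec' : Continuous fun ζ => e (ζ - p.1) := hec.comp (by fun_prop)
  have h2 : ∀ ζ, L.flux (𝓕.stencil (p, ζ)) (some i) = (L.η / 2) * K (e ζ + e (ζ - p.1)) := fun ζ => by
    rw [hK, he, L.euler_eq, L.euler_eq]
    simp [System.flux, stencil]
  have h3 : ∫ ζ in (0 : ℝ)..1, e (ζ - p.1) = ∫ ζ in (0 : ℝ)..1, e ζ := by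
    rw [intervalIntegral.integral_comp_sub_right]
    have := hep.intervalIntegral_add_eq (0 - p.1) 0
    rw [zero_add] at this
    rw [← this]
    congr 1
    ring
  rw [← h1, intervalIntegral.integral_congr fun ζ _ => h2 ζ, intervalIntegral.integral_const_mul,
    K.intervalIntegral_comp_comm ((hec.fun_add hec').intervalIntegrable 0 1),
    intervalIntegral.integral_add (hec.intervalIntegrable 0 1) (hec'.intervalIntegrable 0 1), h3, F,
    map_add, hK, Matrix.mulVec_smul, Pi.smul_apply, smul_eq_mul]
  ring

theorem integral_density {p : Param d} (hp : p ∈ 𝓕.regular) :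
    ∫ ζ in (0 : ℝ)..1, L.density (𝓕.stencil (p, ζ)) = fun o => o.elim p.2.2 p.2.1 := by
  funext o
  have h1 := (ContinuousLinearMap.proj (R := ℝ) (φ := fun _ : Option (Fin d) => ℝ)
    o).intervalIntegral_comp_comm (((𝓕.smoothPeriodic_stencil.comp L.contDiff_density).continuous
      hp).intervalIntegrable (μ := volume) 0 1)
  simp only [ContinuousLinearMap.proj_apply] at h1
  rw [← h1]
  rcases o with _ | i
  · simp only [System.density, stencil, Option.elim, window_two, window_three]
    exact 𝓕.energy_eq p hp.1
  · simp only [System.density, stencil, Option.elim, window_two]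
    have h2 := (ContinuousLinearMap.proj (R := ℝ) (φ := fun _ : Fin d => ℝ)
      i).intervalIntegral_comp_comm ((𝓕.smoothPeriodic_profile.continuous
        hp).intervalIntegrable (μ := volume) 0 1)
    simp only [ContinuousLinearMap.proj_apply] at h2
    exact h2.trans (congrFun (𝓕.mean_eq p hp.1) i)

variable (hω : 𝓕.freq p₀ ≠ 0)
include hω

/-- The averaged densities are the parameters `M` and `E` themselves, so their differential is a
projection. -/
theorem integral_fderiv_density (q : Param d) :
    ∫ ζ in (0 : ℝ)..1, fderiv ℝ (fun q => L.density (𝓕.stencil q)) (p₀, ζ) (q, 0)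
      = fun o => o.elim q.2.2 q.2.1 := by
  have hp := 𝓕.mem_regular hω
  rw [← (𝓕.smoothPeriodic_stencil.comp L.contDiff_density).fderiv_integral_apply hp
    𝓕.isOpen_regular]
  let K : Param d →L[ℝ] (Option (Fin d) → ℝ) := LinearMap.toContinuousLinearMap
    { toFun := fun p o => o.elim p.2.2 p.2.1
      map_add' := fun p p' => by funext o; cases o <;> rfl
      map_smul' := fun c p => by funext o; cases o <;> rfl }
  have h1 : (fun p => ∫ ζ in (0 : ℝ)..1, L.density (𝓕.stencil (p, ζ))) =ᶠ[𝓝 p₀] K := by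
    filter_upwards [𝓕.isOpen_regular.mem_nhds hp] with p hp using 𝓕.integral_density hp
  rw [h1.fderiv_eq, K.fderiv]
  rfl

theorem fderiv_whithamFlux (q : Param d) :
    fderiv ℝ 𝓕.whithamFlux p₀ q = (fderiv ℝ 𝓕.freq p₀ q,
      (fun i => (∫ ζ in (0 : ℝ)..1,
        fderiv ℝ (fun q => L.flux (𝓕.stencil q)) (p₀, ζ) (q, 0)) (some i)),
      (∫ ζ in (0 : ℝ)..1, fderiv ℝ (fun q => L.flux (𝓕.stencil q)) (p₀, ζ) (q, 0)) none) := by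
  have hp := 𝓕.mem_regular hω
  have hg := (𝓕.smoothPeriodic_stencil.comp L.contDiff_flux).hasFDerivAt_integral hp
    𝓕.isOpen_regular
  let K : (Option (Fin d) → ℝ) →L[ℝ] (Fin d → ℝ) × ℝ := LinearMap.toContinuousLinearMap
    { toFun := fun c => (fun i => c (some i), c none)
      map_add' := fun p p' => rfl
      map_smul' := fun c p => rfl }
  have h1 : (fun p => (𝓕.freq p, K (∫ ζ in (0 : ℝ)..1, L.flux (𝓕.stencil (p, ζ)))))
      =ᶠ[𝓝 p₀] 𝓕.whithamFlux := by
    filter_upwards [𝓕.isOpen_regular.mem_nhds hp] with p hp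
    have h2 : K (∫ ζ in (0 : ℝ)..1, L.flux (𝓕.stencil (p, ζ))) = (L.B *ᵥ 𝓕.F p, 𝓕.S p) :=
      Prod.ext (funext fun i => 𝓕.integral_flux_some hp i) (𝓕.integral_flux_none hp)
    rw [h2]
    rfl
  have h2 := (𝓕.hasFDerivAt_freq).prodMk (K.hasFDerivAt.comp p₀ hg)
  rw [← (𝓕.smoothPeriodic_stencil.comp L.contDiff_flux).fderiv_integral_apply hp
    𝓕.isOpen_regular, hg.fderiv]
  exact DFunLike.congr_fun (h2.congr_of_eventuallyEq h1.symm).fderiv q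

variable (N : ℕ) [NeZero N] (hk : p₀.1 = 1 / (N : ℝ))

/-- The difference between the mean over cells and the mean of the fluxes, divided by the
frequency. -/
def fluxDefect (N : ℕ) [NeZero N] : Option (Fin d) → ℝ := (𝓕.freq p₀)⁻¹ •
  (cellMean N (fun ζ => L.flux (𝓕.stencil (p₀, ζ))) 0 - ∫ ζ in (0 : ℝ)..1, L.flux (𝓕.stencil (p₀, ζ)))

include hk

/-- The linearized densities have mean zero on the derivative of the profile. -/
theorem cellMean_density_phase (τ : ℝ) :
    cellMean N (fun ζ => fderiv ℝ (fun q => L.density (𝓕.stencil q)) (p₀, ζ) (0, 1)) τ = 0 := by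
  have hp := 𝓕.mem_regular hω
  have hg := 𝓕.smoothPeriodic_stencil.comp L.contDiff_flux
  have h1 : 𝓕.freq p₀ • cellMean N
      (fun ζ => fderiv ℝ (fun q => L.density (𝓕.stencil q)) (p₀, ζ) (0, 1)) τ = 0 := by
    rw [← cellMean_smul]
    simp only [𝓕.freq_smul_fderiv_density hp]
    rw [cellMean_sub, hk, cellMean_shift (f := fun ζ => L.flux (𝓕.stencil (p₀, ζ)))
      (hg.periodic p₀ hp), sub_self]
  exact (smul_eq_zero.1 h1).resolve_left hω

/-- The cell mean varies with `τ` only through the moving shift in the flux: its derivative is `q.1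
/ ω` times that of the cell mean of the flux. Removing that part leaves a constant, which averaging
over `τ` identifies; the value at `τ = 0` then shows the defect. -/
theorem cellMean_density_param (q : Param d) :
    cellMean N (fun ζ => fderiv ℝ (fun q => L.density (𝓕.stencil q)) (p₀, ζ) (q, 0)) 0
      = (fun o => o.elim q.2.2 q.2.1) + q.1 • 𝓕.fluxDefect N := by
  have hp := 𝓕.mem_regular hω
  have hh := 𝓕.smoothPeriodic_stencil.comp L.contDiff_density
  have hg := 𝓕.smoothPeriodic_stencil.comp L.contDiff_flux
  set e : ℝ → Option (Fin d) → ℝ := fun ζ =>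
    fderiv ℝ (fun q => L.density (𝓕.stencil q)) (p₀, ζ) (q, 0) with he
  set g : ℝ → Option (Fin d) → ℝ := fun ζ => L.flux (𝓕.stencil (p₀, ζ)) with hgdef
  have hgper : Function.Periodic g 1 := hg.periodic p₀ hp
  have hgc : Continuous g := hg.continuous hp
  have hec : Continuous e := (hh.continuous_fderiv hp).clm_apply continuous_const
  have heper : Function.Periodic e 1 := fun ζ => by
    have := hh.periodic_fderiv hp 𝓕.isOpen_regular ζ
    simp only at this
    simp only [e, this]
  have h1 : ∀ τ, HasDerivAt (fun τ => cellMean N e τ - ((𝓕.freq p₀)⁻¹ * q.1) • cellMean N g τ) 0 τ := by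
    intro τ
    refine ((hasDerivAt_cellMean (𝓕.hasDerivAt_density_param hω q) τ).fun_sub
      ((hasDerivAt_cellMean (fun ζ => hg.hasDerivAt hp ζ) τ).fun_const_smul
        ((𝓕.freq p₀)⁻¹ * q.1))).congr_deriv ?_
    have h2 : Function.Periodic
        (fun ζ => fderiv ℝ (fun q => L.flux (𝓕.stencil q)) (p₀, ζ) (q, q.1)) 1 := fun ζ => by
      have := hg.periodic_fderiv hp 𝓕.isOpen_regular ζ
      simp only at this
      simp only [this]
    have h3 : ((q, q.1) : Param d × ℝ) = (q, 0) + q.1 • (0, 1) := by simp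
    rw [cellMean_smul, cellMean_sub, cellMean_sub, cellMean_smul, 𝓕.cellMean_density_phase hω N hk, hk,
      cellMean_shift h2]
    simp only [h3, map_add, map_smul]
    rw [cellMean_add, cellMean_smul]
    module
  have h2 : ∀ τ, cellMean N e τ - ((𝓕.freq p₀)⁻¹ * q.1) • cellMean N g τ
      = cellMean N e 0 - ((𝓕.freq p₀)⁻¹ * q.1) • cellMean N g 0 := fun τ =>
    is_const_of_deriv_eq_zero (fun t => (h1 t).differentiableAt) (fun t => (h1 t).deriv) τ 0
  have h3 : ∫ τ in (0 : ℝ)..1, (cellMean N e τ - ((𝓕.freq p₀)⁻¹ * q.1) • cellMean N g τ)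
      = cellMean N e 0 - ((𝓕.freq p₀)⁻¹ * q.1) • cellMean N g 0 := by
    simp only [h2]
    simp
  have h4 : Continuous fun τ => ((𝓕.freq p₀)⁻¹ * q.1) • cellMean N g τ :=
    (continuous_cellMean hgc).const_smul ((𝓕.freq p₀)⁻¹ * q.1)
  rw [intervalIntegral.integral_sub ((continuous_cellMean hec).intervalIntegrable 0 1)
    (h4.intervalIntegrable 0 1), intervalIntegral.integral_smul, integral_cellMean hec heper,
    integral_cellMean hgc hgper, he, 𝓕.integral_fderiv_density hω q] at h3
  rw [fluxDefect]
  rw [eq_sub_iff_add_eq] at h3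
  rw [← h3]
  module

end WaveFamily

/-! ### Bloch operators on sampled functions -/

section Sampling

variable {d N : ℕ} [NeZero N] {ι : Type*} [Fintype ι]

/-- The values of a real function at the points `τ + j / N`, as a complex periodic sequence. -/
def shiftedSample (N : ℕ) (τ : ℝ) (v : ℝ → ι → ℝ) : ZMod N → ι → ℂ :=
  fun j => cvec (v ((j.val : ℝ) / N + τ))

theorem mean_shiftedSample (τ : ℝ) (v : ℝ → ι → ℝ) :
    mean (shiftedSample N τ v) = cvec (cellMean N v τ) := by
  rw [mean_apply, cellMean, cvec_smul, cvec_sum]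
  simp [shiftedSample]

theorem shiftedSample_add (τ : ℝ) (v z : ℝ → ι → ℝ) :
    shiftedSample N τ (fun ζ => v ζ + z ζ) = shiftedSample N τ v + shiftedSample N τ z :=
  funext fun _ => cvec_add _ _

theorem shiftedSample_smul (τ r : ℝ) (v : ℝ → ι → ℝ) :
    shiftedSample N τ (fun ζ => r • v ζ) = (r : ℂ) • shiftedSample N τ v :=
  funext fun _ => cvec_smul _ _

theorem shiftedSample_one {v : ℝ → ι → ℝ} (hv : Function.Periodic v 1) :
    shiftedSample N 1 v = shiftedSample N 0 v :=
  funext fun j => congrArg cvec (by rw [add_zero]; exact hv _)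

theorem shiftedSample_intCast {v : ℝ → ι → ℝ} (hv : Function.Periodic v 1) (τ : ℝ) (j : ZMod N)
    (n : ℤ) : shiftedSample N τ v (j + (n : ZMod N))
      = cvec (v ((j.val : ℝ) / N + τ + n • (1 / (N : ℝ)))) := by
  have h1 := periodic_val N hv ((j.val : ℤ) + n) τ
  have h2 : (((j.val : ℤ) + n : ℤ) : ZMod N) = j + (n : ZMod N) := by push_cast; simp
  rw [h2] at h1
  rw [shiftedSample, h1]
  congr 2
  push_cast
  rw [zsmul_eq_mul]
  ring

theorem stencilOp_zero_shiftedSample (K : ZMod N → ((Fin 5 → Fin d → ℝ) →L[ℝ] (ι → ℝ)))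
    {v : ℝ → Fin d → ℝ} (hv : Function.Periodic v 1) (τ : ℝ) (j : ZMod N) :
    stencilOp K 0 (shiftedSample N τ v) j
      = cvec (K j (window (1 / (N : ℝ)) v ((j.val : ℝ) / N + τ))) := by
  rw [stencilOp_apply, ← cx_cvec]
  congr 1
  funext m
  rw [blochWindow_apply, mul_zero, Complex.exp_zero, one_smul, shiftedSample_intCast hv]
  rfl

theorem deriv_stencilOp_shiftedSample (K : ZMod N → ((Fin 5 → Fin d → ℝ) →L[ℝ] (ι → ℝ)))
    {v : ℝ → Fin d → ℝ} (hv : Function.Periodic v 1) (τ : ℝ) (j : ZMod N) :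
    deriv (fun ξ => stencilOp K ξ) 0 (shiftedSample N τ v) j
      = Complex.I • cvec (K j (fun m => (((m : ℕ) : ℤ) - 2) •
          window (1 / (N : ℝ)) v ((j.val : ℝ) / N + τ) m)) := by
  rw [deriv_stencilOp, ← cx_cvec, ← map_smul]
  congr 1
  funext m
  rw [shiftedSample_intCast hv, Pi.smul_apply, ← smul_smul]
  congr 1
  funext i
  simp only [Pi.smul_apply, cvec, window, zsmul_eq_mul, smul_eq_mul]
  push_cast
  rfl

end Sampling

/-! ### Solutions of the linearized equations obtained from the family of waves -/

namespace WaveFamily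

variable {d : ℕ} {L : System d} {p₀ : Param d} (𝓕 : WaveFamily L p₀)

/-- The differential of the profile in the direction `v`. -/
def dprofile (v : Param d × ℝ) (ζ : ℝ) : Fin d → ℝ := fderiv ℝ 𝓕.profile (p₀, ζ) v

/-- The derivative of the frequency relative to the frequency. -/
def relFreq (q : Param d) : ℝ := (𝓕.freq p₀)⁻¹ * fderiv ℝ 𝓕.freq p₀ q

/-- The derivative of the averaged fluxes, divided by the frequency. -/
def relFlux (q : Param d) : Option (Fin d) → ℝ := (𝓕.freq p₀)⁻¹ •
  ∫ ζ in (0 : ℝ)..1, fderiv ℝ (fun q => L.flux (𝓕.stencil q)) (p₀, ζ) (q, 0)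

variable (N : ℕ) [NeZero N]

/-- The integrated fluxes of the derivative of the waves in the direction `q`. -/
def paramFlux (q : Param d) (τ : ℝ) : Option (Fin d) → ℝ :=
  (𝓕.freq p₀)⁻¹ • ((∫ ζ in (0 : ℝ)..τ, cellMean N
      (fun ζ => fderiv ℝ (fun q => L.flux (𝓕.stencil q)) (p₀, ζ) (q, 0)) ζ)
    -- Integration by parts of `σ` times the derivative of the cell mean of the flux: the
    -- contribution of the phase component, which grows linearly in time.
    + 𝓕.relFreq q • (τ • cellMean N (fun ζ => L.flux (𝓕.stencil (p₀, ζ))) τ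
      - ∫ ζ in (0 : ℝ)..τ, cellMean N (fun ζ => L.flux (𝓕.stencil (p₀, ζ))) ζ))

/-- The augmented solution associated with the derivative of the waves in the direction `q`. -/
def paramSolution (q : Param d) (τ : ℝ) : PerSeq d N × (Option (Fin d) → ℂ) :=
  -- The derivative of `u^p(kj + ω(p)t)` at `t = τ/ω`, without its nonperiodic part `j q.1 ∂_ζ u`.
  -- That part is accounted for by the derivative of the Bloch symbol in `ξ`.
  (shiftedSample N τ (𝓕.dprofile (q, τ * 𝓕.relFreq q)), cvec (𝓕.paramFlux N q τ))

/-- The augmented solution associated with the derivative of the profile. -/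
def phaseSolution (τ : ℝ) : PerSeq d N × (Option (Fin d) → ℂ) :=
  (shiftedSample N τ (𝓕.dprofile (0, 1)), cvec ((𝓕.freq p₀)⁻¹ •
    (cellMean N (fun ζ => L.flux (𝓕.stencil (p₀, ζ))) τ
      - cellMean N (fun ζ => L.flux (𝓕.stencil (p₀, ζ))) 0)))

variable (hω : 𝓕.freq p₀ ≠ 0)
include hω

theorem periodic_dprofile (v : Param d × ℝ) : Function.Periodic (𝓕.dprofile v) 1 := fun ζ => by
  have := 𝓕.smoothPeriodic_profile.periodic_fderiv (𝓕.mem_regular hω) 𝓕.isOpen_regular ζ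
  simp only at this
  simp only [dprofile, this]

variable (hk : p₀.1 = 1 / (N : ℝ))
include hk

omit hω in
theorem waveWindow_eq (τ : ℝ) (j : ZMod N) :
    waveWindow N (𝓕.u p₀) τ j = 𝓕.stencil (p₀, (j.val : ℝ) / N + τ) := by
  rw [waveWindow, ← hk]; rfl

theorem fderiv_stencil_eq (ζ r : ℝ) (q : Param d) :
    fderiv ℝ 𝓕.stencil (p₀, ζ) (q, r) = window (1 / (N : ℝ)) (𝓕.dprofile (q, r)) ζ
      + q.1 • fun m : Fin 5 => (((m : ℕ) : ℤ) - 2) • window (1 / (N : ℝ)) (𝓕.dprofile (0, 1)) ζ m := by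
  funext m
  rw [𝓕.fderiv_stencil (𝓕.mem_regular hω), hk]
  have h : ((q, r + (((m : ℕ) : ℤ) - 2) • q.1) : Param d × ℝ)
      = (q, r) + ((((m : ℕ) : ℤ) - 2) • q.1) • (0, 1) := by simp
  rw [h, map_add, map_smul, Pi.add_apply, Pi.smul_apply, smul_comm q.1, ← smul_assoc]
  rfl

/-- The Bloch factor at offset `m - 2` has derivative `I (m - 2)`, so the coefficient `-I q.1`
reproduces exactly the motion of the sampling points under a change of wavenumber. -/
theorem stencilOp_dprofile {ι : Type*} [Fintype ι]
    (K : ZMod N → ((Fin 5 → Fin d → ℝ) →L[ℝ] (ι → ℝ))) (τ r : ℝ) (q : Param d) :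
    stencilOp K 0 (shiftedSample N τ (𝓕.dprofile (q, r))) + (-Complex.I * q.1) •
        deriv (fun ξ => stencilOp K ξ) 0 (shiftedSample N τ (𝓕.dprofile (0, 1)))
      = fun j => cvec (K j (fderiv ℝ 𝓕.stencil (p₀, (j.val : ℝ) / N + τ) (q, r))) := by
  funext j
  rw [Pi.add_apply, Pi.smul_apply, stencilOp_zero_shiftedSample K (𝓕.periodic_dprofile hω _),
    deriv_stencilOp_shiftedSample K (𝓕.periodic_dprofile hω _), 𝓕.fderiv_stencil_eq N hω hk, map_add,
    cvec_add, map_smul, cvec_smul, smul_smul]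
  congr 2
  linear_combination (-(q.1 : ℂ)) * Complex.I_mul_I

theorem stencilOp_dprofile_zero {ι : Type*} [Fintype ι]
    (K : ZMod N → ((Fin 5 → Fin d → ℝ) →L[ℝ] (ι → ℝ))) (τ r : ℝ) {q : Param d} (hq : q.1 = 0) :
    stencilOp K 0 (shiftedSample N τ (𝓕.dprofile (q, r)))
      = fun j => cvec (K j (fderiv ℝ 𝓕.stencil (p₀, (j.val : ℝ) / N + τ) (q, r))) := by
  have h := 𝓕.stencilOp_dprofile N hω hk K τ r q
  rw [hq, Complex.ofReal_zero, mul_zero, zero_smul, add_zero] at h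
  exact h

omit hω hk in
theorem paramFlux_zero (q : Param d) : 𝓕.paramFlux N q 0 = 0 := by
  simp [paramFlux]

omit hk in
theorem paramFlux_one (q : Param d) :
    𝓕.paramFlux N q 1 = 𝓕.relFlux q + 𝓕.relFreq q • 𝓕.fluxDefect N := by
  have hp := 𝓕.mem_regular hω
  have hg := 𝓕.smoothPeriodic_stencil.comp L.contDiff_flux
  have hgper := hg.periodic p₀ hp
  have h1 : Function.Periodic
      (fun ζ => fderiv ℝ (fun q => L.flux (𝓕.stencil q)) (p₀, ζ) (q, 0)) 1 := fun ζ => by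
    have := hg.periodic_fderiv hp 𝓕.isOpen_regular ζ
    simp only at this
    simp only [this]
  have h2 := cellMean_add_one (N := N) hgper 0
  rw [zero_add] at h2
  rw [paramFlux, integral_cellMean ((hg.continuous_fderiv hp).clm_apply continuous_const) h1,
    integral_cellMean (hg.continuous hp) hgper, h2, one_smul, relFlux, fluxDefect]
  module

omit hk in
theorem hasDerivAt_paramFlux (q : Param d) (τ : ℝ) :
    HasDerivAt (𝓕.paramFlux N q) ((𝓕.freq p₀)⁻¹ • cellMean N (fun ζ =>
      fderiv ℝ (fun q => L.flux (𝓕.stencil q)) (p₀, ζ) (q, τ * 𝓕.relFreq q)) τ) τ := by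
  have hp := 𝓕.mem_regular hω
  have hg := 𝓕.smoothPeriodic_stencil.comp L.contDiff_flux
  have hgc := continuous_cellMean (N := N) (hg.continuous hp)
  have hdc := continuous_cellMean (N := N) (f := fun ζ =>
    fderiv ℝ (fun q => L.flux (𝓕.stencil q)) (p₀, ζ) (q, 0))
    ((hg.continuous_fderiv hp).clm_apply continuous_const)
  have h1 := (hdc.integral_hasStrictDerivAt 0 τ).hasDerivAt
  have h2 := (hgc.integral_hasStrictDerivAt 0 τ).hasDerivAt
  have h3 := (hasDerivAt_id τ).fun_smul (hasDerivAt_cellMean (N := N) (fun ζ => hg.hasDerivAt hp ζ) τ)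
  refine ((h1.fun_add ((h3.fun_sub h2).fun_const_smul (𝓕.relFreq q))).fun_const_smul
    (𝓕.freq p₀)⁻¹).congr_deriv ?_
  congr 1
  have h4 : ((q, τ * 𝓕.relFreq q) : Param d × ℝ) = (q, 0) + (τ * 𝓕.relFreq q) • (0, 1) := by simp
  simp only [h4, map_add, map_smul]
  rw [cellMean_add, cellMean_smul]
  simp only [id]
  module

theorem hasDerivAt_phaseSolution (τ : ℝ) : HasDerivAt (𝓕.phaseSolution N)
    (augmentedGenerator L N (𝓕.u p₀) (𝓕.freq p₀) 0 τ (𝓕.phaseSolution N τ)) τ := by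
  have hp := 𝓕.mem_regular hω
  have hg := 𝓕.smoothPeriodic_stencil.comp L.contDiff_flux
  rw [augmentedGenerator, augmentedOp_apply, phaseSolution]
  refine HasDerivAt.prodMk ?_ ?_
  · rw [𝓕.stencilOp_dprofile_zero N hω hk _ τ 1 Prod.fst_zero]
    refine hasDerivAt_pi.2 fun j => hasDerivAt_cvec ?_
    rw [smul_apply, 𝓕.waveWindow_eq N hk]
    have h := (𝓕.hasDerivAt_phase hω ((j.val : ℝ) / N + τ)).scomp τ
      ((hasDerivAt_id τ).const_add ((j.val : ℝ) / N))
    rw [one_smul] at h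
    exact h
  · rw [𝓕.stencilOp_dprofile_zero N hω hk _ τ 1 Prod.fst_zero]
    have h1 := ((hasDerivAt_cellMean (N := N) (fun ζ => hg.hasDerivAt hp ζ) τ).sub_const
      (cellMean N (fun ζ => L.flux (𝓕.stencil (p₀, ζ))) 0)).fun_const_smul (𝓕.freq p₀)⁻¹
    refine (hasDerivAt_cvec h1).congr_deriv ?_
    rw [← cellMean_smul, ← mean_shiftedSample]
    congr 1
    funext j
    rw [smul_apply, 𝓕.waveWindow_eq N hk, shiftedSample, 𝓕.fderiv_comp_stencil hp L.contDiff_flux]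

/-- For `q.1 = 0` this is a genuine solution; in the wavenumber direction it is forced by the first
variation of the generator along the phase solution, the form required by
`hasDerivAt_evolution_param`. -/
theorem hasDerivAt_paramSolution (q : Param d) (τ : ℝ) : HasDerivAt (𝓕.paramSolution N q)
    (augmentedGenerator L N (𝓕.u p₀) (𝓕.freq p₀) 0 τ (𝓕.paramSolution N q τ) +
      (-Complex.I * q.1) • deriv (fun ξ => augmentedGenerator L N (𝓕.u p₀) (𝓕.freq p₀) ξ τ) 0
        (𝓕.phaseSolution N τ)) τ := by
  have hp := 𝓕.mem_regular hω
  have hg := 𝓕.smoothPeriodic_stencil.comp L.contDiff_flux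
  simp only [augmentedGenerator]
  rw [augmentedOp_apply, deriv_augmentedOp, Prod.smul_mk, Prod.mk_add_mk,
    ← map_smul (mean (N := N) (ι := Option (Fin d))), ← map_add]
  refine HasDerivAt.prodMk ?_ ?_
  · simp only [paramSolution, phaseSolution]
    rw [𝓕.stencilOp_dprofile N hω hk]
    refine hasDerivAt_pi.2 fun j => hasDerivAt_cvec ?_
    rw [smul_apply, 𝓕.waveWindow_eq N hk]
    have h1 := (𝓕.hasDerivAt_phase hω ((j.val : ℝ) / N + τ)).scomp τ
      ((hasDerivAt_id τ).const_add ((j.val : ℝ) / N))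
    have h2 := (𝓕.hasDerivAt_param hω q ((j.val : ℝ) / N + τ)).scomp τ
      ((hasDerivAt_id τ).const_add ((j.val : ℝ) / N))
    have h3 := h2.fun_add (((hasDerivAt_id τ).mul_const (𝓕.relFreq q)).fun_smul h1)
    have h4 : ∀ ζ r, 𝓕.dprofile (q, r) ζ = fderiv ℝ 𝓕.profile (p₀, ζ) (q, 0)
        + r • fderiv ℝ 𝓕.profile (p₀, ζ) (0, 1) := fun ζ r => by
      rw [dprofile, ← map_smul, ← map_add]
      simp
    have h5 : fderiv ℝ 𝓕.stencil (p₀, (j.val : ℝ) / N + τ) (q, τ * 𝓕.relFreq q)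
        = fderiv ℝ 𝓕.stencil (p₀, (j.val : ℝ) / N + τ) (q, 0)
          + (τ * 𝓕.relFreq q) • fderiv ℝ 𝓕.stencil (p₀, (j.val : ℝ) / N + τ) (0, 1) := by
      rw [← map_smul, ← map_add]
      simp
    simp only [h4]
    refine h3.congr_deriv ?_
    rw [h5, map_add, map_smul, one_smul, one_smul, one_mul, relFreq]
    simp only [Function.comp_apply, id]
    module
  · simp only [paramSolution, phaseSolution]
    rw [𝓕.stencilOp_dprofile N hω hk]
    refine (hasDerivAt_cvec (𝓕.hasDerivAt_paramFlux N hω q τ)).congr_deriv ?_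
    rw [← cellMean_smul, ← mean_shiftedSample]
    congr 1
    funext j
    rw [smul_apply, 𝓕.waveWindow_eq N hk, shiftedSample, 𝓕.fderiv_comp_stencil hp L.contDiff_flux]

end WaveFamily

/-! ### The modulation data of a wave -/

theorem cellMean_clm {X Y : Type*} [NormedAddCommGroup X] [NormedSpace ℝ X] [NormedAddCommGroup Y]
    [NormedSpace ℝ Y] {N : ℕ} [NeZero N] (A : X →L[ℝ] Y) (f : ℝ → X) (τ : ℝ) :
    cellMean N (fun ζ => A (f ζ)) τ = A (cellMean N f τ) := by
  simp [cellMean]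

/-- The directions `∂_M`, `∂_E` in the space of parameters. -/
def paramBasis {d : ℕ} (o : Option (Fin d)) : Param d := o.elim (0, 0, 1) fun i => (0, Pi.single i 1, 0)

theorem paramBasis_fst {d : ℕ} (o : Option (Fin d)) : (paramBasis o).1 = 0 := by
  cases o <;> rfl

theorem paramBasis_snd {d : ℕ} (o : Option (Fin d)) :
    (fun o' : Option (Fin d) => o'.elim (paramBasis o).2.2 (paramBasis o).2.1) = Pi.single o 1 := by
  funext o'
  rcases o with _ | i <;> rcases o' with _ | i' <;> simp [paramBasis, Pi.single_apply]

theorem sum_paramBasis {d : ℕ} (q : (Fin d → ℝ) × ℝ) :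
    ((0, q) : Param d) = ∑ o : Option (Fin d), o.elim q.2 q.1 • paramBasis o := by
  rw [Fintype.sum_option]
  refine Prod.ext ?_ (Prod.ext ?_ ?_)
  · simp [paramBasis, Prod.fst_sum]
  · simp [paramBasis, Prod.fst_sum, Prod.snd_sum]
    funext i
    simp [Finset.sum_apply, Pi.single_apply]
  · simp [paramBasis, Prod.snd_sum]

/-- The linear map with given values on the standard basis. -/
def combination {κ X : Type*} [Fintype κ] [NormedAddCommGroup X] [NormedSpace ℂ X] (v : κ → X) :
    (κ → ℂ) →L[ℂ] X := LinearMap.toContinuousLinearMap (Fintype.linearCombination ℂ v)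

theorem combination_apply {κ X : Type*} [Fintype κ] [NormedAddCommGroup X] [NormedSpace ℂ X]
    (v : κ → X) (c : κ → ℂ) : combination v c = ∑ o, c o • v o :=
  Fintype.linearCombination_apply ℂ v c

namespace WaveFamily

variable {d : ℕ} {L : System d} {p₀ : Param d} (𝓕 : WaveFamily L p₀) (N : ℕ) [NeZero N]

theorem continuous_u : Continuous (𝓕.u p₀) := by
  have h : ContinuousOn (fun ζ : ℝ => 𝓕.u p₀ ζ) univ :=
    𝓕.smooth_u.continuousOn.comp (f := fun ζ : ℝ => (p₀, ζ)) (by fun_prop)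
      fun ζ _ => ⟨𝓕.mem_dom, mem_univ ζ⟩
  exact continuousOn_univ.1 h

/-- The critical vector at zero wavenumber. -/
def phaseVector : PerSeq d N := shiftedSample N 0 (𝓕.dprofile (0, 1))

/-- The derivatives of the wave with respect to the parameters. -/
def paramVector (q : Param d) : PerSeq d N := shiftedSample N 0 (𝓕.dprofile (q, 0))

variable (hω : 𝓕.freq p₀ ≠ 0)
include hω

theorem hasDerivAt_u (hk : p₀.1 = 1 / (N : ℝ)) (ζ : ℝ) : HasDerivAt (𝓕.u p₀)
    ((𝓕.freq p₀)⁻¹ • L.field (window (1 / (N : ℝ)) (𝓕.u p₀) ζ)) ζ := by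
  have hp := 𝓕.mem_regular hω
  have h1 := 𝓕.smoothPeriodic_profile.hasDerivAt hp ζ
  have h2 := 𝓕.freq_smul_fderiv_profile hp ζ
  rw [← hk]
  refine h1.congr_deriv ?_
  rw [show window p₀.1 (𝓕.u p₀) ζ = 𝓕.stencil (p₀, ζ) from rfl, ← h2, smul_smul, inv_mul_cancel₀ hω,
    one_smul]

variable (hk : p₀.1 = 1 / (N : ℝ))
include hk

theorem phaseSolution_zero : 𝓕.phaseSolution N 0 = (𝓕.phaseVector N, 0) := by
  rw [phaseSolution, sub_self, smul_zero, cvec_zero, phaseVector]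

theorem phaseSolution_one : 𝓕.phaseSolution N 1 = (𝓕.phaseVector N, 0) := by
  have hg := (𝓕.smoothPeriodic_stencil.comp L.contDiff_flux).periodic p₀ (𝓕.mem_regular hω)
  have h := cellMean_add_one (N := N) hg 0
  rw [zero_add] at h
  rw [phaseSolution, h, sub_self, smul_zero, cvec_zero, shiftedSample_one (𝓕.periodic_dprofile hω _),
    phaseVector]

theorem paramSolution_zero (q : Param d) : 𝓕.paramSolution N q 0 = (𝓕.paramVector N q, 0) := by
  rw [paramSolution, paramFlux_zero, cvec_zero, zero_mul, paramVector]

theorem paramSolution_one (q : Param d) : 𝓕.paramSolution N q 1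
    = (𝓕.paramVector N q + (𝓕.relFreq q : ℂ) • 𝓕.phaseVector N,
      cvec (𝓕.relFlux q) + (𝓕.relFreq q : ℂ) • cvec (𝓕.fluxDefect N)) := by
  have h : 𝓕.dprofile (q, 𝓕.relFreq q)
      = fun ζ => 𝓕.dprofile (q, 0) ζ + 𝓕.relFreq q • 𝓕.dprofile (0, 1) ζ := by
    funext ζ
    rw [dprofile, dprofile, dprofile, ← map_smul, ← map_add]
    simp
  rw [paramSolution, 𝓕.paramFlux_one N hω, cvec_add, cvec_smul, one_mul,
    shiftedSample_one (𝓕.periodic_dprofile hω _), h, shiftedSample_add, shiftedSample_smul, paramVector,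
    phaseVector]

theorem evolution_phaseVector :
    evolution (augmentedGenerator L N (𝓕.u p₀) (𝓕.freq p₀) 0) 1 0 (𝓕.phaseVector N, 0)
      = (𝓕.phaseVector N, 0) := by
  have h := eq_evolution_apply
    (continuous_augmentedGenerator_left L N (𝓕.freq p₀) 𝓕.continuous_u 0)
    (𝓕.hasDerivAt_phaseSolution N hω hk) (right_mem_Icc.2 zero_le_one)
  rw [𝓕.phaseSolution_zero N hω hk, 𝓕.phaseSolution_one N hω hk] at h
  exact h.symm

theorem evolution_paramVector {q : Param d} (hq : q.1 = 0) :
    evolution (augmentedGenerator L N (𝓕.u p₀) (𝓕.freq p₀) 0) 1 0 (𝓕.paramVector N q, 0)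
      = (𝓕.paramVector N q + (𝓕.relFreq q : ℂ) • 𝓕.phaseVector N,
        cvec (𝓕.relFlux q) + (𝓕.relFreq q : ℂ) • cvec (𝓕.fluxDefect N)) := by
  have h := eq_evolution_apply
    (continuous_augmentedGenerator_left L N (𝓕.freq p₀) 𝓕.continuous_u 0)
    (fun τ => (𝓕.hasDerivAt_paramSolution N hω hk q τ).congr_deriv (by
      rw [hq, Complex.ofReal_zero, mul_zero, zero_smul, add_zero])) (right_mem_Icc.2 zero_le_one)
  rw [𝓕.paramSolution_zero N hω hk, 𝓕.paramSolution_one N hω hk] at h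
  exact h.symm

/-- First variation formula applied to `I` times the parameter solution: `I · (-I) = 1` normalizes
its forcing. The two components provide the expansions of the Floquet operator and of the integrated
fluxes at once. -/
theorem hasDerivAt_evolution_wavenumber {q : Param d} (hq : q.1 = 1) :
    HasDerivAt (fun ξ : ℂ => evolution (augmentedGenerator L N (𝓕.u p₀) (𝓕.freq p₀) ξ) 1 0
        ((𝓕.phaseVector N, 0) + ξ • (Complex.I • (𝓕.paramVector N q, 0))))
      (Complex.I • (𝓕.paramVector N q + (𝓕.relFreq q : ℂ) • 𝓕.phaseVector N,
        cvec (𝓕.relFlux q) + (𝓕.relFreq q : ℂ) • cvec (𝓕.fluxDefect N))) 0 := by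
  have h := hasDerivAt_evolution_param
    (continuous_augmentedGenerator L N (𝓕.freq p₀) 𝓕.continuous_u)
    (fun t => differentiable_augmentedOp _ _)
    (x := 𝓕.phaseSolution N) (y := fun τ => Complex.I • 𝓕.paramSolution N q τ)
    (𝓕.hasDerivAt_phaseSolution N hω hk) fun τ => by
      refine ((𝓕.hasDerivAt_paramSolution N hω hk q τ).fun_const_smul Complex.I).congr_deriv ?_
      rw [hq, map_smul, smul_add, smul_smul, Complex.ofReal_one, mul_one, mul_neg, Complex.I_mul_I,
        neg_neg, one_smul]
  rw [𝓕.phaseSolution_zero N hω hk, 𝓕.paramSolution_zero N hω hk, 𝓕.paramSolution_one N hω hk] at h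
  exact h

theorem fst_evolution (ξ : ℂ) (y : PerSeq d N × (Option (Fin d) → ℂ)) :
    (evolution (augmentedGenerator L N (𝓕.u p₀) (𝓕.freq p₀) ξ) 1 0 y).1
      = monodromy L N (𝓕.u p₀) (𝓕.freq p₀) ξ y.1 :=
  fst_evolution_augmentedGenerator L N _ 𝓕.continuous_u ξ y (right_mem_Icc.2 zero_le_one)

omit hω hk in
theorem snd_evolution (ξ : ℂ) (v : PerSeq d N) :
    (evolution (augmentedGenerator L N (𝓕.u p₀) (𝓕.freq p₀) ξ) 1 0 (v, 0)).2
      = meanFlux L N (𝓕.u p₀) (𝓕.freq p₀) ξ v := rfl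

theorem meanDensity_paramVector (q : Param d) :
    meanDensity L N (𝓕.u p₀) 0 0 (𝓕.paramVector N q) + (-Complex.I * q.1) •
        mean (deriv (fun ξ => stencilOp (fun j => fderiv ℝ L.density (waveWindow N (𝓕.u p₀) 0 j)) ξ) 0
          (𝓕.phaseVector N))
      = cvec ((fun o : Option (Fin d) => o.elim q.2.2 q.2.1) + q.1 • 𝓕.fluxDefect N) := by
  have hp := 𝓕.mem_regular hω
  rw [← 𝓕.cellMean_density_param hω N hk q, ← mean_shiftedSample, meanDensity,
    ContinuousLinearMap.comp_apply, ← map_smul (mean (N := N) (ι := Option (Fin d))), ← map_add,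
    paramVector, phaseVector, 𝓕.stencilOp_dprofile N hω hk]
  congr 1
  funext j
  rw [shiftedSample, 𝓕.waveWindow_eq N hk, 𝓕.fderiv_comp_stencil hp L.contDiff_density]

theorem meanDensity_phaseVector : meanDensity L N (𝓕.u p₀) 0 0 (𝓕.phaseVector N) = 0 := by
  have hp := 𝓕.mem_regular hω
  rw [← cvec_zero, ← 𝓕.cellMean_density_phase hω N hk 0, ← mean_shiftedSample, meanDensity,
    ContinuousLinearMap.comp_apply, phaseVector, 𝓕.stencilOp_dprofile_zero N hω hk _ 0 1 Prod.fst_zero]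
  congr 1
  funext j
  rw [shiftedSample, 𝓕.waveWindow_eq N hk, 𝓕.fderiv_comp_stencil hp L.contDiff_density]

theorem meanDensity_paramBasis (o : Option (Fin d)) :
    meanDensity L N (𝓕.u p₀) 0 0 (𝓕.paramVector N (paramBasis o)) = Pi.single o 1 := by
  have h := 𝓕.meanDensity_paramVector N hω hk (paramBasis o)
  rw [paramBasis_fst, Complex.ofReal_zero, mul_zero, zero_smul, zero_smul, add_zero, add_zero,
    paramBasis_snd] at h
  rw [h]
  funext o'
  simp only [cvec, Pi.single_apply]
  split_ifs <;> simp

omit hω hk in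
theorem differentiable_meanDensity : Differentiable ℂ fun ξ => meanDensity L N (𝓕.u p₀) ξ 0 :=
  fun ξ => (differentiableAt_const _).clm_comp (differentiable_stencilOp _ ξ)

theorem hasDerivAt_meanDensity :
    HasDerivAt (fun ξ : ℂ => meanDensity L N (𝓕.u p₀) ξ 0
        (𝓕.phaseVector N + ξ • (Complex.I • 𝓕.paramVector N (1, 0, 0))))
      (Complex.I • cvec (𝓕.fluxDefect N)) 0 := by
  set K : ZMod N → ((Fin 5 → Fin d → ℝ) →L[ℝ] (Option (Fin d) → ℝ)) := fun j =>
    fderiv ℝ L.density (waveWindow N (𝓕.u p₀) 0 j) with hK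
  have h1 : HasDerivAt (fun ξ => meanDensity L N (𝓕.u p₀) ξ 0)
      (mean ∘L deriv (fun ξ => stencilOp K ξ) 0) 0 := by
    have h := (hasDerivAt_const (0 : ℂ) (mean (N := N) (ι := Option (Fin d)))).clm_comp
      (differentiable_stencilOp K 0).hasDerivAt
    rw [ContinuousLinearMap.zero_comp, zero_add] at h
    exact h
  have h2 : HasDerivAt (fun ξ : ℂ => 𝓕.phaseVector N + ξ • (Complex.I • 𝓕.paramVector N (1, 0, 0)))
      (Complex.I • 𝓕.paramVector N (1, 0, 0)) 0 := by
    simpa using ((hasDerivAt_id (0 : ℂ)).smul_const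
      (Complex.I • 𝓕.paramVector N (1, 0, 0))).const_add (𝓕.phaseVector N)
  refine (h1.clm_apply h2).congr_deriv ?_
  have h3 := 𝓕.meanDensity_paramVector N hω hk (1, 0, 0)
  have h4 : (fun o : Option (Fin d) => o.elim ((1, 0, 0) : Param d).2.2 ((1, 0, 0) : Param d).2.1)
      = 0 := by funext o; cases o <;> rfl
  rw [h4, zero_add, one_smul, Complex.ofReal_one, mul_one] at h3
  rw [← h3, zero_smul, add_zero, map_smul, smul_add, smul_smul, mul_neg, Complex.I_mul_I, neg_neg,
    one_smul, add_comm]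
  rfl

/-- If it vanished, uniqueness for the linearized equation would make the profile constant. At a
constant state the cell mean of the linearized energy depends only on the cell mean `z` of `∂_E u`.
This `z` is 0 because `M` is held fixed, whereas `∂_E` of the energy must be 1. -/
theorem phaseVector_ne_zero : 𝓕.phaseVector N ≠ 0 := by
  intro h0
  have hp := 𝓕.mem_regular hω
  have h1 : ∀ τ ∈ Icc (0 : ℝ) 1, 𝓕.dprofile (0, 1) τ = 0 := by
    intro τ hτ
    have h2 := eq_evolution_apply
      (continuous_augmentedGenerator_left L N (𝓕.freq p₀) 𝓕.continuous_u 0)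
      (𝓕.hasDerivAt_phaseSolution N hω hk) hτ
    rw [𝓕.phaseSolution_zero N hω hk, h0, Prod.mk_zero_zero, map_zero] at h2
    have h3 := congrFun (congrArg Prod.fst h2) 0
    funext i
    have h4 := congrFun h3 i
    simpa [phaseSolution, shiftedSample, cvec] using h4
  have h2 : ∀ ζ, 𝓕.dprofile (0, 1) ζ = 0 := fun ζ => by
    rw [← h1 (Int.fract ζ) ⟨Int.fract_nonneg ζ, (Int.fract_lt_one ζ).le⟩, ← Int.self_sub_floor]
    have := (𝓕.periodic_dprofile hω (0, 1)).sub_int_mul_eq (x := ζ) ⌊ζ⌋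
    rw [mul_one] at this
    exact this.symm
  have h3 : ∀ ζ, 𝓕.u p₀ ζ = 𝓕.u p₀ 0 := fun ζ => by
    have h : ∀ ζ, HasDerivAt (𝓕.u p₀) 0 ζ := fun ζ =>
      (𝓕.smoothPeriodic_profile.hasDerivAt hp ζ).congr_deriv (h2 ζ)
    exact is_const_of_deriv_eq_zero (fun ζ => (h ζ).differentiableAt) (fun ζ => (h ζ).deriv) ζ 0
  have h4 : ∀ ζ, 𝓕.stencil (p₀, ζ) = 𝓕.stencil (p₀, 0) := fun ζ => by
    funext m
    simp only [stencil, window]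
    rw [h3, ← h3]
  set z : Fin d → ℝ := cellMean N (𝓕.dprofile (paramBasis none, 0)) 0 with hz
  have h5 : cellMean N (fun ζ => fderiv ℝ 𝓕.stencil (p₀, ζ) (paramBasis none, 0)) 0 = fun _ => z := by
    funext m
    have h6 := cellMean_clm (N := N) (ContinuousLinearMap.proj (R := ℝ)
      (φ := fun _ : Fin 5 => Fin d → ℝ) m)
      (fun ζ => fderiv ℝ 𝓕.stencil (p₀, ζ) (paramBasis none, 0)) 0
    simp only [ContinuousLinearMap.proj_apply] at h6
    rw [← h6, hz, ← cellMean_shift_intCast (𝓕.periodic_dprofile hω _) (((m : ℕ) : ℤ) - 2)]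
    congr 1
    funext ζ
    rw [𝓕.fderiv_stencil hp, paramBasis_fst, smul_zero, add_zero, hk]
    rfl
  have h6 := 𝓕.cellMean_density_param hω N hk (paramBasis none)
  rw [paramBasis_fst, zero_smul, add_zero, paramBasis_snd] at h6
  simp only [𝓕.fderiv_comp_stencil hp L.contDiff_density] at h6
  simp only [h4] at h6
  rw [cellMean_clm, h5] at h6
  have h7 : z = 0 := funext fun i => by
    have := congrFun h6 (some i)
    rw [System.fderiv_density_some] at this
    simpa using this
  have h8 := congrFun h6 none
  rw [System.fderiv_density_none, h7] at h8
  simp at h8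

theorem blochEvolution_eq_monodromy (ξ : ℝ) : 𝓕.blochEvolution N ξ (1 / 𝓕.freq p₀) 0
    = monodromy L N (𝓕.u p₀) (𝓕.freq p₀) ξ := by
  rw [← evolution_blochSymbol L N (𝓕.freq p₀) 𝓕.continuous_u (𝓕.periodic p₀ 𝓕.mem_dom) hω ξ, ← hk]
  rfl

theorem exists_eq_of_mem_span {v : PerSeq d N} (hv : v ∈ Submodule.span ℂ (𝓕.tangentVectors N)) :
    ∃ (a : ℂ) (c : Option (Fin d) → ℂ), v = a • 𝓕.phaseVector N
      + combination (fun o => 𝓕.paramVector N (paramBasis o)) c := by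
  have hp := 𝓕.mem_regular hω
  let f : ℂ × (Option (Fin d) → ℂ) →ₗ[ℂ] PerSeq d N :=
    (LinearMap.toSpanSingleton ℂ _ (𝓕.phaseVector N)).coprod
      (combination fun o => 𝓕.paramVector N (paramBasis o) : (Option (Fin d) → ℂ) →ₗ[ℂ] PerSeq d N)
  have hf : ∀ a c, f (a, c) = a • 𝓕.phaseVector N
      + combination (fun o => 𝓕.paramVector N (paramBasis o)) c := fun a c => by
    simp [f]
  have h1 : Submodule.span ℂ (𝓕.tangentVectors N) ≤ LinearMap.range f := by
    rw [Submodule.span_le]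
    rintro x (rfl | ⟨q, rfl⟩)
    · refine ⟨(1, 0), ?_⟩
      rw [hf, map_zero, add_zero, one_smul]
      funext j
      have h2 : deriv (𝓕.u p₀) = 𝓕.dprofile (0, 1) :=
        funext fun ζ => (𝓕.smoothPeriodic_profile.hasDerivAt hp ζ).deriv
      rw [h2, phaseVector, shiftedSample, add_zero]
      rfl
    · refine ⟨(0, cvec fun o => o.elim q.2 q.1), ?_⟩
      rw [hf, zero_smul, zero_add, combination_apply]
      funext j
      have h2 : ∀ ζ, fderiv ℝ (fun p => 𝓕.u p ζ) p₀ (0, q) = 𝓕.dprofile ((0, q), 0) ζ := fun ζ =>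
        DFunLike.congr_fun (𝓕.smoothPeriodic_profile.hasFDerivAt_left hp ζ).fderiv (0, q)
      have h3 : ∀ ζ, 𝓕.dprofile ((0, q), 0) ζ
          = ∑ o : Option (Fin d), o.elim q.2 q.1 • 𝓕.dprofile (paramBasis o, 0) ζ := fun ζ => by
        have h4 : (((0, q), 0) : Param d × ℝ)
            = ContinuousLinearMap.inl ℝ (Param d) ℝ ((0, q) : Param d) := rfl
        simp only [dprofile]
        rw [h4, sum_paramBasis q, map_sum, map_sum]
        simp only [map_smul]
        rfl
      simp only [h2, h3]
      rw [Finset.sum_apply]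
      simp only [Pi.smul_apply, paramVector, shiftedSample, add_zero]
      refine Eq.trans ?_ (cvec_sum _ _).symm
      simp only [cvec_smul]
      rfl
  obtain ⟨⟨a, c⟩, h⟩ := h1 hv
  exact ⟨a, c, h ▸ hf a c⟩

/-- The modulation data of the base wave. -/
def modulationData (hA : 𝓕.NonDegenerate N) :
    ModulationData (PerSeq d N) (Option (Fin d) → ℂ) where
  M := monodromy L N (𝓕.u p₀) (𝓕.freq p₀)
  ℓ := fun ξ => meanDensity L N (𝓕.u p₀) ξ 0
  n := meanFlux L N (𝓕.u p₀) (𝓕.freq p₀)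
  φ := 𝓕.phaseVector N
  ψ := 𝓕.paramVector N (1, 0, 0)
  χ := combination fun o => 𝓕.paramVector N (paramBasis o)
  θ := 𝓕.relFreq (1, 0, 0)
  ϑ := combination fun o => (𝓕.relFreq (paramBasis o) : ℂ)
  s := cvec (𝓕.fluxDefect N)
  Gk := cvec (𝓕.relFlux (1, 0, 0))
  Gc := combination fun o => cvec (𝓕.relFlux (paramBasis o))
  analytic_M := (differentiable_monodromy L N _ 𝓕.continuous_u).analyticAt 0
  analytic_ℓ := (𝓕.differentiable_meanDensity N).analyticAt 0
  analytic_n := (differentiable_meanFlux L N _ 𝓕.continuous_u).analyticAt 0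
  conservation := conservation_monodromy L N _ 𝓕.continuous_u (𝓕.periodic p₀ 𝓕.mem_dom) hω
    (𝓕.hasDerivAt_u N hω hk)
  M_φ := by
    have h := 𝓕.fst_evolution N hω hk 0 (𝓕.phaseVector N, 0)
    rw [𝓕.evolution_phaseVector N hω hk] at h
    exact h.symm
  M_χ := fun c => by
    have h : ∀ o, monodromy L N (𝓕.u p₀) (𝓕.freq p₀) 0 (𝓕.paramVector N (paramBasis o))
        = 𝓕.paramVector N (paramBasis o) + (𝓕.relFreq (paramBasis o) : ℂ) • 𝓕.phaseVector N := by
      intro o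
      have h := 𝓕.fst_evolution N hω hk 0 (𝓕.paramVector N (paramBasis o), 0)
      rw [𝓕.evolution_paramVector N hω hk (paramBasis_fst o)] at h
      exact h.symm
    rw [combination_apply, combination_apply, map_sum, Finset.sum_smul, ← Finset.sum_add_distrib]
    refine Finset.sum_congr rfl fun o _ => ?_
    rw [map_smul, h, smul_add, smul_smul, smul_eq_mul]
  M_ψ := by
    have h := (𝓕.hasDerivAt_evolution_wavenumber N hω hk (q := (1, 0, 0)) rfl).fst
    simp only [𝓕.fst_evolution N hω hk] at h
    exact h
  ℓ_φ := 𝓕.meanDensity_phaseVector N hω hk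
  ℓ_χ := fun c => by
    rw [combination_apply, map_sum]
    simp only [map_smul, 𝓕.meanDensity_paramBasis N hω hk]
    exact (pi_eq_sum_univ' c).symm
  ℓ_ψ := 𝓕.hasDerivAt_meanDensity N hω hk
  n_φ := by
    rw [← snd_evolution, 𝓕.evolution_phaseVector N hω hk]
  n_χ := fun c => by
    have h : ∀ o, meanFlux L N (𝓕.u p₀) (𝓕.freq p₀) 0 (𝓕.paramVector N (paramBasis o))
        = cvec (𝓕.relFlux (paramBasis o))
          + (𝓕.relFreq (paramBasis o) : ℂ) • cvec (𝓕.fluxDefect N) := fun o => by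
      rw [← snd_evolution, 𝓕.evolution_paramVector N hω hk (paramBasis_fst o)]
    rw [combination_apply, combination_apply, combination_apply, map_sum, Finset.sum_smul,
      ← Finset.sum_add_distrib]
    refine Finset.sum_congr rfl fun o _ => ?_
    rw [map_smul, h, smul_add, smul_smul, smul_eq_mul]
  n_ψ := by
    have h := (𝓕.hasDerivAt_evolution_wavenumber N hω hk (q := (1, 0, 0)) rfl).snd
    simp only [Prod.smul_mk, Prod.mk_add_mk, smul_zero, add_zero, snd_evolution] at h
    exact h
  φ_ne_zero := 𝓕.phaseVector_ne_zero N hω hk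
  -- The only field that rests on the non-degeneracy assumption.
  mem_of_pow_eq_zero := fun k v h => by
    refine 𝓕.exists_eq_of_mem_span N hω hk (hA ?_)
    rw [𝓕.blochEvolution_eq_monodromy N hω hk, Complex.ofReal_zero]
    refine Module.End.mem_maxGenEigenspace _ _ _ |>.2 ⟨k, ?_⟩
    have h1 : ∀ A : PerSeq d N →L[ℂ] PerSeq d N,
        ((A : Module.End ℂ (PerSeq d N)) ^ k) v = (A ^ k) v := fun A => by
      rw [← ContinuousLinearMap.toLinearMap_pow]; rfl
    rw [← h, ← h1, one_smul]
    rfl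

end WaveFamily

/-! ### Comparison with the averaged system -/

section Conjugation

variable {V V' : Type*} [AddCommGroup V] [Module ℂ V] [AddCommGroup V'] [Module ℂ V']
  {T : Module.End ℂ V} {D : Module.End ℂ V'} (e : V ≃ₗ[ℂ] V') {c : ℂ}
  (h : ∀ x, e (T x) = c • D (e x))
include h

theorem pow_sub_smul_of_intertwining (b : ℂ) (k : ℕ) (x : V) :
    e (((T - (c * b) • (1 : Module.End ℂ V)) ^ k) x)
      = c ^ k • ((D - b • (1 : Module.End ℂ V')) ^ k) (e x) := by
  induction k generalizing x with
  | zero => simp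
  | succ k ih =>
    have h1 : e ((T - (c * b) • (1 : Module.End ℂ V)) x) = c • (D - b • (1 : Module.End ℂ V')) (e x) := by
      simp only [LinearMap.sub_apply, LinearMap.smul_apply, Module.End.one_apply, map_sub, map_smul, h]
      module
    rw [pow_succ, Module.End.mul_apply, ih, h1, pow_succ (D - b • (1 : Module.End ℂ V')),
      Module.End.mul_apply, map_smul, smul_smul, pow_succ]

theorem maxGenEigenspace_le_of_intertwining (hc : c ≠ 0) (b : ℂ) (m : ℕ)
    (hT : T.maxGenEigenspace (c * b) ≤ T.genEigenspace (c * b) m) :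
    D.maxGenEigenspace b ≤ D.genEigenspace b m := by
  intro y hy
  obtain ⟨k, hk⟩ := (Module.End.mem_maxGenEigenspace _ _ _).1 hy
  have h1 : e.symm y ∈ T.maxGenEigenspace (c * b) := by
    refine (Module.End.mem_maxGenEigenspace _ _ _).2 ⟨k, e.injective ?_⟩
    rw [pow_sub_smul_of_intertwining e h, e.apply_symm_apply, hk, smul_zero, map_zero]
  have h2 := Module.End.mem_genEigenspace_nat.1 (hT h1)
  have h3 := pow_sub_smul_of_intertwining e h b m (e.symm y)
  rw [LinearMap.mem_ker.1 h2, map_zero, e.apply_symm_apply] at h3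
  exact Module.End.mem_genEigenspace_nat.2
    (LinearMap.mem_ker.2 ((smul_eq_zero.1 h3.symm).resolve_left (pow_ne_zero m hc)))

theorem charpoly_of_intertwining [FiniteDimensional ℂ V] [FiniteDimensional ℂ V'] (hc : c ≠ 0)
    {r : ℕ} {a : Fin r → ℂ} (hr : Module.finrank ℂ V' = r)
    (ha : T.charpoly = ∏ α, (Polynomial.X - Polynomial.C (a α))) :
    D.charpoly = ∏ α, (Polynomial.X - Polynomial.C (c⁻¹ * a α)) := by
  have h1 : e.conj T = c • D := LinearMap.ext fun y => by
    rw [LinearEquiv.conj_apply_apply, h, e.apply_symm_apply]; rfl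
  refine Polynomial.funext fun z => mul_left_cancel₀ (pow_ne_zero r hc) ?_
  have h2 : T.charpoly.eval (c * z) = c ^ r * D.charpoly.eval z := by
    rw [← e.charpoly_conj T, h1, LinearMap.eval_charpoly, LinearMap.eval_charpoly, ← hr,
      ← LinearMap.det_smul, smul_sub]
    congr 2
    ext y
    simp [Module.algebraMap_end_apply, smul_comm z c]
  rw [← h2, ha, Polynomial.eval_prod, Polynomial.eval_prod,
    show c ^ r = ∏ _α : Fin r, c by simp, ← Finset.prod_mul_distrib]
  refine Finset.prod_congr rfl fun α _ => ?_
  simp only [Polynomial.eval_sub, Polynomial.eval_X, Polynomial.eval_C]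
  field_simp

end Conjugation

namespace WaveFamily

variable {d : ℕ} {L : System d} {p₀ : Param d} (𝓕 : WaveFamily L p₀)

/-- Real parameters seen as complex ones. -/
def complexParam : Param d →ₗ[ℝ] ℂ × (Option (Fin d) → ℂ) where
  toFun q := (q.1, cvec fun o => o.elim q.2.2 q.2.1)
  map_add' q q' := by
    refine Prod.ext (by simp) (funext fun o => ?_)
    cases o <;> simp [cvec]
  map_smul' r q := by
    refine Prod.ext (by simp) (funext fun o => ?_)
    cases o <;> simp [cvec]

theorem complexParam_apply (q : Param d) :
    complexParam q = ((q.1 : ℂ), cvec fun o : Option (Fin d) => o.elim q.2.2 q.2.1) := rfl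

theorem complexParam_paramBasis (o : Option (Fin d)) :
    complexParam (paramBasis o) = ((0 : ℂ), Pi.single o (1 : ℂ)) := by
  rw [complexParam_apply, paramBasis_fst, paramBasis_snd, Complex.ofReal_zero]
  congr 1
  funext o'
  simp only [cvec, Pi.single_apply]
  split_ifs <;> simp

theorem complexParam_one : complexParam (1, 0, 0) = ((1 : ℂ), (0 : Option (Fin d) → ℂ)) := by
  rw [complexParam_apply]
  refine Prod.ext (by simp) (funext fun o => ?_)
  cases o <;> simp [cvec]

theorem finrank_complexParam : Module.finrank ℂ (ℂ × (Option (Fin d) → ℂ)) = d + 2 := by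
  rw [Module.finrank_prod, Module.finrank_fintype_fun_eq_card, Fintype.card_option, Fintype.card_fin,
    Module.finrank_self]
  omega

/-- The complexification of the space of parameters. -/
def complexParamEquiv : (ℂ ⊗[ℝ] Param d) ≃ₗ[ℂ] ℂ × (Option (Fin d) → ℂ) := by
  let f := LinearMap.liftBaseChange ℂ (complexParam (d := d))
  have hf : ∀ z q, f (z ⊗ₜ q) = z • complexParam q := fun z q =>
    LinearMap.liftBaseChange_tmul _ _ _ _
  have h1 : Module.finrank ℂ (ℂ ⊗[ℝ] Param d) = Module.finrank ℂ (ℂ × (Option (Fin d) → ℂ)) := by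
    rw [finrank_complexParam, Module.finrank_baseChange, Module.finrank_prod, Module.finrank_prod,
      Module.finrank_fintype_fun_eq_card, Fintype.card_fin, Module.finrank_self]
    omega
  have h2 : Function.Surjective f := by
    rintro ⟨k, c⟩
    refine ⟨k ⊗ₜ (1, 0, 0) + ∑ o, c o ⊗ₜ paramBasis o, ?_⟩
    rw [map_add, map_sum, hf, complexParam_one]
    simp only [hf, complexParam_paramBasis]
    refine Prod.ext ?_ ?_
    · simp [Prod.fst_sum]
    · simp only [Prod.snd_add, Prod.snd_sum, Prod.smul_snd, smul_zero, zero_add]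
      exact (pi_eq_sum_univ' c).symm
  exact LinearEquiv.ofBijective f
    ⟨(LinearMap.injective_iff_surjective_of_finrank_eq_finrank h1).2 h2, h2⟩

theorem complexParamEquiv_tmul (z : ℂ) (q : Param d) :
    complexParamEquiv (z ⊗ₜ[ℝ] q) = z • complexParam q :=
  LinearMap.liftBaseChange_tmul _ _ _ _

variable (hω : 𝓕.freq p₀ ≠ 0) (N : ℕ) [NeZero N] (hk : p₀.1 = 1 / (N : ℝ))
  (hA : 𝓕.NonDegenerate N)

include hω in
theorem complexParam_fderiv_whithamFlux (q : Param d) :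
    complexParam (fderiv ℝ 𝓕.whithamFlux p₀ q)
      = 𝓕.freq p₀ • ((𝓕.relFreq q : ℂ), cvec (𝓕.relFlux q)) := by
  rw [complexParam_apply, 𝓕.fderiv_whithamFlux hω, Prod.smul_mk, ← cvec_smul', relFlux, smul_smul,
    mul_inv_cancel₀ hω, one_smul, relFreq]
  refine Prod.ext ?_ (congrArg cvec (funext fun o => by cases o <;> rfl))
  simp only [Complex.real_smul]
  push_cast
  rw [mul_inv_cancel_left₀ (by exact_mod_cast hω)]

/-- The entries of the averaged operator are those of the Whitham Jacobian divided by the frequency;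
it is enough to compare them on the directions of `k`, `M` and `E`. -/
theorem averaged_complexParam (q : Param d) :
    complexParam (fderiv ℝ 𝓕.whithamFlux p₀ q)
      = (𝓕.freq p₀ : ℂ) • (𝓕.modulationData N hω hk hA).averaged (complexParam q) := by
  set A := (𝓕.modulationData N hω hk hA).averaged with hAv
  let f : Param d →ₗ[ℝ] ℂ × (Option (Fin d) → ℂ) :=
    complexParam ∘ₗ (fderiv ℝ 𝓕.whithamFlux p₀ : Param d →ₗ[ℝ] Param d)
  let g : Param d →ₗ[ℝ] ℂ × (Option (Fin d) → ℂ) :=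
    𝓕.freq p₀ • ((A : ℂ × (Option (Fin d) → ℂ) →ₗ[ℂ] _).restrictScalars ℝ ∘ₗ complexParam)
  have h1 : f (1, 0, 0) = g (1, 0, 0) := by
    change complexParam (fderiv ℝ 𝓕.whithamFlux p₀ (1, 0, 0)) = 𝓕.freq p₀ • A (complexParam (1, 0, 0))
    rw [𝓕.complexParam_fderiv_whithamFlux hω, complexParam_one, hAv, ModulationData.averaged,
      ModulationData.block_apply]
    simp [modulationData]
  have h2 : ∀ o, f (paramBasis o) = g (paramBasis o) := fun o => by
    change complexParam (fderiv ℝ 𝓕.whithamFlux p₀ (paramBasis o))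
      = 𝓕.freq p₀ • A (complexParam (paramBasis o))
    rw [𝓕.complexParam_fderiv_whithamFlux hω, complexParam_paramBasis, hAv, ModulationData.averaged,
      ModulationData.block_apply]
    simp [modulationData, combination_apply, Pi.single_apply]
  have h3 : q = q.1 • ((1, 0, 0) : Param d) + (0, q.2) :=
    Prod.ext (by simp) (by simp [← Prod.zero_eq_mk])
  have h4 : f q = g q := by
    rw [h3, sum_paramBasis, map_add, map_add, map_smul, map_smul, map_sum, map_sum, h1]
    simp only [map_smul, h2]
  exact h4.trans (Complex.coe_smul _ _).symm

theorem complexParamEquiv_whithamLin (x : ℂ ⊗[ℝ] Param d) :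
    complexParamEquiv (𝓕.whithamLin x)
      = (𝓕.freq p₀ : ℂ) • ((𝓕.modulationData N hω hk hA).averaged :
          Module.End ℂ (ℂ × (Option (Fin d) → ℂ))) (complexParamEquiv x) := by
  induction x with
  | zero => simp
  | add x y hx hy => rw [map_add, map_add, map_add, map_add, smul_add, hx, hy]
  | tmul z q =>
    rw [whithamLin, LinearMap.baseChange_tmul, complexParamEquiv_tmul, complexParamEquiv_tmul, map_smul,
      smul_comm]
    congr 1
    exact 𝓕.averaged_complexParam hω N hk hA q

end WaveFamily

end HamLattice

end

/-- The inclusion of generalized eigenspaces says that the Jordan blocks at `a α` have size at most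
`m`, so `m = 1` is the semisimple case with exponent 2. The last clause covers a block of size two
at a double eigenvalue. -/
theorem theorem4p3 {d : ℕ} (L : HamLattice.System d) (N : ℕ) [NeZero N]
    (p₀ : HamLattice.Param d) (hk : p₀.1 = 1 / (N : ℝ))
    (𝓕 : HamLattice.WaveFamily L p₀) (hfreq : 𝓕.freq p₀ ≠ 0) (hA : 𝓕.NonDegenerate N)
    (a : Fin (d + 2) → ℂ) (ha : 𝓕.IsCharacteristicSpeeds a) :
    ∃ ε₀ : ℝ, 0 < ε₀ ∧ ∃ ξ₀ ∈ Set.Ioo (0 : ℝ) (Real.pi / N), ∃ lam : Fin (d + 2) → ℝ → ℂ,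
      (∀ α, ContinuousOn (lam α) (Set.Icc (-ξ₀) ξ₀)) ∧
      (∀ ξ ∈ Set.Icc (-ξ₀) ξ₀,
        spectrum ℂ (𝓕.blochEvolution N ξ (1 / 𝓕.freq p₀) 0) ∩ Metric.ball 1 ε₀
          = Set.range fun α => lam α ξ) ∧
      ∀ α,
        (∀ m : ℕ, 1 ≤ m →
          𝓕.whithamLin.maxGenEigenspace (a α) ≤ 𝓕.whithamLin.genEigenspace (a α) m →
          (fun ξ : ℝ => lam α ξ - Complex.exp (1 / 𝓕.freq p₀ * (Complex.I * ξ * a α)))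
            =O[𝓝 0] fun ξ : ℝ => |ξ| ^ (1 + 1 / (m : ℝ))) ∧
        (𝓕.whithamLin.charpoly.rootMultiplicity (a α) ≤ 2 →
          (fun ξ : ℝ => lam α ξ - Complex.exp (1 / 𝓕.freq p₀ * (Complex.I * ξ * a α)))
            =O[𝓝 0] fun ξ : ℝ => |ξ| ^ 2) := by
  set w : ℂ := (𝓕.freq p₀ : ℂ) with hw
  have hw0 : w ≠ 0 := Complex.ofReal_ne_zero.2 hfreq
  have hcomm := 𝓕.complexParamEquiv_whithamLin hfreq N hk hA
  -- The averaged operator lives in the time of the profile, so its eigenvalues are the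
  -- characteristic speeds divided by `ω`; this is the factor `1/ω` in the exponent.
  have hchar := HamLattice.charpoly_of_intertwining _ hcomm hw0
    HamLattice.WaveFamily.finrank_complexParam ha
  have hN : (0 : ℝ) < N := Nat.cast_pos.2 (NeZero.pos N)
  obtain ⟨ε₀, hε₀, ξ₀, hξ₀, lam, hcont, hspec, hlam⟩ :=
    (𝓕.modulationData N hfreq hk hA).exists_curves hchar
      (HamLattice.exists_left_inverse_monodromy N L 𝓕.continuous_u (𝓕.periodic p₀ 𝓕.mem_dom)
        (𝓕.freq p₀)) (div_pos Real.pi_pos hN)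
  have hexp : ∀ α (ξ : ℝ), Complex.exp (1 / w * (Complex.I * ξ * a α))
      = Complex.exp (Complex.I * ξ * (w⁻¹ * a α)) := fun α ξ => by
    congr 1
    rw [one_div]
    ring
  refine ⟨ε₀, hε₀, ξ₀, hξ₀, lam, hcont, fun ξ hξ => ?_, fun α => ⟨fun m hm h => ?_, fun h => ?_⟩⟩
  · rw [𝓕.blochEvolution_eq_monodromy N hfreq hk]
    exact hspec ξ hξ
  · simp only [hexp]
    refine (hlam α).1 m hm (HamLattice.maxGenEigenspace_le_of_intertwining _ hcomm hw0 _ m ?_)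
    rwa [mul_inv_cancel_left₀ hw0]
  · simp only [hexp]
    refine (hlam α).2 ?_
    rw [show 𝓕.whithamLin.charpoly = _ from ha, HamLattice.rootMultiplicity_prod_X_sub_C] at h
    rw [hchar, HamLattice.rootMultiplicity_prod_X_sub_C,
      show (fun α => w⁻¹ * a α) = (fun z => w⁻¹ * z) ∘ a from rfl, ← Multiset.map_map,
      Multiset.count_map_eq_count' _ _ (mul_right_injective₀ (inv_ne_zero hw0))]
    exact h
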